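/- **Setting.** Let $\rho:[0,1]\to[0,1]$ be concave and non-increasing with $\rho(0)(1-\eta)\le\rho(\eta)\le 1-\eta$, write $\rho_0=\rho(0)$, let $\alpha_0>0$, and let $\mathcal W(\rho,\alpha_0,1)$ be the law on $(0,\infty)^2$ with cdf $$H(x,y)=\begin{cases}\exp(-x^{-\alpha_0}), & y\ge x>0,\\ \exp(-y^{-\alpha_0})\{1+\rho((y/x)^{\alpha_0})\,y^{-\alpha_0}\}, & x>y>0.\end{cases}$$ With $\gamma$ the Euler–Mascheroni constant, let $\Upsilon_{r}(x)=r\,\Gamma(x+2)+(1-r)\Gamma(x+1)$, $\Pi_r(y)=\frac1y-\frac{\Upsilon_r'(y)}{\Upsilon_r(y)}+\frac r2-\gamma$, let $\varpi_r$ be the unique zero of $\Pi_r$ on $(0,\infty)$ ($0\le r\le 1$), and put $\alpha_1=\varpi_{\rho_0}\alpha_0$, $z_0=\frac12\Upsilon_{\rho_0}(\varpi_{\rho_0})$, $s_1=z_0^{-1/\alpha_1}$. For each $n$ let $Z_{n,i}=(X_{n,i},Y_{n,i})$, $1\le i\le k_n$, be random vectors in $(0,\infty)^2$, defined on a common probability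 space, with $k_n\ge 2$ and $k_n\to\infty$. Let $(\hat\alpha_n,\hat\sigma_n)$ be the maximizer over $(0,\infty)^2$ of $$\ell(\alpha,\sigma)=2k_n\log\alpha+2k_n\alpha\log\sigma-\sum_{i=1}^{k_n}\{(\alpha+1)\log(X_{n,i}Y_{n,i})+\sigma^\alpha Y_{n,i}^{-\alpha}\}$$ when the pairs $Z_{n,i}$, $i\le k_n$, are not all equal and a maximizer exists (which is automatic for pairs that are not all equal and satisfy $Y_{n,i}\le X_{n,i}$); otherwise set $(\hat\alpha_n,\hat\sigma_n)=(c_n,Y_{n,1})$ with arbitrary constants $c_n\in\mathbb R$. Given an estimator $\hat\rho_{0,n}$ with values in $[0,1]$, let $$\tilde\alpha_n=\hat\alpha_n/\varpi_{\hat\rho_{0,n}},\qquad \tilde\sigma_n=\hat\sigma_n\Big(\frac{\Upsilon_{\hat\rho_{0,n}}(\varpi_{\hat\rho_{0,n}})}{2}\Big)^{1/\hat\alpha_n}.$$ **Assumptions.** $\mathbb P(Z_{n,1}=\dots=Z_{n,k_n})\to0$. There are $\sigma_n>0$ and $0<\alpha_-<\alpha_1<\alpha_+<\infty$ such that $$\frac1{k_n}\sum_{i=1}^{k_n}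 f(X_{n,i}/\sigma_n,Y_{n,i}/\sigma_n)\rightsquigarrow\int_{(0,\infty)^2} f\,\mathrm dH$$ for every $f$ among $\log x$, $\log y$ and, for $\alpha\in(\alpha_-,\alpha_+)$, $y^{-\alpha}$, $y^{-\alpha}\log y$, $y^{-\alpha}(\log y)^2$. There are $0<v_n\to\infty$ and a random vector $\boldsymbol W$ in $\mathbb R^4$ with $\boldsymbol G_n:=(\mathbb G_nf_1,\dots,\mathbb G_nf_4)^\top\rightsquigarrow\boldsymbol W$, where $(f_1,f_2,f_3,f_4)=(y^{-\alpha_1}\log y,\;y^{-\alpha_1},\;\log y,\;\log x)$ and $\mathbb G_nf=v_n\{\frac1{k_n}\sum_{i}f(X_{n,i}/\sigma_n,Y_{n,i}/\sigma_n)-\int f\,\mathrm dH\}$. Finally, $\hat\rho_{0,n}=\rho_0+o_{\mathbb P}(v_n^{-1})$. **Conclusion.** As $n\to\infty$, $$v_n\begin{pmatrix}\tilde\alpha_n-\alpha_0\\ \tilde\sigma_n/\sigma_n-1\end{pmatrix}=M^{\mathrm{bc}}_{\rho_0}(\alpha_0)\,\boldsymbol G_n+o_{\mathbb P}(1)\rightsquigarrow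 M^{\mathrm{bc}}_{\rho_0}(\alpha_0)\boldsymbol W,\qquad M^{\mathrm{bc}}_{\rho_0}(\alpha_0)=\begin{pmatrix}1/\varpi_{\rho_0}&0\\ \alpha_1^{-1}\log s_1&1/s_1\end{pmatrix}M_{\rho_0}(\alpha_0),$$ where $M_{\rho_0}(\alpha_0)=(\beta_{jk})\in\mathbb R^{2\times4}$ is given as follows. With $\Upsilon,\Upsilon',\Upsilon''$ denoting $\Upsilon_{\rho_0}$ and its derivatives at $\varpi_{\rho_0}$, and $D=-\frac2{\alpha_1^2}-\frac{2(\Upsilon''\Upsilon-(\Upsilon')^2)}{\alpha_0^2\Upsilon^2}$, $$(\beta_{11},\beta_{12},\beta_{13},\beta_{14})=\frac1D\Big(-\frac2\Upsilon,\;-\frac{2\Upsilon'}{\alpha_0\Upsilon^2},\;1,\;1\Big),\qquad \beta_{21}=\frac{z_0^{-1/\alpha_1}}{\alpha_1D}\Big\{\frac{\Upsilon'}{2\alpha_0z_0^2}-\frac{\log z_0}{\alpha_1z_0}\Big\},$$ $$\beta_{22}=\frac{z_0^{-1/\alpha_1}}{\alpha_1D}\Big\{\frac{(\Upsilon')^2}{4\alpha_0^2z_0^3}-\frac{\Upsilon'\log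 z_0}{2\alpha_0\alpha_1z_0^2}\Big\}-\frac{z_0^{-1/\alpha_1-1}}{2\alpha_1},\qquad \beta_{23}=\beta_{24}=\frac{z_0^{-1/\alpha_1}}{\alpha_1D}\Big\{\frac{\log z_0}{\alpha_1}-\frac{\Upsilon'}{2\alpha_0z_0}\Big\}.$$ If $\rho_0=1$, then $$M^{\mathrm{bc}}_1(\alpha_0)=M_1(\alpha_0)=\frac6{2\pi^2-3}\begin{pmatrix}\alpha_0^2&\frac{3-2\gamma}2\alpha_0&-\alpha_0^2&-\alpha_0^2\\ \frac{2\gamma-3}2&\frac{3-2\pi^2-3(3-2\gamma)^2}{12\alpha_0}&\frac{3-2\gamma}2&\frac{3-2\gamma}2\end{pmatrix}.$$ -/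

import Mathlib

open MeasureTheory Filter Set
open scoped Topology Matrix

namespace FrechetWelsch

/-- The dependence functions `ρ : [0,1] → [0,1]` (values of `ρ` off `[0,1]` are never used). -/
structure IsWelschFunction (ρ : ℝ → ℝ) : Prop where
  concave : ConcaveOn ℝ (Icc 0 1) ρ
  antitone : AntitoneOn ρ (Icc 0 1)
  mapsTo : MapsTo ρ (Icc 0 1) (Icc 0 1)
  lower : ∀ η ∈ Icc (0 : ℝ) 1, ρ 0 * (1 - η) ≤ ρ η
  upper : ∀ η ∈ Icc (0 : ℝ) 1, ρ η ≤ 1 - η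

lemma IsWelschFunction.lip {ρ : ℝ → ℝ} (h : IsWelschFunction ρ) {x y : ℝ} (hx : 0 ≤ x)
    (hxy : x ≤ y) (hy : y ≤ 1) : ρ x - ρ y ≤ y - x := by
  rcases eq_or_lt_of_le (hxy.trans hy) with h1 | h1
  · have : x = y := le_antisymm hxy (h1 ▸ hy)
    simp [this]
  have hx1 : (0:ℝ) < 1 - x := by linarith
  have hcc := h.concave.2
  have hc := hcc (show x ∈ Icc (0 : ℝ) 1 from ⟨hx, h1.le⟩)
    (show (1 : ℝ) ∈ Icc (0 : ℝ) 1 from ⟨zero_le_one, le_rfl⟩)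
    (show 0 ≤ 1 - (y - x) / (1 - x) by rw [sub_nonneg, div_le_one hx1]; linarith)
    (show 0 ≤ (y - x) / (1 - x) by apply div_nonneg <;> linarith) (by ring)
  have e : (1 - (y - x) / (1 - x)) • x + ((y - x) / (1 - x)) • (1:ℝ) = y := by
    simp only [smul_eq_mul]; field_simp; ring
  rw [e] at hc
  simp only [smul_eq_mul] at hc
  have h1' := (h.mapsTo (x := 1) ⟨zero_le_one, le_rfl⟩).1
  have hu := h.upper x ⟨hx, h1.le⟩
  have ht : 0 ≤ (y - x) / (1 - x) := by apply div_nonneg <;> linarith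
  have h3 : (y - x) / (1 - x) * ρ x ≤ (y - x) / (1 - x) * (1 - x) :=
    mul_le_mul_of_nonneg_left hu ht
  rw [div_mul_cancel₀ _ hx1.ne'] at h3
  nlinarith [mul_nonneg ht h1']

lemma IsWelschFunction.continuousOn {ρ : ℝ → ℝ} (h : IsWelschFunction ρ) :
    ContinuousOn ρ (Icc 0 1) := by
  have : LipschitzOnWith 1 ρ (Icc 0 1) := by
    refine LipschitzOnWith.of_dist_le_mul fun x hx y hy => ?_
    simp only [NNReal.coe_one, one_mul, Real.dist_eq]
    rcases le_total x y with hxy | hxy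
    · rw [abs_of_nonneg (sub_nonneg.2 (h.antitone hx hy hxy)), abs_sub_comm,
        abs_of_nonneg (by linarith)]
      exact h.lip hx.1 hxy hy.2
    · rw [abs_sub_comm, abs_of_nonneg (sub_nonneg.2 (h.antitone hy hx hxy)),
        abs_of_nonneg (by linarith)]
      exact h.lip hy.1 hxy hx.2
  exact this.continuousOn

/-- A concave `ρ` as above is the integrated tail of a distribution function on `[0, 1]`. -/
lemma IsWelschFunction.exists_cdf {ρ : ℝ → ℝ} (h : IsWelschFunction ρ) :
    ∃ F : ℝ → ℝ, Monotone F ∧ (∀ t ≤ 0, F t = 0) ∧ (∀ t, 1 ≤ t → F t = 1) ∧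
      ∀ η ∈ Icc (0 : ℝ) 1, ∫ t in η..1, F t = ρ η := by
  have hder : ∀ x ∈ Ioo (0:ℝ) 1,
      HasDerivWithinAt ρ (derivWithin ρ (Ioi x) x) (Ioi x) x := fun x hx => by
    have := h.concave.neg.hasDerivWithinAt_rightDeriv_of_mem_interior
      (x := x) (by rwa [interior_Icc])
    have h2 := this.neg
    rw [neg_neg] at h2
    exact h2.differentiableWithinAt.hasDerivWithinAt
  have hmono : ∀ x ∈ Ioo (0:ℝ) 1, ∀ y ∈ Ioo (0:ℝ) 1, x ≤ y →
      -derivWithin ρ (Ioi x) x ≤ -derivWithin ρ (Ioi y) y := fun x hx y hy hxy => by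
    have := h.concave.neg.monotoneOn_rightDeriv (a := x) (by rwa [interior_Icc]) (b := y)
      (by rwa [interior_Icc]) hxy
    simpa [derivWithin.neg] using this
  have hb : ∀ x ∈ Ioo (0:ℝ) 1, 0 ≤ -derivWithin ρ (Ioi x) x ∧ -derivWithin ρ (Ioi x) x ≤ 1 := by
    intro x hx
    constructor
    · have hm : ∀ᶠ y in 𝓝[>] x, slope ρ x y ≤ 0 := by
        filter_upwards [Ioo_mem_nhdsGT hx.2] with y hy
        rw [slope_def_field]
        exact div_nonpos_of_nonpos_of_nonneg
          (sub_nonpos.2 (h.antitone ⟨hx.1.le, hx.2.le⟩ ⟨(hx.1.trans hy.1).le, hy.2.le⟩ hy.1.le))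
          (by linarith [hy.1])
      have ht := (hasDerivWithinAt_iff_tendsto_slope' (by simp)).1 (hder x hx)
      linarith [le_of_tendsto ht hm]
    · have := h.concave.slope_le_rightDeriv (x := x) (y := 1) ⟨hx.1.le, hx.2.le⟩
        ⟨zero_le_one, le_rfl⟩ hx.2 (hder x hx).differentiableWithinAt
      have h1' := (h.mapsTo (x := 1) ⟨zero_le_one, le_rfl⟩).1
      have hu := h.upper x ⟨hx.1.le, hx.2.le⟩
      have h2 : (-1:ℝ) ≤ slope ρ x 1 := by
        rw [slope_def_field, le_div_iff₀ (by linarith [hx.2])]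
        linarith
      linarith
  refine ⟨fun t => if t ≤ 0 then 0 else if t < 1 then -derivWithin ρ (Ioi t) t else 1,
    ?_, fun t ht => by simp [ht], fun t ht => by
      simp [not_le.2 (zero_lt_one.trans_le ht), not_lt.2 ht], ?_⟩
  · intro a b hab
    dsimp only
    split_ifs with h1 h2 h3 h4 h5 h6 <;> try linarith
    · exact (hb b ⟨not_le.1 h2, h3⟩).1
    · exact hmono a ⟨not_le.1 h1, h4⟩ b ⟨by linarith, h6⟩ hab
    · exact (hb a ⟨not_le.1 h1, h4⟩).2
  · intro η hη
    set F : ℝ → ℝ := fun t => if t ≤ 0 then 0 else if t < 1 then -derivWithin ρ (Ioi t) t else 1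
    have hF : Monotone F := by
      intro a b hab
      simp only [F]
      split_ifs with h1 h2 h3 h4 h5 h6 <;> try linarith
      · exact (hb b ⟨not_le.1 h2, h3⟩).1
      · exact hmono a ⟨not_le.1 h1, h4⟩ b ⟨by linarith, h6⟩ hab
      · exact (hb a ⟨not_le.1 h1, h4⟩).2
    have := intervalIntegral.integral_eq_sub_of_hasDeriv_right_of_le (f := fun x => -ρ x) (f' := F)
      hη.2 (h.continuousOn.neg.mono (Icc_subset_Icc_left hη.1)) (fun x hx => by
        have hx' : x ∈ Ioo (0:ℝ) 1 := ⟨hη.1.trans_lt hx.1, hx.2⟩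
        have : F x = -derivWithin ρ (Ioi x) x := by simp [F, not_le.2 hx'.1, hx'.2]
        rw [this]
        exact (hder x hx').neg) hF.intervalIntegrable
    rw [this]
    have h1' := (h.mapsTo (x := 1) ⟨zero_le_one, le_rfl⟩).1
    have hu := h.upper 1 ⟨zero_le_one, le_rfl⟩
    have : ρ 1 = 0 := by linarith
    simp [this]


/-- The joint cdf `H_{ρ,α,σ}` of the Fréchet-Welsch distribution `W(ρ, α, σ)`. -/
noncomputable def frechetWelschCDF (ρ : ℝ → ℝ) (α σ x y : ℝ) : ℝ :=
  if 0 < x ∧ 0 < y then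
    if x ≤ y then Real.exp (-(x / σ) ^ (-α))
    else Real.exp (-(y / σ) ^ (-α)) * (1 + ρ ((y / x) ^ α) * (y / σ) ^ (-α))
  else 0

/-- `P` is a probability measure on the plane with joint cdf `H_{ρ,α,σ}`. -/
def IsFrechetWelschLaw (ρ : ℝ → ℝ) (α σ : ℝ) (P : Measure (ℝ × ℝ)) : Prop :=
  IsProbabilityMeasure P ∧
    ∀ x y : ℝ, P (Iic x ×ˢ Iic y) = ENNReal.ofReal (frechetWelschCDF ρ α σ x y)

lemma IsWelschFunction.exists_stieltjes {ρ : ℝ → ℝ} (h : IsWelschFunction ρ) :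
    ∃ G : StieltjesFunction ℝ, (∀ t, 0 ≤ G t) ∧ (∀ t < 0, G t = 0) ∧ (∀ t, 1 ≤ t → G t = 1) ∧
      ∀ η ∈ Icc (0 : ℝ) 1, ∫ t in η..1, G t = ρ η := by
  obtain ⟨F, hF, h0, h1, hint⟩ := h.exists_cdf
  have hpos : ∀ t, 0 ≤ F t := fun t => by
    rcases le_total t 0 with ht | ht
    · rw [h0 t ht]
    · rw [← h0 0 le_rfl]; exact hF ht
  refine ⟨hF.stieltjesFunction, fun t => ?_, fun t ht => ?_, fun t ht => ?_, fun η hη => ?_⟩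
  · rw [hF.stieltjesFunction_eq]; exact (hpos t).trans (hF.le_rightLim le_rfl)
  · rw [hF.stieltjesFunction_eq]
    refine le_antisymm ((hF.rightLim_le ht).trans (h0 0 le_rfl).le) ?_
    exact (hpos t).trans (hF.le_rightLim le_rfl)
  · rw [hF.stieltjesFunction_eq]
    refine le_antisymm ((hF.rightLim_le (lt_add_one t)).trans (h1 _ (by linarith)).le) ?_
    rw [← h1 t ht]; exact hF.le_rightLim le_rfl
  · rw [← hint η hη]
    refine intervalIntegral.integral_congr_ae ?_
    filter_upwards [hF.countable_not_continuousAt.ae_notMem volume] with t ht _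
    rw [hF.stieltjesFunction_eq]
    have ht' : ContinuousAt F t := not_not.1 ht
    exact (hF.continuousWithinAt_Ioi_iff_rightLim_eq.1 ht'.continuousWithinAt)

/-- The standard exponential distribution. -/
noncomputable def stdExp : Measure ℝ :=
  (volume.restrict (Ioi 0)).withDensity fun s => ENNReal.ofReal (Real.exp (-s))

lemma lintegral_exp_neg (a : ℝ) :
    ∫⁻ s in Ioi a, ENNReal.ofReal (Real.exp (-s)) = ENNReal.ofReal (Real.exp (-a)) := by
  rw [← ofReal_integral_eq_lintegral_ofReal, integral_exp_neg_Ioi]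
  · have := integrableOn_exp_mul_Ioi (a := -1) (by norm_num) a
    simp only [neg_one_mul] at this
    exact this
  · exact ae_of_all _ fun s => (Real.exp_pos _).le

instance : IsProbabilityMeasure stdExp := ⟨by
  rw [stdExp, withDensity_apply _ MeasurableSet.univ, Measure.restrict_univ, lintegral_exp_neg]
  simp⟩

lemma stdExp_tail (a : ℝ) :
    stdExp {e | a ≤ max e 0} = ENNReal.ofReal (Real.exp (-max a 0)) := by
  rcases le_total a 0 with ha | ha
  · have : {e : ℝ | a ≤ max e 0} = univ := by ext e; simp [ha]
    rw [this, measure_univ, max_eq_right ha]; simp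
  · have hm : MeasurableSet {e : ℝ | a ≤ max e 0} :=
      measurableSet_le measurable_const (measurable_id.max measurable_const)
    rw [stdExp, withDensity_apply _ hm, Measure.restrict_restrict hm, max_eq_left ha,
      ← lintegral_exp_neg]
    refine setLIntegral_congr ?_
    refine (Filter.EventuallyEq.trans ?_ (Ioi_ae_eq_Ici (a := a)).symm)
    have hz : ∀ᵐ e : ℝ, e ≠ 0 := by simp [ae_iff]
    filter_upwards [hz] with e he
    refine propext ⟨?_, ?_⟩
    · rintro ⟨h1, h2⟩
      change a ≤ max e 0 at h1
      rwa [max_eq_left (le_of_lt h2)] at h1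
    · intro h1
      change a ≤ e at h1
      exact ⟨h1.trans (le_max_left _ _), lt_of_le_of_ne (ha.trans h1) he.symm⟩

lemma IsFrechetWelschLaw.unique {ρ : ℝ → ℝ} {α σ : ℝ} {P Q : Measure (ℝ × ℝ)}
    (hP : IsFrechetWelschLaw ρ α σ P) (hQ : IsFrechetWelschLaw ρ α σ Q) : P = Q := by
  have := hP.1
  have := hQ.1
  have hspan : IsCountablySpanning (range (Iic : ℝ → Set ℝ)) :=
    ⟨fun n : ℕ => Iic (n : ℝ), fun n => ⟨_, rfl⟩, by
      refine eq_univ_of_forall fun x => mem_iUnion.2 ?_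
      obtain ⟨n, hn⟩ := exists_nat_ge x
      exact ⟨n, hn⟩⟩
  have hgen : (inferInstance : MeasurableSpace ℝ) =
      MeasurableSpace.generateFrom (range (Iic : ℝ → Set ℝ)) := by
    rw [← borel_eq_generateFrom_Iic]; exact BorelSpace.measurable_eq
  refine ext_of_generate_finite _
    (generateFrom_eq_prod hgen.symm hgen.symm hspan hspan).symm
    (isPiSystem_Iic.prod isPiSystem_Iic) ?_ (by simp)
  rintro _ ⟨_, ⟨x, rfl⟩, _, ⟨y, rfl⟩, rfl⟩
  rw [hP.2, hQ.2]

theorem exists_frechetWelschLaw {ρ : ℝ → ℝ} (h : IsWelschFunction ρ) {α σ : ℝ} (hα : 0 < α)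
    (hσ : 0 < σ) : ∃ P, IsFrechetWelschLaw ρ α σ P := by
  obtain ⟨G, hG, hG0, hG1, hint⟩ := h.exists_stieltjes
  have hbot : Tendsto G atBot (𝓝 0) :=
    tendsto_const_nhds.congr' (by
      filter_upwards [eventually_lt_atBot 0] with t ht using (hG0 t ht).symm)
  have htop : Tendsto G atTop (𝓝 1) :=
    tendsto_const_nhds.congr' (by
      filter_upwards [eventually_ge_atTop 1] with t ht using (hG1 t ht).symm)
  have : IsProbabilityMeasure G.measure := G.isProbabilityMeasure hbot htop
  set T : ℝ × ℝ × ℝ → ℝ × ℝ := fun p => (σ * p.1 ^ (-α⁻¹),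
    σ * max ((p.1 + max p.2.1 0) ^ (-α⁻¹)) ((max p.2.2 0 / p.1) ^ α⁻¹)) with hT
  have hTm : Measurable T := by fun_prop
  refine ⟨(stdExp.prod (stdExp.prod G.measure)).map T,
    Measure.isProbabilityMeasure_map hTm.aemeasurable, fun x y => ?_⟩
  have hms : MeasurableSet (Iic x ×ˢ Iic y) := measurableSet_Iic.prod measurableSet_Iic
  rw [Measure.map_apply hTm hms, Measure.prod_apply (hTm hms), stdExp,
    lintegral_withDensity_eq_lintegral_mul _ (by fun_prop)
      (measurable_measure_prodMk_left (hTm hms)), ← stdExp]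
  by_cases hxy : 0 < x ∧ 0 < y
  swap
  · rw [frechetWelschCDF, if_neg hxy, ENNReal.ofReal_zero]
    refine (setLIntegral_congr_fun measurableSet_Ioi (g := fun _ => 0) fun s hs => ?_).trans
      (by simp)
    have hs' : (0 : ℝ) < s := hs
    have hemp : Prod.mk s ⁻¹' (T ⁻¹' (Iic x ×ˢ Iic y)) = ∅ := by
      refine eq_empty_of_forall_notMem fun p hp => hxy ?_
      have h1 : σ * s ^ (-α⁻¹) ≤ x := hp.1
      have h2 : σ * max ((s + max p.1 0) ^ (-α⁻¹)) ((max p.2 0 / s) ^ α⁻¹) ≤ y := hp.2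
      have h3 : 0 < s + max p.1 0 := add_pos_of_pos_of_nonneg hs' (le_max_right _ _)
      refine ⟨lt_of_lt_of_le (by positivity) h1, lt_of_lt_of_le ?_ h2⟩
      exact mul_pos hσ (lt_max_of_lt_left (Real.rpow_pos_of_pos h3 _))
    simp only [Pi.mul_apply, hemp, measure_empty, mul_zero]
  obtain ⟨hx, hy⟩ := hxy
  set u := (x / σ) ^ (-α) with hu
  set v := (y / σ) ^ (-α) with hv
  have hu0 : 0 < u := by positivity
  have hv0 : 0 < v := by positivity
  have hiff : ∀ s z : ℝ, 0 < s → 0 < z → (σ * s ^ (-α⁻¹) ≤ z ↔ (z / σ) ^ (-α) ≤ s) := by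
    intro s z hs hz
    rw [← Real.rpow_inv_le_iff_of_neg hs (by positivity) (by linarith), inv_neg, le_div_iff₀ hσ,
      mul_comm]
  have hiff2 : ∀ t : ℝ, 0 ≤ t → (σ * t ^ α⁻¹ ≤ y ↔ t ≤ v⁻¹) := by
    intro t ht
    rw [hv, Real.rpow_neg (by positivity), inv_inv, ← Real.rpow_inv_le_iff_of_pos ht (by positivity)
      hα, le_div_iff₀ hσ, mul_comm]
  have hmain : ∀ s ∈ Ioi (0 : ℝ), ENNReal.ofReal (Real.exp (-s)) *
      (stdExp.prod G.measure) (Prod.mk s ⁻¹' (T ⁻¹' (Iic x ×ˢ Iic y))) =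
      (Ici u).indicator (fun s => ENNReal.ofReal (Real.exp (-max s v) * G (s / v))) s := by
    intro s hs
    have hs' : (0 : ℝ) < s := hs
    by_cases hus : u ≤ s
    · have hfib : Prod.mk s ⁻¹' (T ⁻¹' (Iic x ×ˢ Iic y)) =
          {e | v - s ≤ max e 0} ×ˢ Iic (s / v) := by
        ext ⟨e, b⟩
        have h3 : 0 < s + max e 0 := add_pos_of_pos_of_nonneg hs' (le_max_right _ _)
        have hb : 0 ≤ max b 0 / s := div_nonneg (le_max_right _ _) hs'.le
        change (σ * s ^ (-α⁻¹) ≤ x ∧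
          σ * max ((s + max e 0) ^ (-α⁻¹)) ((max b 0 / s) ^ α⁻¹) ≤ y) ↔
          (v - s ≤ max e 0 ∧ b ≤ s / v)
        rw [mul_max_of_nonneg _ _ hσ.le, max_le_iff, hiff s x hs' hx, hiff _ y h3 hy, hiff2 _ hb,
          div_le_iff₀ hs', max_le_iff, ← hv, ← hu]
        have h4 : v⁻¹ * s = s / v := by rw [div_eq_mul_inv, mul_comm]
        have h5 : 0 ≤ s / v := by positivity
        rw [h4]
        constructor
        · rintro ⟨-, h6, h7, -⟩; exact ⟨by linarith, h7⟩
        · rintro ⟨h6, h7⟩; exact ⟨hus, by linarith, h7, h5⟩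
      rw [hfib, Measure.prod_prod, stdExp_tail, G.measure_Iic hbot, indicator_of_mem (mem_Ici.2 hus), sub_zero,
        ← mul_assoc, ← ENNReal.ofReal_mul (Real.exp_pos _).le, ← Real.exp_add,
        ← ENNReal.ofReal_mul (Real.exp_pos _).le]
      congr 3
      rcases le_total s v with h6 | h6
      · rw [max_eq_left (by linarith), max_eq_right h6]; ring_nf
      · rw [max_eq_right (by linarith), max_eq_left h6]; ring_nf
    · have hemp : Prod.mk s ⁻¹' (T ⁻¹' (Iic x ×ˢ Iic y)) = ∅ := by
        refine eq_empty_of_forall_notMem fun p hp => hus ?_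
        exact (hiff s x hs' hx).1 hp.1
      rw [hemp, measure_empty, mul_zero, indicator_of_notMem (fun h' => hus (mem_Ici.1 h'))]
  refine (setLIntegral_congr_fun measurableSet_Ioi hmain).trans ?_
  rw [lintegral_indicator measurableSet_Ici, Measure.restrict_restrict measurableSet_Ici,
    show Ici u ∩ Ioi 0 = Ici u from inter_eq_left.2 fun s hs => hu0.trans_le (mem_Ici.1 hs),
    setLIntegral_congr Ioi_ae_eq_Ici.symm]
  have htail : ∀ a, v ≤ a → ∫⁻ s in Ioi a, ENNReal.ofReal (Real.exp (-max s v) * G (s / v)) =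
      ENNReal.ofReal (Real.exp (-a)) := by
    intro a ha
    rw [← lintegral_exp_neg]
    refine setLIntegral_congr_fun measurableSet_Ioi fun s hs => ?_
    have hs' : a < s := hs
    rw [max_eq_left (by linarith), hG1 _ ((one_le_div hv0).2 (by linarith)), mul_one]
  rw [frechetWelschCDF, if_pos ⟨hx, hy⟩]
  by_cases hle : x ≤ y
  · rw [if_pos hle]
    exact htail u (Real.rpow_le_rpow_of_nonpos (by positivity)
      (div_le_div_of_nonneg_right hle hσ.le) (by linarith))
  rw [if_neg hle]
  have huv : u ≤ v := Real.rpow_le_rpow_of_nonpos (by positivity)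
      (div_le_div_of_nonneg_right (not_le.1 hle).le hσ.le) (by linarith)
  have hquot : (y / x) ^ α = u / v := by
    rw [hu, hv, Real.rpow_neg (by positivity), Real.rpow_neg (by positivity), inv_div_inv,
      ← Real.div_rpow (by positivity) (by positivity), div_div_div_cancel_right₀ hσ.ne']
  have hquot_mem : u / v ∈ Icc (0 : ℝ) 1 := ⟨by positivity, (div_le_one hv0).2 huv⟩
  have hmeas : Measurable fun s => G (s / v) := G.mono.measurable.comp (measurable_id.div_const v)
  have hbody : ∫⁻ s in Ioc u v, ENNReal.ofReal (Real.exp (-max s v) * G (s / v)) =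
      ENNReal.ofReal (Real.exp (-v) * (v * ρ (u / v))) := by
    have hi : IntervalIntegrable (fun s => Real.exp (-v) * G (s / v)) volume u v := by
      refine IntervalIntegrable.const_mul ?_ _
      exact (G.mono.comp fun a b hab => div_le_div_of_nonneg_right hab hv0.le).intervalIntegrable
    have e1 : ∫⁻ s in Ioc u v, ENNReal.ofReal (Real.exp (-max s v) * G (s / v)) =
        ∫⁻ s in Ioc u v, ENNReal.ofReal (Real.exp (-v) * G (s / v)) :=
      setLIntegral_congr_fun measurableSet_Ioc fun s hs => by
        rw [max_eq_right hs.2]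
    rw [e1, ← ofReal_integral_eq_lintegral_ofReal
      ((intervalIntegrable_iff_integrableOn_Ioc_of_le huv).1 hi)
      (ae_of_all _ fun s => mul_nonneg (Real.exp_pos _).le (hG _)),
      ← intervalIntegral.integral_of_le huv, intervalIntegral.integral_const_mul,
      intervalIntegral.integral_comp_div (fun t => G t) hv0.ne', div_self hv0.ne',
      hint _ hquot_mem, smul_eq_mul]
  rw [← Ioc_union_Ioi_eq_Ioi huv, lintegral_union measurableSet_Ioi
    (by rw [Set.disjoint_left]; exact fun s hs hs' => absurd hs.2 (not_le.2 hs')),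
    hbody, htail v le_rfl, hquot, ← ENNReal.ofReal_add]
  · congr 1; ring
  · have := (h.mapsTo hquot_mem).1
    positivity
  · positivity

open Classical in
/-- The Fréchet-Welsch distribution `W(ρ, α, σ)`: the probability measure on the plane with joint
cdf `H_{ρ,α,σ}`. It exists and is unique for admissible `ρ` and `α, σ > 0`. -/
noncomputable def frechetWelsch (ρ : ℝ → ℝ) (α σ : ℝ) : Measure (ℝ × ℝ) :=
  if h : ∃ P, IsFrechetWelschLaw ρ α σ P then h.choose else 0

theorem frechetWelsch_spec {ρ : ℝ → ℝ} (h : IsWelschFunction ρ) {α σ : ℝ} (hα : 0 < α)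
    (hσ : 0 < σ) : IsFrechetWelschLaw ρ α σ (frechetWelsch ρ α σ) := by
  have hex := exists_frechetWelschLaw h hα hσ
  rw [frechetWelsch, dif_pos hex]
  exact hex.choose_spec

/-! ### The pseudo maximum likelihood estimator -/

/-- The independence log-likelihood `ℓ(α, σ | z)` of the standard Fréchet-Welsch model. -/
noncomputable def logLik {k : ℕ} (z : Fin k → ℝ × ℝ) (α σ : ℝ) : ℝ :=
  2 * k * Real.log α + 2 * k * α * Real.log σ
    - ∑ i, ((α + 1) * Real.log ((z i).1 * (z i).2) + σ ^ α * (z i).2 ^ (-α))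

/-- `θ = (α, σ)` maximizes the log-likelihood over `(0,∞)²`. -/
def IsMLE {k : ℕ} (z : Fin k → ℝ × ℝ) (θ : ℝ × ℝ) : Prop :=
  θ ∈ Ioi (0 : ℝ) ×ˢ Ioi (0 : ℝ) ∧
    IsMaxOn (fun θ' : ℝ × ℝ => logLik z θ'.1 θ'.2) (Ioi (0 : ℝ) ×ˢ Ioi (0 : ℝ)) θ

open Classical in
/-- The estimator `(α̂, σ̂)`: the maximizer of the log-likelihood if the pairs are not all equal;
otherwise (or should there be no maximizer, which does not happen when `0 < y i ≤ x i`) it is the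
conventional value `(c, y₁)`. -/
noncomputable def mle {k : ℕ} (c : ℝ) (z : Fin k → ℝ × ℝ) : ℝ × ℝ :=
  if h : (¬ ∀ i j, z i = z j) ∧ ∃ θ, IsMLE z θ then h.2.choose
  else (c, if hk : 0 < k then (z ⟨0, hk⟩).2 else 1)

/-! ### Bias constants -/

/-- `Υ_{ρ₀}(x) = ρ₀ Γ(x+2) + (1-ρ₀) Γ(x+1)`. -/
noncomputable def Upsilon (ρ₀ x : ℝ) : ℝ :=
  ρ₀ * Real.Gamma (x + 2) + (1 - ρ₀) * Real.Gamma (x + 1)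

/-- `Π_{ρ₀}(y) = 1/y - Υ'(y)/Υ(y) + ρ₀/2 - γ`. -/
noncomputable def PiFun (ρ₀ y : ℝ) : ℝ :=
  1 / y - deriv (Upsilon ρ₀) y / Upsilon ρ₀ y + ρ₀ / 2 - Real.eulerMascheroniConstant

/-- `ϖ_{ρ₀}`, the (unique) zero of `Π_{ρ₀}` on `(0, ∞)`. -/
noncomputable def varpi (ρ₀ : ℝ) : ℝ :=
  Classical.epsilon fun y : ℝ => 0 < y ∧ PiFun ρ₀ y = 0

/-- `α₁ = ϖ_{ρ₀} α₀`. -/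
noncomputable def alphaOne (ρ₀ α₀ : ℝ) : ℝ := varpi ρ₀ * α₀

/-- `s₁ = (2 / Υ_{ρ₀}(ϖ_{ρ₀}))^{1/α₁}`. -/
noncomputable def sOne (ρ₀ α₀ : ℝ) : ℝ :=
  (2 / Upsilon ρ₀ (varpi ρ₀)) ^ (1 / alphaOne ρ₀ α₀)

/-- `α̃ = α̂ / ϖ_{ρ̂₀}`. -/
noncomputable def alphaTilde (θ : ℝ × ℝ) (r : ℝ) : ℝ := θ.1 / varpi r

/-- `σ̃ = σ̂ (Υ_{ρ̂₀}(ϖ_{ρ̂₀}) / 2)^{1/α̂}`. -/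
noncomputable def sigmaTilde (θ : ℝ × ℝ) (r : ℝ) : ℝ :=
  θ.2 * (Upsilon r (varpi r) / 2) ^ (1 / θ.1)

/-! ### Function classes and empirical quantities -/

/-- The class `F₁(a, b)`. -/
def classF1 (a b : ℝ) : Set (ℝ × ℝ → ℝ) :=
  {fun p => Real.log p.1} ∪ {fun p => Real.log p.2}
    ∪ {f | ∃ α, a < α ∧ α < b ∧ f = fun p => p.2 ^ (-α)}
    ∪ {f | ∃ α, a < α ∧ α < b ∧ f = fun p => p.2 ^ (-α) * Real.log p.2}

/-- The class `F₂(a, b)`. -/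
def classF2 (a b : ℝ) : Set (ℝ × ℝ → ℝ) :=
  classF1 a b ∪ {f | ∃ α, a < α ∧ α < b ∧ f = fun p => p.2 ^ (-α) * Real.log p.2 ^ 2}

/-- The functions `(f₁, f₂, f₃, f₄)`. -/
noncomputable def fVec (α₁ : ℝ) : Fin 4 → ℝ × ℝ → ℝ :=
  ![fun p => p.2 ^ (-α₁) * Real.log p.2, fun p => p.2 ^ (-α₁),
    fun p => Real.log p.2, fun p => Real.log p.1]

/-- The average of `f` over the rescaled sample `z / σ`. -/
noncomputable def empMean {k : ℕ} (z : Fin k → ℝ × ℝ) (σ : ℝ) (f : ℝ × ℝ → ℝ) : ℝ :=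
  (1 / (k : ℝ)) * ∑ i, f ((z i).1 / σ, (z i).2 / σ)

/-- The integral of `f` over `(0,∞)²` with respect to `W(ρ, α₀, 1)`. -/
noncomputable def fwIntegral (ρ : ℝ → ℝ) (α₀ : ℝ) (f : ℝ × ℝ → ℝ) : ℝ :=
  ∫ p in Ioi (0 : ℝ) ×ˢ Ioi (0 : ℝ), f p ∂(frechetWelsch ρ α₀ 1)

/-- The vector `(G_n f₁, …, G_n f₄)` with rate `v`, sample `z` and scale `σ`. -/
noncomputable def gVec {k : ℕ} (ρ : ℝ → ℝ) (α₀ v σ : ℝ) (z : Fin k → ℝ × ℝ) : Fin 4 → ℝ :=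
  fun j => v * (empMean z σ (fVec (alphaOne (ρ 0) α₀) j)
    - fwIntegral ρ α₀ (fVec (alphaOne (ρ 0) α₀) j))

/-! ### The matrices of the linear expansions -/

/-- The slope `-2/α₁² - 2 (Υ'' Υ - (Υ')²) / (α₀² Υ²)`, with `Υ = Υ_{ρ₀}` evaluated at `ϖ_{ρ₀}`. -/
noncomputable def psiDot (ρ₀ α₀ : ℝ) : ℝ :=
  -2 / alphaOne ρ₀ α₀ ^ 2
    - 2 * (deriv (deriv (Upsilon ρ₀)) (varpi ρ₀) * Upsilon ρ₀ (varpi ρ₀)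
        - deriv (Upsilon ρ₀) (varpi ρ₀) ^ 2) / (α₀ ^ 2 * Upsilon ρ₀ (varpi ρ₀) ^ 2)

/-- The `2 × 4` matrix `M_{ρ₀}(α₀)` of the uncorrected estimator. -/
noncomputable def matM (ρ₀ α₀ : ℝ) : Matrix (Fin 2) (Fin 4) ℝ :=
  let U := Upsilon ρ₀ (varpi ρ₀)
  let U' := deriv (Upsilon ρ₀) (varpi ρ₀)
  let D := psiDot ρ₀ α₀
  let α₁ := alphaOne ρ₀ α₀
  let z₀ := U / 2
  let C := z₀ ^ (-1 / α₁) / (α₁ * D)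
  !![-(2 / U) / D, -(2 * U' / (α₀ * U ^ 2)) / D, 1 / D, 1 / D;
    C * (U' / (2 * α₀ * z₀ ^ 2) - Real.log z₀ / (α₁ * z₀)),
    C * (U' ^ 2 / (4 * α₀ ^ 2 * z₀ ^ 3) - U' * Real.log z₀ / (2 * α₀ * α₁ * z₀ ^ 2))
      - z₀ ^ (-1 / α₁ - 1) / (2 * α₁),
    C * (Real.log z₀ / α₁ - U' / (2 * α₀ * z₀)),
    C * (Real.log z₀ / α₁ - U' / (2 * α₀ * z₀))]

/-- The matrix `M^bc_{ρ₀}(α₀)` of the bias-corrected estimator. -/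
noncomputable def matMbc (ρ₀ α₀ : ℝ) : Matrix (Fin 2) (Fin 4) ℝ :=
  !![1 / varpi ρ₀, 0;
    Real.log (sOne ρ₀ α₀) / alphaOne ρ₀ α₀, 1 / sOne ρ₀ α₀] * matM ρ₀ α₀

/-- The closed form of `M_1(α₀)`. -/
noncomputable def matMOne (α₀ : ℝ) : Matrix (Fin 2) (Fin 4) ℝ :=
  let g := Real.eulerMascheroniConstant
  (6 / (2 * Real.pi ^ 2 - 3)) •
    !![α₀ ^ 2, (3 - 2 * g) / 2 * α₀, -α₀ ^ 2, -α₀ ^ 2;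
      (2 * g - 3) / 2, (3 - 2 * Real.pi ^ 2 - 3 * (3 - 2 * g) ^ 2) / (12 * α₀),
      (3 - 2 * g) / 2, (3 - 2 * g) / 2]

end FrechetWelsch

open FrechetWelsch

/-! Under the limit law, `Y ^ (-α₀)` is a mixture of Gamma variables of shapes 1 and 2 with weights
`1 - ρ₀` and `ρ₀`. So the integral of `y ^ (-a)` is `Υ(a / α₀)`, and each factor `log y` costs a
derivative and a factor `-1 / α₀`. Moreover `Υ` is the moment generating function of `log t`, hence
analytic, positive and log-convex where it is used.

Maximizing the likelihood over the scale first forces `(σ / σ_n) ^ a` times the mean of `(Y / σ_n) ^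
(-a)` to equal 2. What remains is a profile in `a` whose derivative, the score, is strictly
decreasing by Cauchy-Schwarz. The score converges pointwise to `(2 / α₀) Π(a / α₀)`, which changes
sign only at `α₁ = ϖ α₀`; this gives consistency (`eventually_mle_mem`). By the mean value theorem
`α̂ - α₁` is minus the score at `α₁` divided by a slope. The numerator is linear in the four centred
averages, with random but convergent coefficients. The slope involves moments at random arguments,
which converge because empirical exponential moments are convex or monotone in the exponent; no
uniform law of large numbers is needed. The scale follows from its explicit equation and the shape
expansion (`exists_shape_expansion`, `exists_scale_expansion`). Since `ϖ_r` and `log Υ_r(ϖ_r)` are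
locally Lipschitz in `r`, estimating `ρ₀` at rate `o(1 / v_n)` contributes nothing.

All this is deterministic calculus along a filter on `ℕ × Ω` in which convergence means convergence
in probability. The remainder is `o(1 + ‖G_n‖)`; tightness of `G_n` makes it `o_P(1)`, and Slutsky's
lemma gives the limit law, once the estimator is known to be measurable. For `ρ₀ = 1` the entries
reduce to trigamma values, found by differentiating the reflection formula. -/

namespace FrechetWelsch

open ProbabilityTheory Asymptotics

/-! ### The law of `Y ^ (-α)` and its moment generating function -/

/-- The mixture with weights `1 - r` and `r` of the Gamma distributions with shapes `1` and `2`. -/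
noncomputable def gammaMixture (r : ℝ) : Measure ℝ :=
  (volume.restrict (Ioi 0)).withDensity fun t => ENNReal.ofReal (Real.exp (-t) * (1 - r + r * t))

lemma gammaMixture_density_nonneg {r t : ℝ} (hr : r ∈ Icc (0 : ℝ) 1) (ht : 0 < t) :
    0 ≤ Real.exp (-t) * (1 - r + r * t) := by
  have h1 := hr.1
  have h2 := hr.2
  have : 0 ≤ 1 - r := by linarith
  positivity

lemma integral_gammaMixture {r : ℝ} (hr : r ∈ Icc (0 : ℝ) 1) (f : ℝ → ℝ) :
    ∫ t, f t ∂(gammaMixture r) = ∫ t in Ioi 0, Real.exp (-t) * (1 - r + r * t) * f t := by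
  rw [gammaMixture, integral_withDensity_eq_integral_toReal_smul (by fun_prop) (by simp)]
  refine setIntegral_congr_fun measurableSet_Ioi fun t ht => ?_
  simp only [smul_eq_mul]
  rw [ENNReal.toReal_ofReal (gammaMixture_density_nonneg hr ht)]

lemma integrable_gammaMixture_iff {r : ℝ} (hr : r ∈ Icc (0 : ℝ) 1) (f : ℝ → ℝ) :
    Integrable f (gammaMixture r) ↔
      IntegrableOn (fun t => Real.exp (-t) * (1 - r + r * t) * f t) (Ioi 0) := by
  rw [gammaMixture, integrable_withDensity_iff_integrable_smul' (by fun_prop) (by simp)]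
  refine integrableOn_congr_fun (fun t ht => ?_) measurableSet_Ioi
  simp only [smul_eq_mul]
  rw [ENNReal.toReal_ofReal (gammaMixture_density_nonneg hr ht)]

lemma gammaMixture_integrand_eq (r s : ℝ) {t : ℝ} (ht : 0 < t) :
    Real.exp (-t) * (1 - r + r * t) * Real.exp (s * Real.log t) =
      r * (Real.exp (-t) * t ^ (s + 2 - 1)) + (1 - r) * (Real.exp (-t) * t ^ (s + 1 - 1)) := by
  rw [show s + 2 - 1 = s + 1 by ring, Real.rpow_add ht, Real.rpow_one, add_sub_cancel_right,
    mul_comm s, ← Real.rpow_def_of_pos ht]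
  ring

lemma integrable_exp_mul_log_gammaMixture {r : ℝ} (hr : r ∈ Icc (0 : ℝ) 1) {s : ℝ} (hs : -1 < s) :
    Integrable (fun t => Real.exp (s * Real.log t)) (gammaMixture r) := by
  rw [integrable_gammaMixture_iff hr,
    integrableOn_congr_fun (s := Ioi 0) (g := fun t => r * (Real.exp (-t) * t ^ (s + 2 - 1)) +
      (1 - r) * (Real.exp (-t) * t ^ (s + 1 - 1)))
      (fun t ht => gammaMixture_integrand_eq r s ht) measurableSet_Ioi]
  exact ((Real.GammaIntegral_convergent (by linarith)).const_mul _).add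
    ((Real.GammaIntegral_convergent (by linarith)).const_mul _)

/-- Each mixture component contributes one Gamma function. Reading `Υ_r` as a moment generating
function supplies its derivatives as integrals, its positivity and its log-convexity. -/
lemma mgf_log_gammaMixture {r : ℝ} (hr : r ∈ Icc (0 : ℝ) 1) {s : ℝ} (hs : -1 < s) :
    mgf Real.log (gammaMixture r) s = Upsilon r s := by
  rw [mgf, integral_gammaMixture hr,
    setIntegral_congr_fun measurableSet_Ioi (fun t ht => gammaMixture_integrand_eq r s ht),
    integral_add ((Real.GammaIntegral_convergent (by linarith)).const_mul _)
    ((Real.GammaIntegral_convergent (by linarith)).const_mul _), integral_const_mul,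
    integral_const_mul, ← Real.Gamma_eq_integral (by linarith),
    ← Real.Gamma_eq_integral (by linarith), Upsilon]

lemma isProbabilityMeasure_gammaMixture {r : ℝ} (hr : r ∈ Icc (0 : ℝ) 1) :
    IsProbabilityMeasure (gammaMixture r) := by
  have h1 := mgf_log_gammaMixture hr (s := 0) (by norm_num)
  have h2 := integrable_exp_mul_log_gammaMixture hr (s := 0) (by norm_num)
  simp only [zero_mul, Real.exp_zero] at h2
  have : IsFiniteMeasure (gammaMixture r) := (integrable_const_iff_isFiniteMeasure one_ne_zero).1 h2
  rw [mgf_zero'] at h1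
  have h3 : Real.Gamma 2 = 1 := by
    rw [show (2 : ℝ) = 1 + 1 by norm_num, Real.Gamma_add_one one_ne_zero]; simp
  simp only [Upsilon, zero_add, h3, Real.Gamma_one] at h1
  refine ⟨?_⟩
  rw [measureReal_def, show r * 1 + (1 - r) * 1 = (1 : ℝ) by ring] at h1
  rw [← ENNReal.ofReal_toReal (measure_ne_top _ _), h1, ENNReal.ofReal_one]

lemma ae_gammaMixture_pos (r : ℝ) : ∀ᵐ t ∂(gammaMixture r), 0 < t :=
  (withDensity_absolutelyContinuous _ _).ae_le (ae_restrict_mem measurableSet_Ioi)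

lemma gammaMixture_ne_zero {r : ℝ} (hr : r ∈ Icc (0 : ℝ) 1) : gammaMixture r ≠ 0 :=
  have := isProbabilityMeasure_gammaMixture hr
  IsProbabilityMeasure.ne_zero _

lemma mem_interior_integrableExpSet {r : ℝ} (hr : r ∈ Icc (0 : ℝ) 1) {s : ℝ} (hs : -1 < s) :
    s ∈ interior (integrableExpSet Real.log (gammaMixture r)) :=
  mem_interior.2 ⟨Ioi (-1), fun _ ht => integrable_exp_mul_log_gammaMixture hr ht, isOpen_Ioi, hs⟩

lemma eventually_mgf_eq_Upsilon {r : ℝ} (hr : r ∈ Icc (0 : ℝ) 1) {s : ℝ} (hs : -1 < s) :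
    mgf Real.log (gammaMixture r) =ᶠ[𝓝 s] Upsilon r := by
  filter_upwards [isOpen_Ioi.mem_nhds hs] with t ht using mgf_log_gammaMixture hr ht

lemma deriv_Upsilon_eq {r : ℝ} (hr : r ∈ Icc (0 : ℝ) 1) {s : ℝ} (hs : -1 < s) :
    deriv (Upsilon r) s = ∫ t, Real.log t * Real.exp (s * Real.log t) ∂(gammaMixture r) := by
  rw [← (eventually_mgf_eq_Upsilon hr hs).deriv_eq, deriv_mgf (mem_interior_integrableExpSet hr hs)]

lemma deriv_deriv_Upsilon_eq {r : ℝ} (hr : r ∈ Icc (0 : ℝ) 1) {s : ℝ} (hs : -1 < s) :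
    deriv (deriv (Upsilon r)) s =
      ∫ t, Real.log t ^ 2 * Real.exp (s * Real.log t) ∂(gammaMixture r) := by
  rw [← (eventually_mgf_eq_Upsilon hr hs).deriv.deriv_eq,
    ← iteratedDeriv_mgf (mem_interior_integrableExpSet hr hs), iteratedDeriv_succ, iteratedDeriv_one]

lemma analyticAt_Upsilon {r : ℝ} (hr : r ∈ Icc (0 : ℝ) 1) {s : ℝ} (hs : -1 < s) :
    AnalyticAt ℝ (Upsilon r) s :=
  (analyticAt_mgf (mem_interior_integrableExpSet hr hs)).congr (eventually_mgf_eq_Upsilon hr hs)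

lemma Upsilon_pos {r : ℝ} (hr : r ∈ Icc (0 : ℝ) 1) {s : ℝ} (hs : -1 < s) : 0 < Upsilon r s := by
  rw [← mgf_log_gammaMixture hr hs]
  exact mgf_pos' (gammaMixture_ne_zero hr) (integrable_exp_mul_log_gammaMixture hr hs)

lemma deriv_logDeriv_Upsilon {r : ℝ} (hr : r ∈ Icc (0 : ℝ) 1) {s : ℝ} (hs : -1 < s) :
    HasDerivAt (fun x => deriv (Upsilon r) x / Upsilon r x)
      ((deriv (deriv (Upsilon r)) s * Upsilon r s - deriv (Upsilon r) s ^ 2) / Upsilon r s ^ 2)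
      s := by
  have h := analyticAt_Upsilon hr hs
  have := h.deriv.differentiableAt.hasDerivAt.div h.differentiableAt.hasDerivAt
    (Upsilon_pos hr hs).ne'
  rwa [sq (deriv (Upsilon r) s)]

/-- `Υ_r` is log-convex. -/
lemma Upsilon_logConvex {r : ℝ} (hr : r ∈ Icc (0 : ℝ) 1) {s : ℝ} (hs : -1 < s) :
    deriv (Upsilon r) s ^ 2 ≤ deriv (deriv (Upsilon r)) s * Upsilon r s := by
  have hint := mem_interior_integrableExpSet hr hs
  have hU := Upsilon_pos hr hs
  -- The second derivative of the cumulant generating function is the variance of `log t` under the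
  -- exponentially tilted law.
  have h0 : 0 ≤ iteratedDeriv 2 (cgf Real.log (gammaMixture r)) s := by
    rw [iteratedDeriv_two_cgf_eq_integral hint]
    exact div_nonneg (integral_nonneg fun t => mul_nonneg (sq_nonneg _) (Real.exp_pos _).le)
      mgf_nonneg
  rw [iteratedDeriv_two_cgf hint, deriv_cgf hint, ← deriv_deriv_Upsilon_eq hr hs,
    ← deriv_Upsilon_eq hr hs, mgf_log_gammaMixture hr hs, div_pow, sub_nonneg,
    div_le_div_iff₀ (by positivity) hU] at h0
  nlinarith

lemma monotoneOn_logDeriv_Upsilon {r : ℝ} (hr : r ∈ Icc (0 : ℝ) 1) :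
    MonotoneOn (fun x => deriv (Upsilon r) x / Upsilon r x) (Ioi (-1)) := by
  refine monotoneOn_of_deriv_nonneg (convex_Ioi _)
    (fun s hs => (deriv_logDeriv_Upsilon hr hs).continuousAt.continuousWithinAt) ?_ ?_
  · rw [interior_Ioi]
    exact fun s hs => (deriv_logDeriv_Upsilon hr hs).differentiableAt.differentiableWithinAt
  · rw [interior_Ioi]
    intro s hs
    rw [(deriv_logDeriv_Upsilon hr hs).deriv]
    have := Upsilon_logConvex hr hs
    exact div_nonneg (by linarith) (sq_nonneg _)

/-! ### The bias constant `ϖ_r` -/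

lemma zero_mem_Icc_zero_one : (0 : ℝ) ∈ Icc (0 : ℝ) 1 := ⟨le_rfl, zero_le_one⟩

lemma Upsilon_zero_left (x : ℝ) : Upsilon 0 x = Real.Gamma (x + 1) := by
  simp [Upsilon]

/-- The recurrence of the Gamma function isolates the dependence on `r` in one affine factor, so all
later comparisons between different `r` are explicit. -/
lemma Upsilon_eq_mul (r : ℝ) {x : ℝ} (hx : -1 < x) :
    Upsilon r x = Upsilon 0 x * (1 + r * x) := by
  rw [Upsilon_zero_left, Upsilon, show x + 2 = x + 1 + 1 by ring,
    Real.Gamma_add_one (by linarith)]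
  ring

lemma one_add_mul_pos {r x : ℝ} (hr : r ∈ Icc (0 : ℝ) 1) (hx : -1 < x) : 0 < 1 + r * x := by
  rcases eq_or_lt_of_le hr.1 with h | h
  · simp [← h]
  · nlinarith [hr.2]

lemma logDeriv_Upsilon_eq {r x : ℝ} (hr : r ∈ Icc (0 : ℝ) 1) (hx : -1 < x) :
    deriv (Upsilon r) x / Upsilon r x =
      deriv (Upsilon 0) x / Upsilon 0 x + r / (1 + r * x) := by
  have h0 := (analyticAt_Upsilon zero_mem_Icc_zero_one hx).differentiableAt.hasDerivAt
  have h1 : HasDerivAt (fun y : ℝ => 1 + r * y) r x := by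
    simpa using ((hasDerivAt_id x).const_mul r).const_add 1
  have h2 : Upsilon r =ᶠ[𝓝 x] fun y => Upsilon 0 y * (1 + r * y) := by
    filter_upwards [isOpen_Ioi.mem_nhds hx] with y hy using Upsilon_eq_mul r hy
  have hU := (Upsilon_pos zero_mem_Icc_zero_one hx).ne'
  have hp := (one_add_mul_pos hr hx).ne'
  rw [h2.deriv_eq, (h0.fun_mul h1).deriv, Upsilon_eq_mul r hx]
  field_simp

lemma PiFun_eq {r y : ℝ} (hr : r ∈ Icc (0 : ℝ) 1) (hy : 0 < y) :
    PiFun r y = 1 / y - deriv (Upsilon 0) y / Upsilon 0 y - r / (1 + r * y) + r / 2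
      - Real.eulerMascheroniConstant := by
  rw [PiFun, logDeriv_Upsilon_eq hr (by linarith)]
  ring

/-- `Π_r` decreases at least as fast as `1 / y`. -/
lemma one_div_sub_le_PiFun_sub {r x y : ℝ} (hr : r ∈ Icc (0 : ℝ) 1) (hx : 0 < x) (hxy : x ≤ y) :
    1 / x - 1 / y ≤ PiFun r x - PiFun r y := by
  -- By log-convexity the subtracted term `Υ' / Υ` is nondecreasing, so it can only add to the
  -- decrease of `1 / y`.
  have := monotoneOn_logDeriv_Upsilon hr (show x ∈ Ioi (-1 : ℝ) by simp; linarith)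
    (show y ∈ Ioi (-1 : ℝ) by simp; linarith) hxy
  simp only at this
  simp only [PiFun]
  linarith

lemma PiFun_strictAntiOn {r : ℝ} (hr : r ∈ Icc (0 : ℝ) 1) : StrictAntiOn (PiFun r) (Ioi 0) := by
  intro x hx y _ hxy
  have h1 := one_div_sub_le_PiFun_sub hr hx hxy.le
  have h2 := one_div_lt_one_div_of_lt hx hxy
  linarith

lemma hasDerivAt_PiFun {r y : ℝ} (hr : r ∈ Icc (0 : ℝ) 1) (hy : 0 < y) :
    HasDerivAt (PiFun r) (-(y ^ 2)⁻¹ -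
      (deriv (deriv (Upsilon r)) y * Upsilon r y - deriv (Upsilon r) y ^ 2) / Upsilon r y ^ 2)
      y := by
  have h1 := (hasDerivAt_inv hy.ne').sub (deriv_logDeriv_Upsilon hr (s := y) (by linarith))
  have h2 := (h1.add_const (r / 2)).sub_const Real.eulerMascheroniConstant
  convert! h2 using 2 with x
  simp [PiFun]

lemma hasDerivAt_Upsilon_zero_zero :
    HasDerivAt (Upsilon 0) (-Real.eulerMascheroniConstant) 0 := by
  have h := Real.hasDerivAt_Gamma_one
  rw [show (1 : ℝ) = 0 + 1 by ring] at h
  convert! h.comp_add_const 0 1 using 1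
  ext x; rw [Upsilon_zero_left]

lemma hasDerivAt_Upsilon_zero_one :
    HasDerivAt (Upsilon 0) (1 - Real.eulerMascheroniConstant) 1 := by
  have h := Real.hasDerivAt_Gamma_nat 1
  norm_num [harmonic] at h
  rw [show (2 : ℝ) = 1 + 1 by ring] at h
  have h2 := h.comp_add_const 1 1
  convert! h2 using 1
  · ext x; rw [Upsilon_zero_left]
  · ring

lemma Upsilon_zero_zero : Upsilon 0 0 = 1 := by simp [Upsilon_zero_left]

lemma Upsilon_zero_one : Upsilon 0 1 = 1 := by
  rw [Upsilon_zero_left, Real.Gamma_add_one one_ne_zero]; simp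

/-- Since `Γ'(2) = 1 - γ`, the constant `γ` cancels at `y = 1`. The value is nonpositive, which
bounds the zero above by 1, and it vanishes at `r = 1`, which gives `ϖ_1 = 1`. -/
lemma PiFun_one_right {r : ℝ} (hr : r ∈ Icc (0 : ℝ) 1) :
    PiFun r 1 = r * (r - 1) / (2 * (1 + r)) := by
  rw [PiFun_eq hr one_pos, hasDerivAt_Upsilon_zero_one.deriv, Upsilon_zero_one]
  have : 1 + r ≠ 0 := by linarith [hr.1]
  field_simp
  ring

/-- Monotonicity bounds the logarithmic derivative of `Υ_0` at `1 / 2` by its value `1 - γ` at `1`,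
so that `γ` cancels again. -/
lemma PiFun_half_pos {r : ℝ} (hr : r ∈ Icc (0 : ℝ) 1) : 0 < PiFun r (1 / 2) := by
  have h := monotoneOn_logDeriv_Upsilon zero_mem_Icc_zero_one
    (show (1 / 2 : ℝ) ∈ Ioi (-1 : ℝ) by simp; norm_num)
    (show (1 : ℝ) ∈ Ioi (-1 : ℝ) by simp) (by norm_num)
  simp only [hasDerivAt_Upsilon_zero_one.deriv, Upsilon_zero_one] at h
  rw [PiFun_eq hr (by norm_num)]
  -- A crude affine bound; with it the value of `Π_r` at `1 / 2` is at least `(1 + r) / 3`.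
  have h1 : r / (1 + r * (1 / 2)) ≤ 2 / 3 + r / 6 := by
    have : 0 < 1 + r * (1 / 2) := by linarith [hr.1]
    rw [div_le_iff₀ this]
    nlinarith [hr.1, hr.2, mul_nonneg hr.1 hr.1]
  have := hr.1
  norm_num at h h1 ⊢
  linarith

lemma exists_PiFun_zero {r : ℝ} (hr : r ∈ Icc (0 : ℝ) 1) :
    ∃ y ∈ Icc (1 / 2 : ℝ) 1, PiFun r y = 0 := by
  have hc : ContinuousOn (PiFun r) (Icc (1 / 2) 1) := fun y hy =>
    (hasDerivAt_PiFun hr (by linarith [hy.1])).continuousAt.continuousWithinAt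
  have h1 : PiFun r 1 ≤ 0 := by
    rw [PiFun_one_right hr]
    have h1 := hr.1
    have h2 := hr.2
    exact div_nonpos_of_nonpos_of_nonneg
      (mul_nonpos_of_nonneg_of_nonpos h1 (by linarith)) (by linarith)
  obtain ⟨y, hy, hy0⟩ := intermediate_value_Icc' (by norm_num) hc ⟨h1, (PiFun_half_pos hr).le⟩
  exact ⟨y, hy, hy0⟩

lemma varpi_spec {r : ℝ} (hr : r ∈ Icc (0 : ℝ) 1) : 0 < varpi r ∧ PiFun r (varpi r) = 0 := by
  obtain ⟨y, hy, hy0⟩ := exists_PiFun_zero hr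
  exact Classical.epsilon_spec (p := fun y : ℝ => 0 < y ∧ PiFun r y = 0)
    ⟨y, by linarith [hy.1], hy0⟩

lemma varpi_eq_of_PiFun_eq_zero {r y : ℝ} (hr : r ∈ Icc (0 : ℝ) 1) (hy : 0 < y)
    (h : PiFun r y = 0) : varpi r = y :=
  (PiFun_strictAntiOn hr).injOn (varpi_spec hr).1 hy ((varpi_spec hr).2.trans h.symm)

lemma varpi_mem {r : ℝ} (hr : r ∈ Icc (0 : ℝ) 1) : varpi r ∈ Icc (1 / 2 : ℝ) 1 := by
  obtain ⟨y, hy, hy0⟩ := exists_PiFun_zero hr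
  rwa [varpi_eq_of_PiFun_eq_zero hr (by linarith [hy.1]) hy0]

lemma varpi_one : varpi 1 = 1 :=
  have h : (1 : ℝ) ∈ Icc (0 : ℝ) 1 := ⟨zero_le_one, le_rfl⟩
  varpi_eq_of_PiFun_eq_zero h one_pos (by simp [PiFun_one_right h])

/-- On `(0, 1]`, where the zeros lie, `Π_r` falls at rate at least 1. At a fixed point `Π_r` and
`Π_s` differ only by explicit rational terms of size at most `|r - s|`, so the zeros are no further
apart than the parameters. -/
lemma abs_varpi_sub_le {r s : ℝ} (hr : r ∈ Icc (0 : ℝ) 1) (hs : s ∈ Icc (0 : ℝ) 1) :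
    |varpi r - varpi s| ≤ |r - s| := by
  wlog h : varpi r ≤ varpi s generalizing r s
  · rw [abs_sub_comm, abs_sub_comm r]
    exact this hs hr (le_of_not_ge h)
  have hx := varpi_mem hr
  have hy := varpi_mem hs
  have hx0 := (varpi_spec hr).1
  have hy0 := (varpi_spec hs).1
  have h1 := one_div_sub_le_PiFun_sub hr hx0 h
  rw [(varpi_spec hr).2, ← (varpi_spec hs).2, PiFun_eq hr hy0, PiFun_eq hs hy0] at h1
  set x := varpi r
  set y := varpi s
  have hxy : y - x ≤ 1 / x - 1 / y := by
    rw [div_sub_div _ _ hx0.ne' hy0.ne', le_div_iff₀ (by positivity)]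
    have : x * y ≤ 1 := by nlinarith [hx.2, hy.2]
    nlinarith
  have hry := one_add_mul_pos hr (x := y) (by linarith)
  have hsy := one_add_mul_pos hs (x := y) (by linarith)
  have hc : r / (1 + r * y) - s / (1 + s * y) = (r - s) * (1 / ((1 + r * y) * (1 + s * y))) := by
    rw [div_sub_div _ _ hry.ne' hsy.ne', mul_one_div]
    congr 1
    ring
  have hc0 : 0 < 1 / ((1 + r * y) * (1 + s * y)) := by positivity
  have hc1 : 1 / ((1 + r * y) * (1 + s * y)) ≤ 1 := by
    rw [div_le_one (by positivity)]
    have h3 : 0 ≤ r * y := mul_nonneg hr.1 hy0.le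
    have h4 : 0 ≤ s * y := mul_nonneg hs.1 hy0.le
    nlinarith [mul_nonneg h3 h4]
  -- `Π_r` and `Π_s` are compared at the same point `y`, the zero of the latter; the last factor
  -- lies in `(-1/2, 1/2]`.
  have hb : y - x ≤ (r - s) * (1 / ((1 + r * y) * (1 + s * y)) - 1 / 2) := by linarith
  rw [abs_sub_comm, abs_of_nonneg (by linarith)]
  refine hb.trans ((le_abs_self _).trans ?_)
  rw [abs_mul]
  refine mul_le_of_le_one_right (abs_nonneg _) (abs_le.2 ⟨?_, ?_⟩) <;> linarith

lemma continuousOn_varpi : ContinuousOn varpi (Icc 0 1) := by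
  have : LipschitzOnWith 1 varpi (Icc 0 1) := LipschitzOnWith.of_dist_le_mul fun x hx y hy => by
    simpa [Real.dist_eq] using abs_varpi_sub_le hx hy
  exact this.continuousOn

lemma continuousOn_Upsilon_varpi : ContinuousOn (fun r => Upsilon r (varpi r)) (Icc 0 1) := by
  have h : ∀ r ∈ Icc (0 : ℝ) 1, Upsilon r (varpi r) =
      Upsilon 0 (varpi r) * (1 + r * varpi r) := fun r hr =>
    Upsilon_eq_mul r (by linarith [(varpi_spec hr).1])
  refine ContinuousOn.congr ?_ h
  refine ContinuousOn.mul (fun r hr => ?_)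
    (continuousOn_const.add (continuousOn_id.mul continuousOn_varpi))
  exact (analyticAt_Upsilon zero_mem_Icc_zero_one (by linarith [(varpi_spec hr).1])).continuousAt
    |>.comp_continuousWithinAt (continuousOn_varpi r hr)

lemma varpi_sub_isBigO {s : ℝ} (hs : s ∈ Icc (0 : ℝ) 1) :
    (fun r => varpi r - varpi s) =O[𝓝[Icc 0 1] s] fun r => r - s := by
  refine Asymptotics.IsBigO.of_bound 1 ?_
  filter_upwards [self_mem_nhdsWithin] with r hr
  simpa using abs_varpi_sub_le hr hs

/-- The factorization of `Υ_r` splits the logarithm into smooth functions of `ϖ_r` and of `r ϖ_r`,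
both Lipschitz in `r`. A linear rate, not mere continuity, is needed because the error gets
multiplied by `v_n`. -/
lemma log_Upsilon_varpi_sub_isBigO {s : ℝ} (hs : s ∈ Icc (0 : ℝ) 1) :
    (fun r => Real.log (Upsilon r (varpi r)) - Real.log (Upsilon s (varpi s)))
      =O[𝓝[Icc 0 1] s] fun r => r - s := by
  have hs0 : -1 < varpi s := by linarith [(varpi_spec hs).1]
  have ht : Tendsto varpi (𝓝[Icc 0 1] s) (𝓝 (varpi s)) := continuousOn_varpi s hs
  have h1 : (fun r => Real.log (Upsilon 0 (varpi r)) - Real.log (Upsilon 0 (varpi s)))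
      =O[𝓝[Icc 0 1] s] fun r => r - s := by
    have hd : DifferentiableAt ℝ (fun x => Real.log (Upsilon 0 x)) (varpi s) :=
      (analyticAt_Upsilon zero_mem_Icc_zero_one hs0).differentiableAt.log
        (Upsilon_pos zero_mem_Icc_zero_one hs0).ne'
    exact (hd.isBigO_sub.comp_tendsto ht).trans (varpi_sub_isBigO hs)
  have h2 : (fun r => r * varpi r - s * varpi s) =O[𝓝[Icc 0 1] s] fun r => r - s := by
    refine Asymptotics.IsBigO.of_bound 2 ?_
    filter_upwards [self_mem_nhdsWithin] with r hr
    have e : r * varpi r - s * varpi s = (r - s) * varpi r + s * (varpi r - varpi s) := by ring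
    rw [e, Real.norm_eq_abs, Real.norm_eq_abs]
    refine (abs_add_le _ _).trans ?_
    rw [abs_mul, abs_mul, abs_of_nonneg hs.1, abs_of_pos (varpi_spec hr).1]
    nlinarith [abs_varpi_sub_le hr hs, hs.2, hs.1, (varpi_mem hr).2, abs_nonneg (r - s)]
  have ht2 : Tendsto (fun r => r * varpi r) (𝓝[Icc 0 1] s) (𝓝 (s * varpi s)) :=
    (tendsto_id.mono_left nhdsWithin_le_nhds).mul ht
  have h3 : (fun r => Real.log (1 + r * varpi r) - Real.log (1 + s * varpi s))
      =O[𝓝[Icc 0 1] s] fun r => r - s := by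
    have hd : DifferentiableAt ℝ (fun x => Real.log (1 + x)) (s * varpi s) :=
      DifferentiableAt.log (by fun_prop) (one_add_mul_pos hs hs0).ne'
    exact (hd.isBigO_sub.comp_tendsto ht2).trans h2
  refine (h1.add h3).congr' ?_ EventuallyEq.rfl
  filter_upwards [self_mem_nhdsWithin] with r hr
  have hr0 : -1 < varpi r := by linarith [(varpi_spec hr).1]
  rw [Upsilon_eq_mul r hr0, Upsilon_eq_mul s hs0,
    Real.log_mul (Upsilon_pos zero_mem_Icc_zero_one hr0).ne' (one_add_mul_pos hr hr0).ne',
    Real.log_mul (Upsilon_pos zero_mem_Icc_zero_one hs0).ne' (one_add_mul_pos hs hs0).ne']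
  ring

/-! ### The case `r = 1` -/

/-- The reflection formula with denominators cleared, so that it holds at `x = 0` too and may be
differentiated there. -/
lemma Upsilon_zero_reflection {x : ℝ} (hx : x ∈ Ioo (-1 : ℝ) 1) :
    Upsilon 0 x * Upsilon 0 (-x) * Real.sin (Real.pi * x) = Real.pi * x := by
  rcases eq_or_ne x 0 with rfl | h0
  · simp
  have hsin : Real.sin (Real.pi * x) ≠ 0 := by
    intro h
    obtain ⟨n, hn⟩ := Real.sin_eq_zero_iff.1 h
    have hn' : (n : ℝ) = x := by
      have := Real.pi_pos.ne'
      field_simp at hn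
      linarith
    rw [← hn'] at hx h0
    have h1 : (-1 : ℤ) < n := by exact_mod_cast hx.1
    have h2 : n < (1 : ℤ) := by exact_mod_cast hx.2
    exact h0 (by rw [show n = 0 by omega]; simp)
  have h := Real.Gamma_mul_Gamma_one_sub x
  rw [Upsilon_zero_left, Upsilon_zero_left, Real.Gamma_add_one h0,
    show -x + 1 = 1 - x by ring, mul_assoc x, h, mul_assoc,
    div_mul_cancel₀ _ hsin, mul_comm]

/-- This is the trigamma value `ψ'(1) = π² / 6`. The sine vanishes to first order at 0, and the
wanted quantity is half the second derivative of `f(x) f(-x)` there, so it appears in the third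
derivative of the reflection formula. -/
lemma logDeriv_Upsilon_zero_deriv_zero :
    deriv (deriv (Upsilon 0)) 0 * Upsilon 0 0 - deriv (Upsilon 0) 0 ^ 2 = Real.pi ^ 2 / 6 := by
  set f := Upsilon 0 with hf
  set f1 := deriv f
  set f2 := deriv f1
  set f3 := deriv f2
  have han : ∀ x ∈ Ioo (-1 : ℝ) 1, AnalyticAt ℝ f x := fun x hx =>
    analyticAt_Upsilon zero_mem_Icc_zero_one hx.1
  have hneg : ∀ x ∈ Ioo (-1 : ℝ) 1, -x ∈ Ioo (-1 : ℝ) 1 := fun x hx =>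
    ⟨by linarith [hx.2], by linarith [hx.1]⟩
  have d0 : ∀ x ∈ Ioo (-1 : ℝ) 1, HasDerivAt f (f1 x) x := fun x hx =>
    (han x hx).differentiableAt.hasDerivAt
  have d1 : ∀ x ∈ Ioo (-1 : ℝ) 1, HasDerivAt f1 (f2 x) x := fun x hx =>
    (han x hx).deriv.differentiableAt.hasDerivAt
  have d2 : ∀ x ∈ Ioo (-1 : ℝ) 1, HasDerivAt f2 (f3 x) x := fun x hx =>
    (han x hx).deriv.deriv.differentiableAt.hasDerivAt
  have n0 : ∀ x ∈ Ioo (-1 : ℝ) 1, HasDerivAt (fun y => f (-y)) (-f1 (-x)) x := fun x hx => by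
    simpa using! (d0 (-x) (hneg x hx)).comp x (hasDerivAt_neg x)
  have n1 : ∀ x ∈ Ioo (-1 : ℝ) 1, HasDerivAt (fun y => f1 (-y)) (-f2 (-x)) x := fun x hx => by
    simpa using! (d1 (-x) (hneg x hx)).comp x (hasDerivAt_neg x)
  have n2 : ∀ x ∈ Ioo (-1 : ℝ) 1, HasDerivAt (fun y => f2 (-y)) (-f3 (-x)) x := fun x hx => by
    simpa using! (d2 (-x) (hneg x hx)).comp x (hasDerivAt_neg x)
  have hs : ∀ x, HasDerivAt (fun y => Real.sin (Real.pi * y)) (Real.pi * Real.cos (Real.pi * x)) x :=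
    fun x => by
      simpa [mul_comm] using ((hasDerivAt_id x).const_mul Real.pi).sin
  have hc : ∀ x, HasDerivAt (fun y => Real.cos (Real.pi * y))
      (-(Real.pi * Real.sin (Real.pi * x))) x := fun x => by
      simpa [mul_comm] using ((hasDerivAt_id x).const_mul Real.pi).cos
  -- `e1` and `e2` are the first two derivatives of the reflection identity on the whole interval;
  -- `e3` is the third, at 0 only.
  have e1 : ∀ x ∈ Ioo (-1 : ℝ) 1, (f1 x * f (-x) + f x * -f1 (-x)) * Real.sin (Real.pi * x) +
      f x * f (-x) * (Real.pi * Real.cos (Real.pi * x)) = Real.pi := fun x hx => by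
    have h1 := ((d0 x hx).mul (n0 x hx)).mul (hs x)
    have h2 : HasDerivAt (fun y => Real.pi * y) Real.pi x := by
      simpa using (hasDerivAt_id x).const_mul Real.pi
    refine h1.unique (h2.congr_of_eventuallyEq ?_)
    filter_upwards [Ioo_mem_nhds hx.1 hx.2] with y hy using Upsilon_zero_reflection hy
  have e2 : ∀ x ∈ Ioo (-1 : ℝ) 1,
      ((f2 x * f (-x) + f1 x * -f1 (-x)) + (f1 x * -f1 (-x) + f x * f2 (-x))) *
        Real.sin (Real.pi * x) +
      2 * ((f1 x * f (-x) + f x * -f1 (-x)) * (Real.pi * Real.cos (Real.pi * x))) -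
      f x * f (-x) * (Real.pi ^ 2 * Real.sin (Real.pi * x)) = 0 := fun x hx => by
    have h1 := ((((d1 x hx).mul (n0 x hx)).add ((d0 x hx).mul (n1 x hx).neg)).mul (hs x)).add
      (((d0 x hx).mul (n0 x hx)).mul ((hc x).const_mul Real.pi))
    have := h1.unique ((hasDerivAt_const x Real.pi).congr_of_eventuallyEq (by
      filter_upwards [Ioo_mem_nhds hx.1 hx.2] with y hy using e1 y hy))
    simp only [Pi.mul_apply, Pi.add_apply, Pi.neg_apply] at this
    linear_combination this
  have hx : (0 : ℝ) ∈ Ioo (-1 : ℝ) 1 := by simp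
  have h1 := (((((d2 0 hx).mul (n0 0 hx)).add ((d1 0 hx).mul (n1 0 hx).neg)).add
      (((d1 0 hx).mul (n1 0 hx).neg).add ((d0 0 hx).mul (n2 0 hx)))).mul (hs 0)).add
      (((((d1 0 hx).mul (n0 0 hx)).add ((d0 0 hx).mul (n1 0 hx).neg)).mul
        ((hc 0).const_mul Real.pi)).const_mul 2) |>.sub
      (((d0 0 hx).mul (n0 0 hx)).mul ((hs 0).const_mul (Real.pi ^ 2)))
  have e3 := h1.unique ((hasDerivAt_const (0 : ℝ) (0 : ℝ)).congr_of_eventuallyEq (by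
      filter_upwards [Ioo_mem_nhds hx.1 hx.2] with y hy
      have := e2 y hy
      simp only [Pi.mul_apply, Pi.add_apply, Pi.neg_apply, Pi.sub_apply]
      linear_combination this))
  have hf0 : f 0 = 1 := Upsilon_zero_zero
  simp [hf0] at e3
  have hpi := Real.pi_pos.ne'
  have e4 : Real.pi * (6 * (f2 0 - f1 0 ^ 2) - Real.pi ^ 2) = 0 := by linear_combination e3
  have := (mul_eq_zero.1 e4).resolve_left hpi
  rw [hf0]
  linarith

/-- The trigamma recurrence `ψ'(2) = ψ'(1) - 1`. Because `Υ_1(x) = Υ_0(x + 1)`, the unit shift is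
the case `r = 1` of `logDeriv_Upsilon_eq`. -/
lemma logDeriv_Upsilon_zero_deriv_one :
    deriv (deriv (Upsilon 0)) 1 * Upsilon 0 1 - deriv (Upsilon 0) 1 ^ 2 =
      Real.pi ^ 2 / 6 - 1 := by
  have hev : (fun x => deriv (Upsilon 0) (x + 1) / Upsilon 0 (x + 1)) =ᶠ[𝓝 0]
      fun x => deriv (Upsilon 0) x / Upsilon 0 x + (x + 1)⁻¹ := by
    filter_upwards [Ioi_mem_nhds (show (-1 : ℝ) < 0 by norm_num)] with x hx
    have hx' : -1 < x := hx
    have hx1 : -1 < x + 1 := by linarith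
    have h : Upsilon 1 =ᶠ[𝓝 x] fun y => Upsilon 0 (y + 1) := by
      filter_upwards with y
      rw [Upsilon_zero_left, Upsilon]
      ring_nf
    have h1 := logDeriv_Upsilon_eq (r := 1) ⟨zero_le_one, le_rfl⟩ hx'
    rw [h.deriv_eq, h.eq_of_nhds, deriv_comp_add_const] at h1
    rw [h1]
    simp [add_comm]
  have h0 := (deriv_logDeriv_Upsilon zero_mem_Icc_zero_one (s := 0) (by norm_num)).add
    (((hasDerivAt_id (0 : ℝ)).add_const 1).inv (by norm_num))
  have h1 := deriv_logDeriv_Upsilon zero_mem_Icc_zero_one (s := 0 + 1) (by norm_num)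
  have h2 := (h1.comp_add_const 0 1).unique (h0.congr_of_eventuallyEq hev)
  rw [zero_add, Upsilon_zero_one, Upsilon_zero_zero] at h2
  have h3 := logDeriv_Upsilon_zero_deriv_zero
  rw [Upsilon_zero_zero] at h3
  norm_num at h2
  rw [Upsilon_zero_one]
  linarith

lemma Upsilon_one_one : Upsilon 1 1 = 2 := by
  rw [Upsilon_eq_mul 1 (by norm_num), Upsilon_zero_one]; norm_num

lemma deriv_Upsilon_one_one :
    deriv (Upsilon 1) 1 = 3 - 2 * Real.eulerMascheroniConstant := by
  have h := logDeriv_Upsilon_eq (r := 1) (x := 1) ⟨zero_le_one, le_rfl⟩ (by norm_num)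
  rw [Upsilon_one_one, Upsilon_zero_one, hasDerivAt_Upsilon_zero_one.deriv] at h
  linarith

/-- The factor `1 + x` adds the derivative of `1 / (1 + x)` at 1, that is `-1 / 4`, to `π² / 6 - 1`.
-/
lemma logDeriv_Upsilon_one_deriv_one :
    (deriv (deriv (Upsilon 1)) 1 * Upsilon 1 1 - deriv (Upsilon 1) 1 ^ 2) / Upsilon 1 1 ^ 2 =
      Real.pi ^ 2 / 6 - 5 / 4 := by
  have hr : (1 : ℝ) ∈ Icc (0 : ℝ) 1 := ⟨zero_le_one, le_rfl⟩
  have hev : (fun x => deriv (Upsilon 1) x / Upsilon 1 x) =ᶠ[𝓝 1]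
      fun x => deriv (Upsilon 0) x / Upsilon 0 x + (x + 1)⁻¹ := by
    filter_upwards [Ioi_mem_nhds (show (-1 : ℝ) < 1 by norm_num)] with x hx
    rw [logDeriv_Upsilon_eq hr hx]
    simp [add_comm]
  have h0 := (deriv_logDeriv_Upsilon zero_mem_Icc_zero_one (s := 1) (by norm_num)).add
    (((hasDerivAt_id (1 : ℝ)).add_const 1).inv (by norm_num))
  have h1 := (deriv_logDeriv_Upsilon hr (s := 1) (by norm_num)).unique
    (h0.congr_of_eventuallyEq hev)
  rw [h1, logDeriv_Upsilon_zero_deriv_one, Upsilon_zero_one]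
  norm_num
  ring

/-! ### The marginals of the Fréchet-Welsch law -/

/-- The density is minus the derivative of `exp (-t) * (1 + r * t)`. With `u = y ^ (-α)` this tail
is the limit of the joint cdf as `x → ∞`. -/
lemma gammaMixture_Ici {r u : ℝ} (hr : r ∈ Icc (0 : ℝ) 1) (hu : 0 < u) :
    gammaMixture r (Ici u) = ENNReal.ofReal (Real.exp (-u) * (1 + r * u)) := by
  have hder : ∀ t ∈ Ici u, HasDerivAt (fun t => -(Real.exp (-t) * (1 + r * t)))
      (Real.exp (-t) * (1 - r + r * t)) t := fun t _ => by
    have h1 : HasDerivAt (fun y : ℝ => 1 + r * y) r t := by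
      simpa using ((hasDerivAt_id t).const_mul r).const_add 1
    have h2 : HasDerivAt (fun y : ℝ => Real.exp (-y)) (-Real.exp (-t)) t := by
      simpa using (hasDerivAt_neg t).exp
    convert! (h2.mul h1).neg using 1
    ring
  have hlim : Tendsto (fun t => -(Real.exp (-t) * (1 + r * t))) atTop (𝓝 0) := by
    have h1 := Real.tendsto_pow_mul_exp_neg_atTop_nhds_zero 1
    have h0 := Real.tendsto_pow_mul_exp_neg_atTop_nhds_zero 0
    convert! (h0.add (h1.const_mul r)).neg using 2
    · ring
    · simp
  have hnn : ∀ t ∈ Ioi u, 0 ≤ Real.exp (-t) * (1 - r + r * t) := fun t ht =>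
    gammaMixture_density_nonneg hr (hu.trans ht)
  rw [gammaMixture, withDensity_apply _ measurableSet_Ici,
    Measure.restrict_restrict measurableSet_Ici,
    show Ici u ∩ Ioi 0 = Ici u from inter_eq_left.2 fun t ht => hu.trans_le (mem_Ici.1 ht), setLIntegral_congr Ioi_ae_eq_Ici.symm,
    ← ofReal_integral_eq_lintegral_ofReal (integrableOn_Ioi_deriv_of_nonneg' hder hnn hlim)
      ((ae_restrict_mem measurableSet_Ioi).mono hnn),
    integral_Ioi_of_hasDerivAt_of_nonneg' hder hnn hlim]
  simp

lemma gammaMixture_map_Iic {r α : ℝ} (hr : r ∈ Icc (0 : ℝ) 1) (hα : 0 < α) (y : ℝ) :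
    (gammaMixture r).map (fun t => t ^ (-α⁻¹)) (Iic y) =
      if 0 < y then ENNReal.ofReal (Real.exp (-y ^ (-α)) * (1 + r * y ^ (-α))) else 0 := by
  have hm : Measurable fun t : ℝ => t ^ (-α⁻¹) := by fun_prop
  rw [Measure.map_apply hm measurableSet_Iic]
  split_ifs with hy
  · rw [← gammaMixture_Ici hr (Real.rpow_pos_of_pos hy _)]
    refine measure_congr ?_
    filter_upwards [ae_gammaMixture_pos r] with t ht
    refine propext ?_
    change t ^ (-α⁻¹) ≤ y ↔ y ^ (-α) ≤ t
    rw [← Real.rpow_inv_le_iff_of_neg ht hy (by linarith), inv_neg]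
  · refine measure_mono_null (fun t ht => ?_) (ae_iff.1 (ae_gammaMixture_pos r))
    intro ht0
    exact hy ((Real.rpow_pos_of_pos ht0 _).trans_le ht)

lemma IsWelschFunction.zero_mem {ρ : ℝ → ℝ} (h : IsWelschFunction ρ) : ρ 0 ∈ Icc (0 : ℝ) 1 :=
  h.mapsTo ⟨le_rfl, zero_le_one⟩

/-- Let `x → ∞` in the joint cdf: the argument `(y / x) ^ α` of `ρ` tends to 0, so only `ρ 0`
survives in the second marginal. -/
lemma IsFrechetWelschLaw.map_snd {ρ : ℝ → ℝ} (h : IsWelschFunction ρ) {α : ℝ} (hα : 0 < α)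
    {P : Measure (ℝ × ℝ)} (hP : IsFrechetWelschLaw ρ α 1 P) :
    P.map Prod.snd = (gammaMixture (ρ 0)).map fun t => t ^ (-α⁻¹) := by
  have := hP.1
  have := isProbabilityMeasure_gammaMixture h.zero_mem
  have : IsProbabilityMeasure ((gammaMixture (ρ 0)).map fun t : ℝ => t ^ (-α⁻¹)) :=
    Measure.isProbabilityMeasure_map (by fun_prop)
  have : IsProbabilityMeasure (P.map Prod.snd) := Measure.isProbabilityMeasure_map (by fun_prop)
  refine Measure.ext_of_Iic _ _ fun y => ?_
  rw [gammaMixture_map_Iic h.zero_mem hα, Measure.map_apply measurable_snd measurableSet_Iic]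
  have hU : Prod.snd ⁻¹' Iic y = ⋃ n : ℕ, Iic (n : ℝ) ×ˢ Iic y := by
    ext p
    simp only [mem_preimage, mem_Iic, mem_iUnion, mem_prod]
    exact ⟨fun hp => (exists_nat_ge p.1).imp fun n hn => ⟨hn, hp⟩, fun ⟨_, _, hp⟩ => hp⟩
  have hlim : Tendsto (fun n : ℕ => P (Iic (n : ℝ) ×ˢ Iic y)) atTop (𝓝 (P (Prod.snd ⁻¹' Iic y))) := by
    rw [hU]
    exact tendsto_measure_iUnion_atTop fun m n hmn =>
      prod_mono (Iic_subset_Iic.2 (by exact_mod_cast hmn)) le_rfl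
  refine tendsto_nhds_unique hlim ?_
  simp only [hP.2]
  split_ifs with hy
  · refine ENNReal.tendsto_ofReal ?_
    -- Continuity of `ρ` is available only within `[0, 1]`, so the quotient must be kept in that
    -- interval.
    have hq : Tendsto (fun n : ℕ => (y / (n : ℝ)) ^ α) atTop (𝓝[Icc 0 1] 0) := by
      refine tendsto_nhdsWithin_iff.2 ⟨?_, ?_⟩
      · have := (tendsto_const_div_atTop_nhds_zero_nat y).rpow_const (p := α) (Or.inr hα.le)
        rwa [Real.zero_rpow hα.ne'] at this
      · obtain ⟨N, hN⟩ := exists_nat_ge y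
        filter_upwards [eventually_ge_atTop N] with n hn
        have hn' : y ≤ n := hN.trans (by exact_mod_cast hn)
        have hn0 : (0 : ℝ) < n := hy.trans_le hn'
        exact ⟨by positivity, Real.rpow_le_one (by positivity) ((div_le_one hn0).2 hn') hα.le⟩
    have hρ : Tendsto (fun n : ℕ => ρ ((y / (n : ℝ)) ^ α)) atTop (𝓝 (ρ 0)) :=
      (h.continuousOn 0 ⟨le_rfl, zero_le_one⟩).tendsto.comp hq
    refine (((hρ.mul_const (y ^ (-α))).const_add 1).const_mul (Real.exp (-y ^ (-α)))).congr' ?_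
    obtain ⟨N, hN⟩ := exists_nat_gt y
    filter_upwards [eventually_ge_atTop N] with n hn
    have hn' : y < n := hN.trans_le (by exact_mod_cast hn)
    rw [frechetWelschCDF, if_pos ⟨hy.trans hn', hy⟩, if_neg (not_le.2 hn'), div_one]
  · refine tendsto_const_nhds.congr fun n => ?_
    rw [frechetWelschCDF, if_neg (fun h => hy h.2), ENNReal.ofReal_zero]

/-- For fixed `x` the joint cdf is constant in `y ≥ x`; the first marginal is the case of mixing
weight 0. -/
lemma IsFrechetWelschLaw.map_fst {ρ : ℝ → ℝ} {α : ℝ} (hα : 0 < α)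
    {P : Measure (ℝ × ℝ)} (hP : IsFrechetWelschLaw ρ α 1 P) :
    P.map Prod.fst = (gammaMixture 0).map fun t => t ^ (-α⁻¹) := by
  have := hP.1
  have := isProbabilityMeasure_gammaMixture zero_mem_Icc_zero_one
  have : IsProbabilityMeasure ((gammaMixture 0).map fun t : ℝ => t ^ (-α⁻¹)) :=
    Measure.isProbabilityMeasure_map (by fun_prop)
  have : IsProbabilityMeasure (P.map Prod.fst) := Measure.isProbabilityMeasure_map (by fun_prop)
  refine Measure.ext_of_Iic _ _ fun x => ?_
  rw [gammaMixture_map_Iic zero_mem_Icc_zero_one hα,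
    Measure.map_apply measurable_fst measurableSet_Iic]
  have hU : Prod.fst ⁻¹' Iic x = ⋃ n : ℕ, Iic x ×ˢ Iic (n : ℝ) := by
    ext p
    simp only [mem_preimage, mem_Iic, mem_iUnion, mem_prod]
    exact ⟨fun hp => (exists_nat_ge p.2).imp fun n hn => ⟨hp, hn⟩, fun ⟨_, hp, _⟩ => hp⟩
  have hlim : Tendsto (fun n : ℕ => P (Iic x ×ˢ Iic (n : ℝ))) atTop (𝓝 (P (Prod.fst ⁻¹' Iic x))) := by
    rw [hU]
    exact tendsto_measure_iUnion_atTop fun m n hmn =>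
      prod_mono le_rfl (Iic_subset_Iic.2 (by exact_mod_cast hmn))
  refine tendsto_nhds_unique hlim (tendsto_const_nhds.congr' ?_)
  obtain ⟨N, hN⟩ := exists_nat_ge x
  filter_upwards [eventually_ge_atTop N] with n hn
  have hn' : x ≤ n := hN.trans (by exact_mod_cast hn)
  rw [hP.2, frechetWelschCDF]
  split_ifs with hx h1 h1
  · simp
  · exact absurd ⟨hx, hx.trans_le hn'⟩ h1
  · exact absurd h1.1 hx
  · simp

lemma IsFrechetWelschLaw.ae_pos {ρ : ℝ → ℝ} (h : IsWelschFunction ρ) {α : ℝ} (hα : 0 < α)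
    {P : Measure (ℝ × ℝ)} (hP : IsFrechetWelschLaw ρ α 1 P) :
    ∀ᵐ p ∂P, p ∈ Ioi (0 : ℝ) ×ˢ Ioi (0 : ℝ) := by
  have h1 : ∀ᵐ x ∂(P.map Prod.fst), 0 < x := by
    rw [hP.map_fst hα, ae_iff]
    have := gammaMixture_map_Iic zero_mem_Icc_zero_one hα 0
    rw [if_neg (lt_irrefl _)] at this
    convert this using 2
    ext; simp
  have h2 : ∀ᵐ y ∂(P.map Prod.snd), 0 < y := by
    rw [hP.map_snd h hα, ae_iff]
    have := gammaMixture_map_Iic h.zero_mem hα 0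
    rw [if_neg (lt_irrefl _)] at this
    convert this using 2
    ext; simp
  filter_upwards [ae_of_ae_map (by fun_prop) h1, ae_of_ae_map (by fun_prop) h2] with p hp1 hp2
    using ⟨hp1, hp2⟩

lemma fwIntegral_comp_snd {ρ : ℝ → ℝ} (h : IsWelschFunction ρ) {α : ℝ} (hα : 0 < α) {f : ℝ → ℝ}
    (hf : Measurable f) :
    fwIntegral ρ α (fun p => f p.2) = ∫ t, f (t ^ (-α⁻¹)) ∂(gammaMixture (ρ 0)) := by
  have hP := frechetWelsch_spec h hα one_pos
  rw [fwIntegral, Measure.restrict_eq_self_of_ae_mem (hP.ae_pos h hα),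
    ← integral_map (φ := Prod.snd) (by fun_prop) hf.aestronglyMeasurable, hP.map_snd h hα,
    integral_map (by fun_prop) hf.aestronglyMeasurable]

lemma fwIntegral_comp_fst {ρ : ℝ → ℝ} (h : IsWelschFunction ρ) {α : ℝ} (hα : 0 < α) {f : ℝ → ℝ}
    (hf : Measurable f) :
    fwIntegral ρ α (fun p => f p.1) = ∫ t, f (t ^ (-α⁻¹)) ∂(gammaMixture 0) := by
  have hP := frechetWelsch_spec h hα one_pos
  rw [fwIntegral, Measure.restrict_eq_self_of_ae_mem (hP.ae_pos h hα),
    ← integral_map (φ := Prod.fst) (by fun_prop) hf.aestronglyMeasurable, hP.map_fst hα,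
    integral_map (by fun_prop) hf.aestronglyMeasurable]

lemma log_rpow_neg_inv {α t : ℝ} (ht : 0 < t) :
    Real.log (t ^ (-α⁻¹)) = -α⁻¹ * Real.log t := Real.log_rpow ht _

lemma rpow_neg_inv_rpow_neg {α a t : ℝ} (ht : 0 < t) :
    (t ^ (-α⁻¹)) ^ (-a) = Real.exp (a / α * Real.log t) := by
  rw [← Real.rpow_mul ht.le, Real.rpow_def_of_pos ht, div_eq_mul_inv]
  ring_nf

/-- The mean of `log t` is `Υ_r'(0)`, and `Υ_r(0) = 1` lets it be read off the logarithmic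
derivative. -/
lemma integral_log_gammaMixture {r : ℝ} (hr : r ∈ Icc (0 : ℝ) 1) :
    ∫ t, Real.log t ∂(gammaMixture r) = r - Real.eulerMascheroniConstant := by
  have h1 := deriv_Upsilon_eq hr (s := 0) (by norm_num)
  simp only [zero_mul, Real.exp_zero, mul_one] at h1
  have h2 := logDeriv_Upsilon_eq hr (x := 0) (by norm_num)
  rw [hasDerivAt_Upsilon_zero_zero.deriv, Upsilon_eq_mul r (by norm_num), Upsilon_zero_zero] at h2
  simp only [mul_zero, add_zero, mul_one, div_one] at h2
  rw [← h1, h2]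
  ring

/-! ### Integrals of the test functions against the limit law. -/

section FwIntegral

variable {ρ : ℝ → ℝ} {α a : ℝ}

lemma fwIntegral_log_fst (h : IsWelschFunction ρ) (hα : 0 < α) :
    fwIntegral ρ α (fun p => Real.log p.1) = Real.eulerMascheroniConstant / α := by
  rw [fwIntegral_comp_fst h hα Real.measurable_log, integral_congr_ae
    (g := fun t => -α⁻¹ * Real.log t) ((ae_gammaMixture_pos _).mono fun t ht => log_rpow_neg_inv ht),
    integral_const_mul, integral_log_gammaMixture zero_mem_Icc_zero_one]
  field_simp
  ring

lemma fwIntegral_log_snd (h : IsWelschFunction ρ) (hα : 0 < α) :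
    fwIntegral ρ α (fun p => Real.log p.2) = (Real.eulerMascheroniConstant - ρ 0) / α := by
  rw [fwIntegral_comp_snd h hα Real.measurable_log, integral_congr_ae
    (g := fun t => -α⁻¹ * Real.log t) ((ae_gammaMixture_pos _).mono fun t ht => log_rpow_neg_inv ht),
    integral_const_mul, integral_log_gammaMixture h.zero_mem]
  field_simp
  ring

lemma neg_one_lt_div (hα : 0 < α) (ha : 0 < a) : -1 < a / α := by
  have : 0 < a / α := by positivity
  linarith

lemma fwIntegral_rpow (h : IsWelschFunction ρ) (hα : 0 < α) (ha : 0 < a) :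
    fwIntegral ρ α (fun p => p.2 ^ (-a)) = Upsilon (ρ 0) (a / α) := by
  rw [fwIntegral_comp_snd h hα (f := fun y => y ^ (-a)) (by fun_prop), integral_congr_ae
    (g := fun t => Real.exp (a / α * Real.log t))
    ((ae_gammaMixture_pos _).mono fun t ht => rpow_neg_inv_rpow_neg ht),
    ← mgf_log_gammaMixture h.zero_mem (neg_one_lt_div hα ha), ProbabilityTheory.mgf]

lemma fwIntegral_rpow_mul_log (h : IsWelschFunction ρ) (hα : 0 < α) (ha : 0 < a) :
    fwIntegral ρ α (fun p => p.2 ^ (-a) * Real.log p.2) = -deriv (Upsilon (ρ 0)) (a / α) / α := by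
  rw [fwIntegral_comp_snd h hα (f := fun y => y ^ (-a) * Real.log y) (by fun_prop),
    integral_congr_ae
    (g := fun t => -α⁻¹ * (Real.log t * Real.exp (a / α * Real.log t)))
    ((ae_gammaMixture_pos _).mono fun t ht => by
      simp only [rpow_neg_inv_rpow_neg ht, log_rpow_neg_inv ht]; ring),
    integral_const_mul, ← deriv_Upsilon_eq h.zero_mem (neg_one_lt_div hα ha)]
  field_simp

lemma fwIntegral_rpow_mul_log_sq (h : IsWelschFunction ρ) (hα : 0 < α) (ha : 0 < a) :
    fwIntegral ρ α (fun p => p.2 ^ (-a) * Real.log p.2 ^ 2) =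
      deriv (deriv (Upsilon (ρ 0))) (a / α) / α ^ 2 := by
  rw [fwIntegral_comp_snd h hα (f := fun y => y ^ (-a) * Real.log y ^ 2) (by fun_prop),
    integral_congr_ae
    (g := fun t => (α ^ 2)⁻¹ * (Real.log t ^ 2 * Real.exp (a / α * Real.log t)))
    ((ae_gammaMixture_pos _).mono fun t ht => by
      simp only [rpow_neg_inv_rpow_neg ht, log_rpow_neg_inv ht]; ring),
    integral_const_mul, ← deriv_deriv_Upsilon_eq h.zero_mem (neg_one_lt_div hα ha)]
  field_simp

end FwIntegral

/-! ### Empirical exponential moments and the score function -/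

section ExpMoment

variable {k : ℕ}

/-- The empirical mean of `l ^ j * exp (-a * l)`. -/
noncomputable def expMoment (l : Fin k → ℝ) (j : ℕ) (a : ℝ) : ℝ :=
  (1 / (k : ℝ)) * ∑ i, l i ^ j * Real.exp (-a * l i)

lemma hasDerivAt_expMoment (l : Fin k → ℝ) (j : ℕ) (a : ℝ) :
    HasDerivAt (expMoment l j) (-expMoment l (j + 1) a) a := by
  have h : ∀ i, HasDerivAt (fun a => l i ^ j * Real.exp (-a * l i))
      (-(l i ^ (j + 1) * Real.exp (-a * l i))) a := fun i => by
    have h1 : HasDerivAt (fun a => -a * l i) (-l i) a := by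
      simpa using (hasDerivAt_neg a).mul_const (l i)
    convert! h1.exp.const_mul (l i ^ j) using 1
    ring
  convert! (HasDerivAt.fun_sum fun i (_ : i ∈ Finset.univ) => h i).const_mul (1 / (k : ℝ)) using 1
  rw [expMoment, Finset.sum_neg_distrib, mul_neg]

lemma expMoment_zero_pos (hk : 0 < k) (l : Fin k → ℝ) (a : ℝ) : 0 < expMoment l 0 a := by
  have : Nonempty (Fin k) := ⟨⟨0, hk⟩⟩
  have hk' : (0 : ℝ) < k := by exact_mod_cast hk
  refine mul_pos (by positivity) (Finset.sum_pos (fun i _ => ?_) Finset.univ_nonempty)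
  simpa using Real.exp_pos _

lemma expMoment_nonneg {j : ℕ} (hj : Even j) (l : Fin k → ℝ) (a : ℝ) : 0 ≤ expMoment l j a :=
  mul_nonneg (by positivity)
    (Finset.sum_nonneg fun i _ => mul_nonneg (hj.pow_nonneg _) (Real.exp_pos _).le)

/-- The shapes of the moments in `a`, convex for even order and decreasing for order 1, upgrade
pointwise convergence to convergence at random arguments. -/
lemma convexOn_expMoment {j : ℕ} (hj : Even j) (l : Fin k → ℝ) :
    ConvexOn ℝ univ (expMoment l j) := by
  refine convexOn_of_deriv2_nonneg' convex_univ
    (fun a _ => (hasDerivAt_expMoment l j a).differentiableAt.differentiableWithinAt) ?_ ?_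
  · rw [funext fun a => (hasDerivAt_expMoment l j a).deriv]
    exact fun a _ =>
      (hasDerivAt_expMoment l (j + 1) a).neg.differentiableAt.differentiableWithinAt
  · intro a _
    have h2 : deriv^[2] (expMoment l j) a = expMoment l (j + 2) a := by
      rw [Function.iterate_succ, Function.iterate_one, Function.comp_apply,
        funext fun a => (hasDerivAt_expMoment l j a).deriv]
      have := (hasDerivAt_expMoment l (j + 1) a).neg.deriv
      rwa [neg_neg] at this
    rw [h2]
    exact expMoment_nonneg (hj.add (by decide)) l a

lemma antitone_expMoment_one (l : Fin k → ℝ) : Antitone (expMoment l 1) := by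
  refine antitone_of_deriv_nonpos
    (fun a => (hasDerivAt_expMoment l 1 a).differentiableAt) fun a => ?_
  rw [(hasDerivAt_expMoment l 1 a).deriv, neg_nonpos]
  exact expMoment_nonneg (by decide) l a

/-- Cauchy-Schwarz with the exponential weight split evenly between the two factors. -/
lemma expMoment_one_sq_le (l : Fin k → ℝ) (a : ℝ) :
    expMoment l 1 a ^ 2 ≤ expMoment l 2 a * expMoment l 0 a := by
  have h := Finset.sum_mul_sq_le_sq_mul_sq Finset.univ
    (fun i => l i * Real.exp (-a * l i / 2)) (fun i => Real.exp (-a * l i / 2))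
  have e : ∀ i, Real.exp (-a * l i) = Real.exp (-a * l i / 2) * Real.exp (-a * l i / 2) :=
    fun i => by rw [← Real.exp_add]; ring_nf
  simp only [expMoment, mul_pow, pow_zero, one_mul, pow_one]
  calc (1 / (k : ℝ)) ^ 2 * (∑ i, l i * Real.exp (-a * l i)) ^ 2
      ≤ (1 / (k : ℝ)) ^ 2 * ((∑ i, (l i * Real.exp (-a * l i / 2)) ^ 2) *
        ∑ i, Real.exp (-a * l i / 2) ^ 2) := by
        refine mul_le_mul_of_nonneg_left ?_ (by positivity)
        have e0 : ∀ i, l i * Real.exp (-a * l i) =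
            l i * Real.exp (-a * l i / 2) * Real.exp (-a * l i / 2) := fun i => by rw [e]; ring
        simp only [e0]
        exact h
    _ = _ := by
        have e1 : ∀ i, (l i * Real.exp (-a * l i / 2)) ^ 2 = l i ^ 2 * Real.exp (-a * l i) :=
          fun i => by rw [e]; ring
        have e2 : ∀ i, Real.exp (-a * l i / 2) ^ 2 = Real.exp (-a * l i) :=
          fun i => by rw [e]; ring
        simp only [e1, e2]
        ring

/-- The derivative `2 / a + 2 E[l e^{-a l}] / E[e^{-a l}] - m` of the profile log-likelihood. -/
noncomputable def score (l : Fin k → ℝ) (m a : ℝ) : ℝ :=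
  2 / a + 2 * (expMoment l 1 a / expMoment l 0 a) - m

lemma hasDerivAt_score (hk : 0 < k) (l : Fin k → ℝ) (m : ℝ) {a : ℝ} (ha : 0 < a) :
    HasDerivAt (score l m) (-2 / a ^ 2 - 2 * ((expMoment l 2 a * expMoment l 0 a -
      expMoment l 1 a ^ 2) / expMoment l 0 a ^ 2)) a := by
  have hB := (expMoment_zero_pos hk l a).ne'
  have h1 := ((hasDerivAt_inv ha.ne').const_mul 2).add
    (((hasDerivAt_expMoment l 1 a).div (hasDerivAt_expMoment l 0 a) hB).const_mul 2)
  convert! h1.sub_const m using 1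
  norm_num
  ring

/-- Strictness comes from the term `2 / a` alone, so it survives ties among the observations. -/
lemma score_deriv_neg (l : Fin k → ℝ) {a : ℝ} (ha : 0 < a) :
    -2 / a ^ 2 - 2 * ((expMoment l 2 a * expMoment l 0 a -
      expMoment l 1 a ^ 2) / expMoment l 0 a ^ 2) < 0 := by
  have h1 : 0 ≤ (expMoment l 2 a * expMoment l 0 a -
      expMoment l 1 a ^ 2) / expMoment l 0 a ^ 2 :=
    div_nonneg (sub_nonneg.2 (expMoment_one_sq_le l a)) (sq_nonneg _)
  have h2 : -2 / a ^ 2 < 0 := div_neg_of_neg_of_pos (by norm_num) (by positivity)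
  linarith

lemma score_continuousOn (hk : 0 < k) (l : Fin k → ℝ) (m : ℝ) :
    ContinuousOn (score l m) (Ioi 0) := fun _ ha =>
  (hasDerivAt_score hk l m ha).continuousAt.continuousWithinAt

lemma score_strictAntiOn (hk : 0 < k) (l : Fin k → ℝ) (m : ℝ) :
    StrictAntiOn (score l m) (Ioi 0) := by
  refine strictAntiOn_of_deriv_neg (convex_Ioi 0) (score_continuousOn hk l m) fun a ha => ?_
  rw [interior_Ioi] at ha
  rw [(hasDerivAt_score hk l m ha).deriv]
  exact score_deriv_neg l ha

/-- The score is positive near `0`. -/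
lemma exists_score_pos (hk : 0 < k) (l : Fin k → ℝ) (m : ℝ) {b : ℝ} (hb : 0 < b) :
    ∃ a ∈ Ioo 0 b, 0 < score l m a := by
  have h1 : Tendsto (fun a => 2 * (expMoment l 1 a / expMoment l 0 a) - m) (𝓝[>] 0)
      (𝓝 (2 * (expMoment l 1 0 / expMoment l 0 0) - m)) := by
    refine Tendsto.mono_left ?_ nhdsWithin_le_nhds
    exact (((hasDerivAt_expMoment l 1 0).continuousAt.div (hasDerivAt_expMoment l 0 0).continuousAt
      (expMoment_zero_pos hk l 0).ne').const_mul 2).sub_const m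
  have h2 : Tendsto (fun a : ℝ => 2 * a⁻¹) (𝓝[>] 0) atTop :=
    tendsto_inv_nhdsGT_zero.const_mul_atTop two_pos
  have h3 := (h2.atTop_add h1).eventually_gt_atTop 0
  obtain ⟨a, ha, hab⟩ := (h3.and (Ioo_mem_nhdsGT hb)).exists
  refine ⟨a, hab, ?_⟩
  rw [score, div_eq_mul_inv]
  linarith

lemma exists_score_eq_zero (hk : 0 < k) (l : Fin k → ℝ) (m : ℝ) {a b : ℝ} (ha : 0 < a)
    (hab : a ≤ b) (h0 : 0 ≤ score l m a) (h1 : score l m b ≤ 0) :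
    ∃ c ∈ Icc a b, score l m c = 0 := by
  obtain ⟨c, hc, hc0⟩ := intermediate_value_Icc' hab
    ((score_continuousOn hk l m).mono fun x hx => ha.trans_le hx.1) ⟨h1, h0⟩
  exact ⟨c, hc, hc0⟩

/-! ### Characterization of the maximizer -/

/-- The normalized log-likelihood with the scale parameter `τ` relative to the reference scale. -/
noncomputable def relLogLik (l : Fin k → ℝ) (m a τ : ℝ) : ℝ :=
  2 * Real.log a + 2 * a * Real.log τ - a * m - τ ^ a * expMoment l 0 a

/-- The profile log-likelihood, up to a constant. -/
noncomputable def profileLogLik (l : Fin k → ℝ) (m a : ℝ) : ℝ :=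
  2 * Real.log a - 2 * Real.log (expMoment l 0 a) - a * m

/-- For fixed `a`, the quantity `w = τ ^ a * expMoment l 0 a` runs through all positive reals. The
likelihood thus separates into the profile in `a` and `2 log w - w`, which is largest at `w = 2`. -/
lemma relLogLik_eq (hk : 0 < k) (l : Fin k → ℝ) (m a : ℝ) {τ : ℝ} (hτ : 0 < τ) :
    relLogLik l m a τ = profileLogLik l m a + 2 * Real.log (τ ^ a * expMoment l 0 a)
      - τ ^ a * expMoment l 0 a := by
  rw [relLogLik, profileLogLik, Real.log_mul (Real.rpow_pos_of_pos hτ _).ne'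
    (expMoment_zero_pos hk l a).ne', Real.log_rpow hτ]
  ring

lemma two_mul_log_sub_le {w : ℝ} (hw : 0 < w) : 2 * Real.log w - w ≤ 2 * Real.log 2 - 2 := by
  have := Real.log_le_sub_one_of_pos (half_pos hw)
  rw [Real.log_div hw.ne' two_ne_zero] at this
  linarith

lemma eq_two_of_two_mul_log_sub {w : ℝ} (hw : 0 < w)
    (h : 2 * Real.log 2 - 2 ≤ 2 * Real.log w - w) : w = 2 := by
  by_contra hne
  have := Real.log_lt_sub_one_of_pos (half_pos hw) (fun h => hne (by linarith))
  rw [Real.log_div hw.ne' two_ne_zero] at this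
  linarith

lemma hasDerivAt_profileLogLik (hk : 0 < k) (l : Fin k → ℝ) (m : ℝ) {a : ℝ} (ha : 0 < a) :
    HasDerivAt (profileLogLik l m) (score l m a) a := by
  have h := (((Real.hasDerivAt_log ha.ne').const_mul 2).sub
    (((hasDerivAt_expMoment l 0 a).log (expMoment_zero_pos hk l a).ne').const_mul 2)).sub
    ((hasDerivAt_id a).mul_const m)
  convert! h using 1
  rw [score]
  ring

/-- The derivative of the profile is a decreasing function, so a critical point is a global maximum.
-/
lemma profileLogLik_le_of_score_eq_zero (hk : 0 < k) (l : Fin k → ℝ) (m : ℝ) {a b : ℝ} (ha : 0 < a)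
    (hb : 0 < b) (h : score l m a = 0) : profileLogLik l m b ≤ profileLogLik l m a := by
  have hder : ∀ x, 0 < x → HasDerivAt (profileLogLik l m) (score l m x) x :=
    fun x hx => hasDerivAt_profileLogLik hk l m hx
  have hanti := (score_strictAntiOn hk l m).antitoneOn
  rcases lt_trichotomy a b with hab | rfl | hab
  · obtain ⟨c, hc, hc'⟩ := exists_hasDerivAt_eq_slope _ _ hab
      (fun x hx => (hder x (ha.trans_le hx.1)).continuousAt.continuousWithinAt)
      (fun x hx => hder x (ha.trans hx.1))
    have h1 := hanti ha (ha.trans hc.1) hc.1.le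
    rw [h, hc', div_le_iff₀ (by linarith)] at h1
    linarith
  · exact le_rfl
  · obtain ⟨c, hc, hc'⟩ := exists_hasDerivAt_eq_slope _ _ hab
      (fun x hx => (hder x (hb.trans_le hx.1)).continuousAt.continuousWithinAt)
      (fun x hx => hder x (hb.trans hx.1))
    have h1 := hanti (hb.trans hc.1) ha hc.2.le
    rw [h, hc', le_div_iff₀ (by linarith)] at h1
    linarith

lemma rpow_inv_rpow_mul (hk : 0 < k) (l : Fin k → ℝ) {a : ℝ} (ha : 0 < a) :
    ((2 / expMoment l 0 a) ^ a⁻¹) ^ a * expMoment l 0 a = 2 := by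
  have hB := expMoment_zero_pos hk l a
  rw [Real.rpow_inv_rpow (by positivity) ha.ne', div_mul_cancel₀ _ hB.ne']

/-- The maximizers of the log-likelihood are the solutions of the score equations. -/
lemma relLogLik_isMax_iff (hk : 0 < k) (l : Fin k → ℝ) (m : ℝ) {a τ : ℝ} (ha : 0 < a)
    (hτ : 0 < τ) :
    (∀ a' τ', 0 < a' → 0 < τ' → relLogLik l m a' τ' ≤ relLogLik l m a τ) ↔
      score l m a = 0 ∧ τ ^ a * expMoment l 0 a = 2 := by
  have hB := fun a => expMoment_zero_pos hk l a
  have hw : 0 < τ ^ a * expMoment l 0 a := mul_pos (Real.rpow_pos_of_pos hτ _) (hB a)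
  constructor
  · intro h
    -- The competitor at shape `a'` is given its best scale, the one for which `w = 2`.
    have hopt : ∀ a', 0 < a' → profileLogLik l m a' + 2 * Real.log 2 - 2 ≤ relLogLik l m a τ :=
      fun a' ha' => by
        have hp : 0 < 2 / expMoment l 0 a' := div_pos two_pos (hB a')
        have := h a' ((2 / expMoment l 0 a') ^ a'⁻¹) ha' (Real.rpow_pos_of_pos hp _)
        rwa [relLogLik_eq hk l m a' (Real.rpow_pos_of_pos hp _), rpow_inv_rpow_mul hk l ha'] at this
    have h2 : τ ^ a * expMoment l 0 a = 2 := by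
      refine eq_two_of_two_mul_log_sub hw ?_
      have := hopt a ha
      rw [relLogLik_eq hk l m a hτ] at this
      linarith
    refine ⟨?_, h2⟩
    have hmax : IsLocalMax (profileLogLik l m) a := by
      filter_upwards [Ioi_mem_nhds ha] with a' ha'
      have := hopt a' ha'
      rw [relLogLik_eq hk l m a hτ, h2] at this
      linarith
    exact hmax.hasDerivAt_eq_zero (hasDerivAt_profileLogLik hk l m ha)
  · rintro ⟨h1, h2⟩ a' τ' ha' hτ'
    rw [relLogLik_eq hk l m a hτ, relLogLik_eq hk l m a' hτ', h2]
    have := two_mul_log_sub_le (mul_pos (Real.rpow_pos_of_pos hτ' a') (hB a'))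
    have := profileLogLik_le_of_score_eq_zero hk l m ha ha' h1
    linarith

/-- The logarithms of the rescaled second components. -/
noncomputable def logSnd (z : Fin k → ℝ × ℝ) (s : ℝ) (i : Fin k) : ℝ := Real.log ((z i).2 / s)

/-- The mean of the logarithms of all rescaled components. -/
noncomputable def logMean (z : Fin k → ℝ × ℝ) (s : ℝ) : ℝ :=
  empMean z s (fun p => Real.log p.1) + empMean z s (fun p => Real.log p.2)

/-- Dividing the data by a reference scale changes the likelihood only by a factor `k` and a term
free of the parameters. -/
lemma logLik_eq (hk : 0 < k) {z : Fin k → ℝ × ℝ} (hz : ∀ i, 0 < (z i).1 ∧ 0 < (z i).2) {s : ℝ}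
    (hs : 0 < s) (a : ℝ) {σ : ℝ} (hσ : 0 < σ) :
    logLik z a σ = k * relLogLik (logSnd z s) (logMean z s) a (σ / s) -
      ∑ i, Real.log ((z i).1 * (z i).2) := by
  have hk' : (k : ℝ) ≠ 0 := by exact_mod_cast hk.ne'
  have e1 : ∀ i, σ ^ a * (z i).2 ^ (-a) = (σ / s) ^ a * Real.exp (-a * logSnd z s i) := fun i => by
    rw [mul_comm (-a), logSnd, ← Real.rpow_def_of_pos (div_pos (hz i).2 hs),
      Real.div_rpow hσ.le hs.le, Real.div_rpow (hz i).2.le hs.le, Real.rpow_neg hs.le a]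
    have := (Real.rpow_pos_of_pos hs a).ne'
    field_simp
  have e2 : ∀ i, Real.log ((z i).1 * (z i).2) =
      Real.log ((z i).1 / s) + Real.log ((z i).2 / s) + 2 * Real.log s := fun i => by
    rw [Real.log_mul (hz i).1.ne' (hz i).2.ne', Real.log_div (hz i).1.ne' hs.ne',
      Real.log_div (hz i).2.ne' hs.ne']
    ring
  simp only [logLik, relLogLik, logMean, empMean, expMoment, e1, pow_zero, one_mul,
    Real.log_div hσ.ne' hs.ne']
  rw [Finset.sum_add_distrib, ← Finset.mul_sum, ← Finset.mul_sum]
  simp only [e2]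
  rw [Finset.sum_add_distrib, Finset.sum_add_distrib, Finset.sum_const, Finset.card_univ,
    Fintype.card_fin, nsmul_eq_mul]
  field_simp
  ring

/-- The reference scale `s` is free: `s = σ_n` serves the asymptotics, `s = 1` the measurability of
the estimator. -/
lemma isMLE_iff (hk : 0 < k) {z : Fin k → ℝ × ℝ} (hz : ∀ i, 0 < (z i).1 ∧ 0 < (z i).2) {s : ℝ}
    (hs : 0 < s) (θ : ℝ × ℝ) :
    IsMLE z θ ↔ 0 < θ.1 ∧ 0 < θ.2 ∧ score (logSnd z s) (logMean z s) θ.1 = 0 ∧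
      (θ.2 / s) ^ θ.1 * expMoment (logSnd z s) 0 θ.1 = 2 := by
  have hk' : (0 : ℝ) < k := by exact_mod_cast hk
  rw [IsMLE, mem_prod, mem_Ioi, mem_Ioi, and_assoc]
  refine and_congr_right fun ha => and_congr_right fun hσ => ?_
  rw [← relLogLik_isMax_iff hk _ _ ha (div_pos hσ hs)]
  constructor
  · intro h a' τ' ha' hτ'
    have := h (show (a', τ' * s) ∈ Ioi (0 : ℝ) ×ˢ Ioi (0 : ℝ) from ⟨ha', mul_pos hτ' hs⟩)
    simp only [mem_ofPred_eq] at this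
    rw [logLik_eq hk hz hs _ hσ, logLik_eq hk hz hs _ (mul_pos hτ' hs),
      mul_div_cancel_right₀ _ hs.ne'] at this
    exact le_of_mul_le_mul_left (by linarith) hk'
  · rintro h ⟨a', σ'⟩ ⟨ha', hσ'⟩
    simp only [mem_ofPred_eq]
    rw [logLik_eq hk hz hs _ hσ, logLik_eq hk hz hs _ hσ']
    have := mul_le_mul_of_nonneg_left (h a' (σ' / s) ha' (div_pos hσ' hs)) hk'.le
    linarith

lemma exists_isMLE_iff (hk : 0 < k) {z : Fin k → ℝ × ℝ} (hz : ∀ i, 0 < (z i).1 ∧ 0 < (z i).2)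
    {s : ℝ} (hs : 0 < s) :
    (∃ θ, IsMLE z θ) ↔ ∃ a, 0 < a ∧ score (logSnd z s) (logMean z s) a = 0 := by
  constructor
  · rintro ⟨θ, hθ⟩
    have := (isMLE_iff hk hz hs θ).1 hθ
    exact ⟨θ.1, this.1, this.2.2.1⟩
  · rintro ⟨a, ha, h⟩
    have hp : 0 < (2 / expMoment (logSnd z s) 0 a) ^ a⁻¹ :=
      Real.rpow_pos_of_pos (div_pos two_pos (expMoment_zero_pos hk _ a)) _
    refine ⟨(a, (2 / expMoment (logSnd z s) 0 a) ^ a⁻¹ * s), (isMLE_iff hk hz hs _).2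
      ⟨ha, mul_pos hp hs, h, ?_⟩⟩
    simp only
    rw [mul_div_cancel_right₀ _ hs.ne', rpow_inv_rpow_mul hk _ ha]

/-- The estimator solves the score equations as soon as these have a solution. -/
lemma mle_spec (hk : 0 < k) {z : Fin k → ℝ × ℝ} (hz : ∀ i, 0 < (z i).1 ∧ 0 < (z i).2) {s : ℝ}
    (hs : 0 < s) (c : ℝ) (hne : ¬ ∀ i j, z i = z j) {a : ℝ} (ha : 0 < a)
    (h : score (logSnd z s) (logMean z s) a = 0) :
    (mle c z).1 = a ∧ 0 < (mle c z).2 ∧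
      ((mle c z).2 / s) ^ a * expMoment (logSnd z s) 0 a = 2 := by
  have hex : (¬ ∀ i j, z i = z j) ∧ ∃ θ, IsMLE z θ :=
    ⟨hne, (exists_isMLE_iff hk hz hs).2 ⟨a, ha, h⟩⟩
  have hm : IsMLE z (mle c z) := by
    rw [mle, dif_pos hex]
    exact hex.2.choose_spec
  obtain ⟨h1, h2, h3, h4⟩ := (isMLE_iff hk hz hs _).1 hm
  have : (mle c z).1 = a := (score_strictAntiOn hk _ _).injOn h1 ha (h3.trans h.symm)
  rw [this] at h4
  exact ⟨this, h2, h4⟩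

/-! ### Averages of the test functions as exponential moments. -/

variable {z : Fin k → ℝ × ℝ}

lemma empMean_rpow (hz : ∀ i, 0 < (z i).2) {s : ℝ} (hs : 0 < s) (a : ℝ) :
    empMean z s (fun p => p.2 ^ (-a)) = expMoment (logSnd z s) 0 a := by
  simp only [empMean, expMoment, logSnd, Real.rpow_def_of_pos (div_pos (hz _) hs)]
  congr! 2 with i
  rw [pow_zero, one_mul]; ring_nf

lemma empMean_rpow_mul_log (hz : ∀ i, 0 < (z i).2) {s : ℝ} (hs : 0 < s) (a : ℝ) :
    empMean z s (fun p => p.2 ^ (-a) * Real.log p.2) = expMoment (logSnd z s) 1 a := by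
  simp only [empMean, expMoment, logSnd, Real.rpow_def_of_pos (div_pos (hz _) hs)]
  congr! 2 with i
  rw [pow_one]; ring_nf

lemma empMean_rpow_mul_log_sq (hz : ∀ i, 0 < (z i).2) {s : ℝ} (hs : 0 < s) (a : ℝ) :
    empMean z s (fun p => p.2 ^ (-a) * Real.log p.2 ^ 2) = expMoment (logSnd z s) 2 a := by
  simp only [empMean, expMoment, logSnd, Real.rpow_def_of_pos (div_pos (hz _) hs)]
  congr! 2 with i
  ring_nf

end ExpMoment

/-! ### Limits of convex and of monotone functions at moving arguments -/

section Moving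

variable {ι : Type*} {F : Filter ι} {g : ι → ℝ → ℝ} {G : ℝ → ℝ} {x : ℝ} {ξ : ι → ℝ}

/-- Monotonicity traps the value at the moving point between the values at the two fixed points `x ±
δ / 2`. -/
lemma tendsto_apply_of_antitone (hg : ∀ i, Antitone (g i)) (hG : ContinuousAt G x)
    (h : ∀ᶠ y in 𝓝 x, Tendsto (fun i => g i y) F (𝓝 (G y))) (hξ : Tendsto ξ F (𝓝 x)) :
    Tendsto (fun i => g i (ξ i)) F (𝓝 (G x)) := by
  rw [Metric.tendsto_nhds]
  intro ε hε
  obtain ⟨δ, hδ, hball⟩ := Metric.eventually_nhds_iff.1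
    (h.and (Metric.tendsto_nhds.1 hG (ε / 2) (half_pos hε)))
  have hm : dist (x - δ / 2) x < δ := by
    rw [Real.dist_eq, show x - δ / 2 - x = -(δ / 2) by ring, abs_neg, abs_of_pos (half_pos hδ)]
    exact half_lt_self hδ
  have hp : dist (x + δ / 2) x < δ := by
    rw [Real.dist_eq, add_sub_cancel_left, abs_of_pos (half_pos hδ)]
    exact half_lt_self hδ
  filter_upwards [Metric.tendsto_nhds.1 (hball hm).1 (ε / 2) (half_pos hε),
    Metric.tendsto_nhds.1 (hball hp).1 (ε / 2) (half_pos hε),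
    Metric.tendsto_nhds.1 hξ (δ / 2) (half_pos hδ)] with i h1 h2 h3
  have h4 := (hball hm).2
  have h5 := (hball hp).2
  rw [Real.dist_eq, abs_lt] at *
  have h6 := hg i (show x - δ / 2 ≤ ξ i by linarith)
  have h7 := hg i (show ξ i ≤ x + δ / 2 by linarith)
  constructor <;> linarith

/-- Convexity bounds values near `x` from above by the endpoint values. Reflecting the moving point
about `x` turns this upper bound into a lower one. -/
lemma tendsto_apply_of_convexOn (hg : ∀ i, ConvexOn ℝ univ (g i)) (hG : ContinuousAt G x)
    (h : ∀ᶠ y in 𝓝 x, Tendsto (fun i => g i y) F (𝓝 (G y))) (hξ : Tendsto ξ F (𝓝 x)) :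
    Tendsto (fun i => g i (ξ i)) F (𝓝 (G x)) := by
  rw [Metric.tendsto_nhds]
  intro ε hε
  have hε' : 0 < ε / 5 := by linarith
  obtain ⟨δ, hδ, hball⟩ := Metric.eventually_nhds_iff.1
    (h.and (Metric.tendsto_nhds.1 hG (ε / 5) hε'))
  have hm : dist (x - δ / 2) x < δ := by
    rw [Real.dist_eq, show x - δ / 2 - x = -(δ / 2) by ring, abs_neg, abs_of_pos (half_pos hδ)]
    exact half_lt_self hδ
  have hp : dist (x + δ / 2) x < δ := by
    rw [Real.dist_eq, add_sub_cancel_left, abs_of_pos (half_pos hδ)]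
    exact half_lt_self hδ
  filter_upwards [Metric.tendsto_nhds.1 (hball hm).1 (ε / 5) hε',
    Metric.tendsto_nhds.1 (hball hp).1 (ε / 5) hε',
    Metric.tendsto_nhds.1 h.self_of_nhds (ε / 5) hε',
    Metric.tendsto_nhds.1 hξ (δ / 2) (half_pos hδ)] with i h1 h2 h0 h3
  have h4 := (hball hm).2
  have h5 := (hball hp).2
  rw [Real.dist_eq, abs_lt] at *
  have hup : ∀ y ∈ Icc (x - δ / 2) (x + δ / 2), g i y < G x + 2 * (ε / 5) := fun y hy =>
    ((hg i).le_max_of_mem_Icc trivial trivial hy).trans_lt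
      (max_lt (by linarith) (by linarith))
  have h6 := hup (ξ i) ⟨by linarith, by linarith⟩
  have h7 := hup (2 * x - ξ i) ⟨by linarith, by linarith⟩
  have hc := (hg i).2
  -- Midpoint convexity yields `g(ξ) ≥ 2 g(x) - g(2x - ξ) > G(x) - 4ε/5`, whence the choice of `ε /
  -- 5`.
  have h8 := hc (mem_univ (ξ i)) (mem_univ (2 * x - ξ i)) (show (0 : ℝ) ≤ 1 / 2 by norm_num)
    (show (0 : ℝ) ≤ 1 / 2 by norm_num) (by norm_num)
  simp only [smul_eq_mul] at h8
  rw [show 1 / 2 * ξ i + 1 / 2 * (2 * x - ξ i) = x by ring] at h8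
  constructor <;> linarith

lemma exists_hasDerivAt_eq_sub {f f' : ℝ → ℝ} {a b : ℝ} (ha : 0 < a) (hb : 0 < b)
    (hf : ∀ x, 0 < x → HasDerivAt f (f' x) x) : ∃ c ∈ uIcc a b, f b - f a = f' c * (b - a) := by
  rcases lt_trichotomy a b with hab | rfl | hab
  · obtain ⟨c, hc, hc'⟩ := exists_hasDerivAt_eq_slope f f' hab
      (fun x hx => (hf x (ha.trans_le hx.1)).continuousAt.continuousWithinAt)
      (fun x hx => hf x (ha.trans hx.1))
    refine ⟨c, Icc_subset_uIcc ⟨hc.1.le, hc.2.le⟩, ?_⟩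
    rw [hc', div_mul_cancel₀ _ (by linarith)]
  · exact ⟨a, left_mem_uIcc, by simp⟩
  · obtain ⟨c, hc, hc'⟩ := exists_hasDerivAt_eq_slope f f' hab
      (fun x hx => (hf x (hb.trans_le hx.1)).continuousAt.continuousWithinAt)
      (fun x hx => hf x (hb.trans hx.1))
    refine ⟨c, Icc_subset_uIcc' ⟨hc.1.le, hc.2.le⟩, ?_⟩
    have : a - b ≠ 0 := by linarith
    rw [hc']
    field_simp
    ring

lemma tendsto_of_mem_uIcc {a : ℝ} {b : ι → ℝ} (hb : Tendsto b F (𝓝 a))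
    (hξ : ∀ᶠ i in F, ξ i ∈ uIcc a (b i)) : Tendsto ξ F (𝓝 a) := by
  rw [Metric.tendsto_nhds] at hb ⊢
  intro ε hε
  filter_upwards [hb ε hε, hξ] with i h1 h2
  refine lt_of_le_of_lt ?_ h1
  rw [Real.dist_eq, Real.dist_eq]
  exact abs_sub_left_of_mem_uIcc h2

/-- A linear form with convergent coefficients agrees with the limit form up to `o(1 + ‖G‖)`. -/
lemma isLittleO_of_dotProduct {n : ℕ} {E e : ι → ℝ} {cf : ι → Fin n → ℝ} {M : Fin n → ℝ}
    {W : ι → Fin n → ℝ} (hcf : Tendsto cf F (𝓝 M)) (he : Tendsto e F (𝓝 0))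
    (h : ∀ᶠ i in F, E i = cf i ⬝ᵥ W i + e i) :
    (fun i => E i - M ⬝ᵥ W i) =o[F] fun i => 1 + ‖W i‖ := by
  have h1 : (fun i => (cf i - M) ⬝ᵥ W i) =o[F] fun i => 1 + ‖W i‖ := by
    have hO : (fun i => (cf i - M) ⬝ᵥ W i) =O[F] fun i => ‖cf i - M‖ * (1 + ‖W i‖) := by
      -- The norm is the supremum norm, so the sum of `n` products costs a factor `n`.
      refine IsBigO.of_bound n (Eventually.of_forall fun i => ?_)
      rw [dotProduct, Real.norm_of_nonneg (by positivity : 0 ≤ ‖cf i - M‖ * (1 + ‖W i‖))]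
      refine (norm_sum_le _ _).trans ((Finset.sum_le_card_nsmul _ _
        (‖cf i - M‖ * (1 + ‖W i‖)) fun j _ => ?_).trans (by simp))
      rw [norm_mul]
      refine mul_le_mul (norm_le_pi_norm _ j) ?_ (norm_nonneg _) (norm_nonneg _)
      linarith [norm_le_pi_norm (W i) j]
    refine hO.trans_isLittleO ?_
    have h0 : (fun i => ‖cf i - M‖) =o[F] fun _ => (1 : ℝ) := by
      rw [isLittleO_one_iff]
      simpa using (hcf.sub_const M).norm
    simpa using h0.mul_isBigO (isBigO_refl (fun i => 1 + ‖W i‖) F)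
  have h2 : e =o[F] fun i => 1 + ‖W i‖ := by
    refine ((isLittleO_one_iff ℝ).2 he).trans_isBigO (IsBigO.of_bound 1 (Eventually.of_forall
      fun i => ?_))
    rw [norm_one, one_mul, Real.norm_of_nonneg (by positivity)]
    linarith [norm_nonneg (W i)]
  refine (h1.add h2).congr' ?_ EventuallyEq.rfl
  filter_upwards [h] with i hi
  rw [hi, sub_dotProduct]
  ring

end Moving

/-! ### The expansion along a filter -/

/-- Samples indexed by `ι` whose rescaled averages converge along a filter `F` to the integrals
with respect to the Fréchet-Welsch law, for all functions in the class `F₂(am, ap)`. -/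
structure IsConvergentSample {ι : Type*} (F : Filter ι) (ρ : ℝ → ℝ) (α₀ am ap : ℝ) (k : ι → ℕ)
    (z : (i : ι) → Fin (k i) → ℝ × ℝ) (s : ι → ℝ) : Prop where
  size_pos : ∀ i, 0 < k i
  sample_pos : ∀ i j, 0 < (z i j).1 ∧ 0 < (z i j).2
  scale_pos : ∀ i, 0 < s i
  welsch : IsWelschFunction ρ
  alpha_pos : 0 < α₀
  am_pos : 0 < am
  am_lt : am < alphaOne (ρ 0) α₀
  lt_ap : alphaOne (ρ 0) α₀ < ap
  lln : ∀ f ∈ classF2 am ap, Tendsto (fun i => empMean (z i) (s i) f) F (𝓝 (fwIntegral ρ α₀ f))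
  not_all_eq : ∀ᶠ i in F, ¬ ∀ j j', z i j = z i j'

namespace IsConvergentSample

variable {ι : Type*} {F : Filter ι} {ρ : ℝ → ℝ} {α₀ am ap : ℝ} {k : ι → ℕ}
  {z : (i : ι) → Fin (k i) → ℝ × ℝ} {s : ι → ℝ}

lemma varpi_pos (h : IsConvergentSample F ρ α₀ am ap k z s) : 0 < varpi (ρ 0) :=
  (varpi_spec h.welsch.zero_mem).1

lemma alphaOne_pos (h : IsConvergentSample F ρ α₀ am ap k z s) : 0 < alphaOne (ρ 0) α₀ :=
  h.am_pos.trans h.am_lt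

lemma alphaOne_div (h : IsConvergentSample F ρ α₀ am ap k z s) :
    alphaOne (ρ 0) α₀ / α₀ = varpi (ρ 0) := by
  rw [alphaOne, mul_div_cancel_right₀ _ h.alpha_pos.ne']

lemma tendsto_expMoment_zero (h : IsConvergentSample F ρ α₀ am ap k z s) {a : ℝ}
    (ha : a ∈ Ioo am ap) :
    Tendsto (fun i => expMoment (logSnd (z i) (s i)) 0 a) F (𝓝 (Upsilon (ρ 0) (a / α₀))) := by
  rw [← fwIntegral_rpow h.welsch h.alpha_pos (h.am_pos.trans ha.1)]
  refine (h.lln _ (Or.inl (Or.inl (Or.inr ⟨a, ha.1, ha.2, rfl⟩)))).congr fun i => ?_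
  exact empMean_rpow (fun j => (h.sample_pos i j).2) (h.scale_pos i) a

lemma tendsto_expMoment_one (h : IsConvergentSample F ρ α₀ am ap k z s) {a : ℝ}
    (ha : a ∈ Ioo am ap) :
    Tendsto (fun i => expMoment (logSnd (z i) (s i)) 1 a) F
      (𝓝 (-deriv (Upsilon (ρ 0)) (a / α₀) / α₀)) := by
  rw [← fwIntegral_rpow_mul_log h.welsch h.alpha_pos (h.am_pos.trans ha.1)]
  refine (h.lln _ (Or.inl (Or.inr ⟨a, ha.1, ha.2, rfl⟩))).congr fun i => ?_
  exact empMean_rpow_mul_log (fun j => (h.sample_pos i j).2) (h.scale_pos i) a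

lemma tendsto_expMoment_two (h : IsConvergentSample F ρ α₀ am ap k z s) {a : ℝ}
    (ha : a ∈ Ioo am ap) :
    Tendsto (fun i => expMoment (logSnd (z i) (s i)) 2 a) F
      (𝓝 (deriv (deriv (Upsilon (ρ 0))) (a / α₀) / α₀ ^ 2)) := by
  rw [← fwIntegral_rpow_mul_log_sq h.welsch h.alpha_pos (h.am_pos.trans ha.1)]
  refine (h.lln _ (Or.inr ⟨a, ha.1, ha.2, rfl⟩)).congr fun i => ?_
  exact empMean_rpow_mul_log_sq (fun j => (h.sample_pos i j).2) (h.scale_pos i) a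

lemma tendsto_logMean (h : IsConvergentSample F ρ α₀ am ap k z s) :
    Tendsto (fun i => logMean (z i) (s i)) F
      (𝓝 (Real.eulerMascheroniConstant / α₀ + (Real.eulerMascheroniConstant - ρ 0) / α₀)) := by
  rw [← fwIntegral_log_fst h.welsch h.alpha_pos, ← fwIntegral_log_snd h.welsch h.alpha_pos]
  exact (h.lln _ (Or.inl (Or.inl (Or.inl (Or.inl rfl))))).add
    (h.lln _ (Or.inl (Or.inl (Or.inl (Or.inr rfl)))))

/-- This limit is the origin of `Π`: its zero `ϖ` times `α₀` is the shape that the misspecified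
likelihood actually estimates. -/
lemma tendsto_score (h : IsConvergentSample F ρ α₀ am ap k z s) {a : ℝ} (ha : a ∈ Ioo am ap) :
    Tendsto (fun i => score (logSnd (z i) (s i)) (logMean (z i) (s i)) a) F
      (𝓝 (2 / α₀ * PiFun (ρ 0) (a / α₀))) := by
  have ha0 := h.am_pos.trans ha.1
  have hα := h.alpha_pos.ne'
  have hU := (Upsilon_pos h.welsch.zero_mem (neg_one_lt_div h.alpha_pos ha0)).ne'
  have h1 := ((((h.tendsto_expMoment_one ha).div (h.tendsto_expMoment_zero ha) hU).const_mul
    2).const_add (2 / a)).sub h.tendsto_logMean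
  convert! h1 using 2
  rw [PiFun]
  field_simp
  ring

lemma eventually_mem (h : IsConvergentSample F ρ α₀ am ap k z s) :
    ∀ᶠ a in 𝓝 (alphaOne (ρ 0) α₀), a ∈ Ioo am ap := Ioo_mem_nhds h.am_lt h.lt_ap

/-- The limit of the score is positive at some `a < α₁` and negative at some `b > α₁`. Eventually so
is the score itself, and its unique zero, which is the estimator, lies between them. -/
lemma eventually_mle_mem (h : IsConvergentSample F ρ α₀ am ap k z s) (c : ι → ℝ) {ε : ℝ}
    (hε : 0 < ε) : ∀ᶠ i in F,
      ((mle (c i) (z i)).1 ∈ Icc (alphaOne (ρ 0) α₀ - ε) (alphaOne (ρ 0) α₀ + ε)) ∧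
      0 < (mle (c i) (z i)).1 ∧
      score (logSnd (z i) (s i)) (logMean (z i) (s i)) (mle (c i) (z i)).1 = 0 ∧
      0 < (mle (c i) (z i)).2 / s i ∧
      ((mle (c i) (z i)).2 / s i) ^ (mle (c i) (z i)).1 *
        expMoment (logSnd (z i) (s i)) 0 (mle (c i) (z i)).1 = 2 := by
  set α₁ := alphaOne (ρ 0) α₀ with hα₁
  have hα := h.alpha_pos
  have hr := h.welsch.zero_mem
  -- The points must be within `ε` of `α₁` and also inside `(am, ap)`, where the laws of large
  -- numbers are assumed.
  obtain ⟨a, ha, haε⟩ : ∃ a ∈ Ioo am α₁, α₁ - ε ≤ a := by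
    obtain ⟨a, ha, ha'⟩ := exists_between (max_lt h.am_lt (show α₁ - ε < α₁ by linarith))
    exact ⟨a, ⟨(le_max_left _ _).trans_lt ha, ha'⟩, (le_max_right _ _).trans ha.le⟩
  obtain ⟨b, hb, hbε⟩ : ∃ b ∈ Ioo α₁ ap, b ≤ α₁ + ε := by
    obtain ⟨b, hb', hb⟩ := exists_between (lt_min h.lt_ap (show α₁ < α₁ + ε by linarith))
    exact ⟨b, ⟨hb', hb.trans_le (min_le_left _ _)⟩, hb.le.trans (min_le_right _ _)⟩
  have ha0 : 0 < a := h.am_pos.trans ha.1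
  have hb0 : 0 < b := h.alphaOne_pos.trans hb.1
  have hpos : 0 < 2 / α₀ * PiFun (ρ 0) (a / α₀) := by
    refine mul_pos (by positivity) ?_
    refine (varpi_spec hr).2.symm.trans_lt ?_
    refine PiFun_strictAntiOn hr (show 0 < a / α₀ by positivity) h.varpi_pos ?_
    rw [← h.alphaOne_div]
    exact div_lt_div_of_pos_right ha.2 hα
  have hneg : 2 / α₀ * PiFun (ρ 0) (b / α₀) < 0 := by
    refine mul_neg_of_pos_of_neg (by positivity) ?_
    refine lt_of_lt_of_eq ?_ (varpi_spec hr).2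
    refine PiFun_strictAntiOn hr h.varpi_pos (show 0 < b / α₀ by positivity) ?_
    rw [← h.alphaOne_div]
    exact div_lt_div_of_pos_right hb.1 hα
  filter_upwards [h.not_all_eq, (h.tendsto_score ⟨ha.1, ha.2.trans h.lt_ap⟩).eventually_const_lt hpos,
    (h.tendsto_score ⟨h.am_lt.trans hb.1, hb.2⟩).eventually_lt_const hneg] with i hi h1 h2
  obtain ⟨x, hx, hx0⟩ := exists_score_eq_zero (h.size_pos i) _ _ ha0 (ha.2.trans hb.1).le h1.le h2.le
  have hxpos := ha0.trans_le hx.1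
  obtain ⟨e1, e2, e3⟩ := mle_spec (h.size_pos i) (h.sample_pos i) (h.scale_pos i) (c i) hi hxpos hx0
  rw [e1]
  exact ⟨⟨haε.trans hx.1, hx.2.trans hbε⟩, hxpos, hx0, div_pos e2 (h.scale_pos i), e3⟩

lemma tendsto_mle (h : IsConvergentSample F ρ α₀ am ap k z s) (c : ι → ℝ) :
    Tendsto (fun i => (mle (c i) (z i)).1) F (𝓝 (alphaOne (ρ 0) α₀)) := by
  rw [Metric.tendsto_nhds]
  intro ε hε
  filter_upwards [h.eventually_mle_mem c (half_pos hε)] with i hi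
  rw [Real.dist_eq, abs_lt]
  constructor <;> linarith [hi.1.1, hi.1.2]

/-! ### Moments at arguments converging to `α₁`, and the slope of the score. -/

variable {ξ : ι → ℝ}

lemma tendsto_expMoment_zero_apply (h : IsConvergentSample F ρ α₀ am ap k z s)
    (hξ : Tendsto ξ F (𝓝 (alphaOne (ρ 0) α₀))) :
    Tendsto (fun i => expMoment (logSnd (z i) (s i)) 0 (ξ i)) F
      (𝓝 (Upsilon (ρ 0) (varpi (ρ 0)))) := by
  have := tendsto_apply_of_convexOn (G := fun a => Upsilon (ρ 0) (a / α₀))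
    (fun i => convexOn_expMoment (j := 0) (by decide) (logSnd (z i) (s i))) (x := alphaOne (ρ 0) α₀) ?_
    (h.eventually_mem.mono fun a ha => h.tendsto_expMoment_zero ha) hξ
  · simpa only [h.alphaOne_div] using this
  · refine ContinuousAt.comp (g := Upsilon (ρ 0)) ?_ (by fun_prop)
    exact (analyticAt_Upsilon h.welsch.zero_mem
      (neg_one_lt_div h.alpha_pos h.alphaOne_pos)).continuousAt

lemma tendsto_expMoment_one_apply (h : IsConvergentSample F ρ α₀ am ap k z s)
    (hξ : Tendsto ξ F (𝓝 (alphaOne (ρ 0) α₀))) :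
    Tendsto (fun i => expMoment (logSnd (z i) (s i)) 1 (ξ i)) F
      (𝓝 (-deriv (Upsilon (ρ 0)) (varpi (ρ 0)) / α₀)) := by
  have := tendsto_apply_of_antitone (G := fun a => -deriv (Upsilon (ρ 0)) (a / α₀) / α₀)
    (fun i => antitone_expMoment_one (logSnd (z i) (s i))) (x := alphaOne (ρ 0) α₀) ?_
    (h.eventually_mem.mono fun a ha => h.tendsto_expMoment_one ha) hξ
  · simpa only [h.alphaOne_div] using this
  · refine (ContinuousAt.comp (g := deriv (Upsilon (ρ 0))) ?_ (by fun_prop)).neg.div_const _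
    exact (analyticAt_Upsilon h.welsch.zero_mem
      (neg_one_lt_div h.alpha_pos h.alphaOne_pos)).deriv.continuousAt

lemma tendsto_expMoment_two_apply (h : IsConvergentSample F ρ α₀ am ap k z s)
    (hξ : Tendsto ξ F (𝓝 (alphaOne (ρ 0) α₀))) :
    Tendsto (fun i => expMoment (logSnd (z i) (s i)) 2 (ξ i)) F
      (𝓝 (deriv (deriv (Upsilon (ρ 0))) (varpi (ρ 0)) / α₀ ^ 2)) := by
  have := tendsto_apply_of_convexOn (G := fun a => deriv (deriv (Upsilon (ρ 0))) (a / α₀) / α₀ ^ 2)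
    (fun i => convexOn_expMoment (j := 2) (by decide) (logSnd (z i) (s i)))
    (x := alphaOne (ρ 0) α₀) ?_
    (h.eventually_mem.mono fun a ha => h.tendsto_expMoment_two ha) hξ
  · simpa only [h.alphaOne_div] using this
  · refine (ContinuousAt.comp (g := deriv (deriv (Upsilon (ρ 0)))) ?_ (by fun_prop)).div_const _
    exact (analyticAt_Upsilon h.welsch.zero_mem
      (neg_one_lt_div h.alpha_pos h.alphaOne_pos)).deriv.deriv.continuousAt

lemma Upsilon_varpi_pos (h : IsConvergentSample F ρ α₀ am ap k z s) :
    0 < Upsilon (ρ 0) (varpi (ρ 0)) :=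
  Upsilon_pos h.welsch.zero_mem (by linarith [h.varpi_pos])

lemma psiDot_neg (h : IsConvergentSample F ρ α₀ am ap k z s) : psiDot (ρ 0) α₀ < 0 := by
  have h1 := h.alphaOne_pos
  have h2 := Upsilon_logConvex h.welsch.zero_mem (s := varpi (ρ 0)) (by linarith [h.varpi_pos])
  have h3 : -2 / alphaOne (ρ 0) α₀ ^ 2 < 0 := div_neg_of_neg_of_pos (by norm_num) (by positivity)
  have h4 : 0 ≤ 2 * (deriv (deriv (Upsilon (ρ 0))) (varpi (ρ 0)) * Upsilon (ρ 0) (varpi (ρ 0))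
        - deriv (Upsilon (ρ 0)) (varpi (ρ 0)) ^ 2) / (α₀ ^ 2 * Upsilon (ρ 0) (varpi (ρ 0)) ^ 2) :=
    div_nonneg (by linarith) (by positivity)
  rw [psiDot]
  linarith

/-- The slope of the score between `α₁` and the estimator converges to `psiDot`. -/
lemma exists_score_slope (h : IsConvergentSample F ρ α₀ am ap k z s) (c : ι → ℝ) :
    ∃ D : ι → ℝ, Tendsto D F (𝓝 (psiDot (ρ 0) α₀)) ∧ ∀ᶠ i in F,
      -score (logSnd (z i) (s i)) (logMean (z i) (s i)) (alphaOne (ρ 0) α₀) =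
        D i * ((mle (c i) (z i)).1 - alphaOne (ρ 0) α₀) := by
  have hev : ∀ᶠ i in F, ∃ x ∈ uIcc (alphaOne (ρ 0) α₀) (mle (c i) (z i)).1,
      -score (logSnd (z i) (s i)) (logMean (z i) (s i)) (alphaOne (ρ 0) α₀) =
      (-2 / x ^ 2 - 2 * ((expMoment (logSnd (z i) (s i)) 2 x * expMoment (logSnd (z i) (s i)) 0 x -
        expMoment (logSnd (z i) (s i)) 1 x ^ 2) / expMoment (logSnd (z i) (s i)) 0 x ^ 2)) *
      ((mle (c i) (z i)).1 - alphaOne (ρ 0) α₀) := by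
    filter_upwards [h.eventually_mle_mem c one_pos] with i hi
    obtain ⟨x, hx, e⟩ := exists_hasDerivAt_eq_sub h.alphaOne_pos hi.2.1
      (fun x hx => hasDerivAt_score (h.size_pos i) (logSnd (z i) (s i)) (logMean (z i) (s i)) hx)
    exact ⟨x, hx, by rw [← e, hi.2.2.1, zero_sub]⟩
  -- Intermediate points are chosen for every index; where none exists the value is arbitrary, which
  -- is harmless along the filter.
  choose! x hx using fun i (hi : ∃ x ∈ uIcc (alphaOne (ρ 0) α₀) (mle (c i) (z i)).1,
      -score (logSnd (z i) (s i)) (logMean (z i) (s i)) (alphaOne (ρ 0) α₀) =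
      (-2 / x ^ 2 - 2 * ((expMoment (logSnd (z i) (s i)) 2 x * expMoment (logSnd (z i) (s i)) 0 x -
        expMoment (logSnd (z i) (s i)) 1 x ^ 2) / expMoment (logSnd (z i) (s i)) 0 x ^ 2)) *
      ((mle (c i) (z i)).1 - alphaOne (ρ 0) α₀)) => hi
  have hlim : Tendsto x F (𝓝 (alphaOne (ρ 0) α₀)) :=
    tendsto_of_mem_uIcc (h.tendsto_mle c) (hev.mono fun i hi => (hx i hi).1)
  refine ⟨_, ?_, hev.mono fun i hi => (hx i hi).2⟩
  have hα₁ := h.alphaOne_pos.ne'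
  have hU := h.Upsilon_varpi_pos.ne'
  have hα := h.alpha_pos.ne'
  have t := ((tendsto_const_nhds (x := (-2 : ℝ))).div (hlim.pow 2) (pow_ne_zero 2 hα₁)).sub
    (((((h.tendsto_expMoment_two_apply hlim).mul (h.tendsto_expMoment_zero_apply hlim)).sub
    ((h.tendsto_expMoment_one_apply hlim).pow 2)).div ((h.tendsto_expMoment_zero_apply hlim).pow 2)
    (pow_ne_zero 2 hU)).const_mul 2)
  convert! t using 2
  rw [psiDot]
  congr 1
  field_simp

end IsConvergentSample

/-! ### The matrices -/

lemma sOne_eq {ρ₀ α₀ : ℝ} (hU : 0 < Upsilon ρ₀ (varpi ρ₀)) :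
    sOne ρ₀ α₀ = (Upsilon ρ₀ (varpi ρ₀) / 2) ^ (-1 / alphaOne ρ₀ α₀) := by
  rw [sOne, show (2 / Upsilon ρ₀ (varpi ρ₀)) = (Upsilon ρ₀ (varpi ρ₀) / 2)⁻¹ by rw [inv_div],
    Real.inv_rpow (by positivity), ← Real.rpow_neg (by positivity), neg_div]

lemma matMbc_row_zero (ρ₀ α₀ : ℝ) : matMbc ρ₀ α₀ 0 = (1 / varpi ρ₀) • matM ρ₀ α₀ 0 := by
  ext j
  simp [matMbc, Matrix.mul_apply, Fin.sum_univ_two]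

/-- The entry `log s₁ / α₁` of the correction cancels every `log z₀` term. What remains is the form
delivered by linearizing the scale equation: the fluctuation of the moment at `α₁`, less its slope
times that of `α̂`. -/
lemma matMbc_row_one {ρ₀ α₀ : ℝ} (hα₀ : 0 < α₀) (hα : 0 < alphaOne ρ₀ α₀)
    (hU : 0 < Upsilon ρ₀ (varpi ρ₀)) (hD : psiDot ρ₀ α₀ ≠ 0) :
    matMbc ρ₀ α₀ 1 = (-(1 / alphaOne ρ₀ α₀ * (Upsilon ρ₀ (varpi ρ₀))⁻¹)) •
      (![0, 1, 0, 0] - (-deriv (Upsilon ρ₀) (varpi ρ₀) / α₀) • matM ρ₀ α₀ 0) := by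
  have hs : 0 < sOne ρ₀ α₀ := by rw [sOne_eq hU]; exact Real.rpow_pos_of_pos (by positivity) _
  have hlog : Real.log (sOne ρ₀ α₀) =
      -Real.log (Upsilon ρ₀ (varpi ρ₀) / 2) / alphaOne ρ₀ α₀ := by
    rw [sOne_eq hU, Real.log_rpow (by positivity)]; ring
  have hpow : (Upsilon ρ₀ (varpi ρ₀) / 2) ^ (-1 / alphaOne ρ₀ α₀ - 1) =
      sOne ρ₀ α₀ / (Upsilon ρ₀ (varpi ρ₀) / 2) := by
    rw [Real.rpow_sub (by positivity), Real.rpow_one, sOne_eq hU]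
  have hU' := hU.ne'
  have hα' := hα.ne'
  have hrow : matM ρ₀ α₀ 0 = ![-(2 / Upsilon ρ₀ (varpi ρ₀)) / psiDot ρ₀ α₀,
      -(2 * deriv (Upsilon ρ₀) (varpi ρ₀) / (α₀ * Upsilon ρ₀ (varpi ρ₀) ^ 2)) / psiDot ρ₀ α₀,
      1 / psiDot ρ₀ α₀, 1 / psiDot ρ₀ α₀] := rfl
  rw [hrow]
  ext j
  fin_cases j <;>
  simp [matMbc, matM, Matrix.mul_apply, Fin.sum_univ_two, hlog, hpow, ← sOne_eq hU] <;>
  field_simp <;> ring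

/-- Here `ϖ = 1` and `Υ_1(1) = 2`, so `s₁ = 1` and the correction matrix is the identity. -/
lemma matMbc_one (α₀ : ℝ) : matMbc 1 α₀ = matM 1 α₀ := by
  have hs : sOne 1 α₀ = 1 := by
    rw [sOne, varpi_one, Upsilon_one_one, div_self two_ne_zero, Real.one_rpow]
  rw [matMbc, hs, varpi_one]
  ext i j
  fin_cases i <;> simp [Matrix.mul_apply, Fin.sum_univ_two]

lemma two_mul_pi_sq_sub_three_pos : 0 < 2 * Real.pi ^ 2 - 3 := by
  nlinarith [Real.pi_gt_three]

lemma psiDot_one {α₀ : ℝ} (hα₀ : 0 < α₀) :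
    psiDot 1 α₀ = -(2 * Real.pi ^ 2 - 3) / (6 * α₀ ^ 2) := by
  have h := logDeriv_Upsilon_one_deriv_one
  rw [psiDot, alphaOne, varpi_one, one_mul]
  rw [Upsilon_one_one] at h ⊢
  have e : deriv (deriv (Upsilon 1)) 1 * 2 - deriv (Upsilon 1) 1 ^ 2 =
      4 * (Real.pi ^ 2 / 6 - 5 / 4) := by linarith
  rw [e]
  field_simp
  ring

lemma matM_one {α₀ : ℝ} (hα₀ : 0 < α₀) : matM 1 α₀ = matMOne α₀ := by
  have hpi := two_mul_pi_sq_sub_three_pos.ne'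
  have hα := hα₀.ne'
  -- Making `2π² - 3` an atom lets denominators be cleared with a single nonvanishing fact.
  obtain ⟨q, hq⟩ : ∃ q, 2 * Real.pi ^ 2 - 3 = q := ⟨_, rfl⟩
  have hq' : 3 - 2 * Real.pi ^ 2 = -q := by rw [← hq]; ring
  rw [hq] at hpi
  ext i j
  simp only [matM, psiDot_one hα₀, alphaOne, varpi_one, one_mul, Upsilon_one_one,
    deriv_Upsilon_one_one, div_self (two_ne_zero (α := ℝ)), Real.one_rpow, Real.log_one, matMOne, hq, hq']
  fin_cases i <;> fin_cases j <;> simp <;> field_simp <;> ring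

lemma gVec_zero {k : ℕ} {z : Fin k → ℝ × ℝ} (hz : ∀ i, 0 < (z i).2) {s : ℝ} (hs : 0 < s)
    (ρ : ℝ → ℝ) (α₀ v : ℝ) : gVec ρ α₀ v s z 0 =
      v * (expMoment (logSnd z s) 1 (alphaOne (ρ 0) α₀) - fwIntegral ρ α₀
        (fun p => p.2 ^ (-alphaOne (ρ 0) α₀) * Real.log p.2)) := by
  rw [← empMean_rpow_mul_log hz hs]; rfl

lemma gVec_one {k : ℕ} {z : Fin k → ℝ × ℝ} (hz : ∀ i, 0 < (z i).2) {s : ℝ} (hs : 0 < s)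
    (ρ : ℝ → ℝ) (α₀ v : ℝ) : gVec ρ α₀ v s z 1 =
      v * (expMoment (logSnd z s) 0 (alphaOne (ρ 0) α₀) - fwIntegral ρ α₀
        (fun p => p.2 ^ (-alphaOne (ρ 0) α₀))) := by
  rw [← empMean_rpow hz hs]; rfl

lemma gVec_two_add_three {k : ℕ} (z : Fin k → ℝ × ℝ) (s : ℝ) (ρ : ℝ → ℝ) (α₀ v : ℝ) :
    gVec ρ α₀ v s z 2 + gVec ρ α₀ v s z 3 = v * (logMean z s -
      (fwIntegral ρ α₀ (fun p => Real.log p.1) + fwIntegral ρ α₀ (fun p => Real.log p.2))) := by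
  change v * (empMean z s (fun p => Real.log p.2) - fwIntegral ρ α₀ (fun p => Real.log p.2)) +
    v * (empMean z s (fun p => Real.log p.1) - fwIntegral ρ α₀ (fun p => Real.log p.1)) = _
  rw [logMean]
  ring

/-! ### Linear expansions of the shape and scale estimators. -/

namespace IsConvergentSample

variable {ι : Type*} {F : Filter ι} {ρ : ℝ → ℝ} {α₀ am ap : ℝ} {k : ι → ℕ}
  {z : (i : ι) → Fin (k i) → ℝ × ℝ} {s : ι → ℝ}

/-- The population score vanishes at `α₁`, so the empirical score there is a difference of averages
and their limits. The ratio is split exactly as `A_n / B_n - A / U = (A_n - A) / B_n - A (B_n - U) /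
(B_n U)`; there is no Taylor remainder, only coefficients that converge. -/
lemma exists_shape_expansion (h : IsConvergentSample F ρ α₀ am ap k z s) (c v : ι → ℝ) :
    ∃ cf : ι → Fin 4 → ℝ, Tendsto cf F (𝓝 (matM (ρ 0) α₀ 0)) ∧ ∀ᶠ i in F,
      v i * ((mle (c i) (z i)).1 - alphaOne (ρ 0) α₀) =
        cf i ⬝ᵥ gVec ρ α₀ (v i) (s i) (z i) := by
  obtain ⟨D, hD, hDe⟩ := h.exists_score_slope c
  have hD0 := h.psiDot_neg.ne
  have hU := h.Upsilon_varpi_pos.ne'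
  have hα := h.alpha_pos.ne'
  have hw := h.varpi_pos.ne'
  have hα₁ := h.alphaOne_pos.ne'
  set U := Upsilon (ρ 0) (varpi (ρ 0)) with hUdef
  set A := -deriv (Upsilon (ρ 0)) (varpi (ρ 0)) / α₀ with hA
  set B : ι → ℝ := fun i => expMoment (logSnd (z i) (s i)) 0 (alphaOne (ρ 0) α₀) with hB
  have hBt : Tendsto B F (𝓝 U) := h.tendsto_expMoment_zero_apply tendsto_const_nhds
  refine ⟨fun i => ![-2 / (B i * D i), 2 * A / (B i * U * D i), 1 / D i, 1 / D i], ?_, ?_⟩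
  · have t0 : Tendsto (fun i => -2 / (B i * D i)) F (𝓝 (matM (ρ 0) α₀ 0 0)) := by
      have := (tendsto_const_nhds (x := (-2 : ℝ))).div (hBt.mul hD) (mul_ne_zero hU hD0)
      convert! this using 2
      simp [matM, ← hUdef]
      field_simp
    have t1 : Tendsto (fun i => 2 * A / (B i * U * D i)) F (𝓝 (matM (ρ 0) α₀ 0 1)) := by
      have := (tendsto_const_nhds (x := 2 * A)).div ((hBt.mul_const U).mul hD)
        (mul_ne_zero (mul_ne_zero hU hU) hD0)
      convert! this using 2
      simp [matM, hA, ← hUdef]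
      field_simp
    have t2 : Tendsto (fun i => 1 / D i) F (𝓝 (psiDot (ρ 0) α₀)⁻¹) := by
      simpa using hD.inv₀ hD0
    refine tendsto_pi_nhds.2 fun j => ?_
    fin_cases j
    · exact t0
    · exact t1
    · simpa [matM] using t2
    · simpa [matM] using t2
  -- The population score equation, which is `Π(ϖ) = 0` multiplied by `2 / α₀`.
  · have hPi : 2 / alphaOne (ρ 0) α₀ + 2 * (A / U) - (fwIntegral ρ α₀ (fun p => Real.log p.1) +
        fwIntegral ρ α₀ (fun p => Real.log p.2)) = 0 := by
      have h0 := (varpi_spec h.welsch.zero_mem).2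
      rw [PiFun, ← hUdef] at h0
      have e : 2 / alphaOne (ρ 0) α₀ + 2 * (A / U) - (fwIntegral ρ α₀ (fun p => Real.log p.1) +
        fwIntegral ρ α₀ (fun p => Real.log p.2)) = 2 / α₀ * (1 / varpi (ρ 0) -
          deriv (Upsilon (ρ 0)) (varpi (ρ 0)) / U + ρ 0 / 2 - Real.eulerMascheroniConstant) := by
        rw [fwIntegral_log_fst h.welsch h.alpha_pos, fwIntegral_log_snd h.welsch h.alpha_pos,
          alphaOne, hA]
        field_simp
        ring
      rw [e, h0, mul_zero]
    filter_upwards [hDe, hD.eventually_ne hD0] with i hi hDi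
    have hz : ∀ j, 0 < (z i j).2 := fun j => (h.sample_pos i j).2
    have hBi : B i ≠ 0 := (expMoment_zero_pos (h.size_pos i) _ _).ne'
    have g0 := gVec_zero hz (h.scale_pos i) ρ α₀ (v i)
    have g1 := gVec_one hz (h.scale_pos i) ρ α₀ (v i)
    have g23 := gVec_two_add_three (z i) (s i) ρ α₀ (v i)
    rw [fwIntegral_rpow_mul_log h.welsch h.alpha_pos h.alphaOne_pos, h.alphaOne_div, ← hA] at g0
    rw [fwIntegral_rpow h.welsch h.alpha_pos h.alphaOne_pos, h.alphaOne_div, ← hUdef] at g1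
    have e1 : (mle (c i) (z i)).1 - alphaOne (ρ 0) α₀ =
        -score (logSnd (z i) (s i)) (logMean (z i) (s i)) (alphaOne (ρ 0) α₀) / D i := by
      rw [hi, mul_div_cancel_left₀ _ hDi]
    have e2 : (![-2 / (B i * D i), 2 * A / (B i * U * D i), 1 / D i, 1 / D i] : Fin 4 → ℝ) ⬝ᵥ
        gVec ρ α₀ (v i) (s i) (z i) = -2 / (B i * D i) * gVec ρ α₀ (v i) (s i) (z i) 0 +
        2 * A / (B i * U * D i) * gVec ρ α₀ (v i) (s i) (z i) 1 +
        1 / D i * (gVec ρ α₀ (v i) (s i) (z i) 2 + gVec ρ α₀ (v i) (s i) (z i) 3) := by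
      simp [dotProduct, Fin.sum_univ_four]
      ring
    rw [e1, e2, g0, g1, g23, score]
    change _ = _ * (v i * (_ - A)) + _ * (v i * (B i - U)) + _
    change v i * (-(_ + 2 * (_ / B i) - _) / D i) = _
    have e3 : 2 / alphaOne (ρ 0) α₀ = (fwIntegral ρ α₀ (fun p => Real.log p.1) +
        fwIntegral ρ α₀ (fun p => Real.log p.2)) - 2 * (A / U) := by linarith
    rw [e3]
    field_simp
    ring

/-- The scale equation gives `log (σ̂ / s) = (log 2 - log B) / α̂`, and the correction contributes
`(log U - log 2) / α̂`; the two `log 2` cancel. -/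
lemma sigmaTilde_div {θ : ℝ × ℝ} {s B U : ℝ} (hθ : 0 < θ.1) (hτ : 0 < θ.2 / s)
    (hB : 0 < B) (h2 : (θ.2 / s) ^ θ.1 * B = 2) (hU : 0 < U) :
    θ.2 * (U / 2) ^ (1 / θ.1) / s = Real.exp ((Real.log U - Real.log B) / θ.1) := by
  have h3 : θ.1 * Real.log (θ.2 / s) + Real.log B = Real.log 2 := by
    rw [← h2, Real.log_mul (Real.rpow_pos_of_pos hτ _).ne' hB.ne', Real.log_rpow hτ]
  rw [mul_div_right_comm, Real.rpow_def_of_pos (by positivity), ← Real.exp_log hτ, ← Real.exp_add,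
    Real.log_div hU.ne' two_ne_zero, ← h3]
  congr 1
  field_simp
  ring

/-- The relative scale is `exp L` with `L` tending to 0. Difference quotients of `exp` and `log`,
and a mean value for the moment, turn `exp L - 1` into an exact combination of centred averages and
the plug-in error in `log Υ_r(ϖ_r)`. -/
lemma exists_scale_expansion (h : IsConvergentSample F ρ α₀ am ap k z s) (c : ι → ℝ)
    {v r : ι → ℝ} (hr_mem : ∀ i, r i ∈ Icc (0 : ℝ) 1) (hr : Tendsto r F (𝓝 (ρ 0)))
    (hvr : Tendsto (fun i => v i * (r i - ρ 0)) F (𝓝 0)) :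
    ∃ (cf : ι → Fin 4 → ℝ) (e : ι → ℝ), Tendsto cf F (𝓝 (matMbc (ρ 0) α₀ 1)) ∧
      Tendsto e F (𝓝 0) ∧ ∀ᶠ i in F,
      v i * (sigmaTilde (mle (c i) (z i)) (r i) / s i - 1) =
        cf i ⬝ᵥ gVec ρ α₀ (v i) (s i) (z i) + e i := by
  obtain ⟨cf, hcf, hcfe⟩ := h.exists_shape_expansion c v
  have hρ := h.welsch.zero_mem
  have hU := h.Upsilon_varpi_pos
  have hα₁ := h.alphaOne_pos
  have hα := h.tendsto_mle c
  set U := Upsilon (ρ 0) (varpi (ρ 0)) with hUdef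
  set a : ι → ℝ := fun i => (mle (c i) (z i)).1 with ha
  set B : ι → ℝ := fun i => expMoment (logSnd (z i) (s i)) 0 (a i) with hB
  have hBt : Tendsto B F (𝓝 U) := h.tendsto_expMoment_zero_apply hα
  have hr' : Tendsto r F (𝓝[Icc 0 1] (ρ 0)) :=
    tendsto_nhdsWithin_iff.2 ⟨hr, Eventually.of_forall hr_mem⟩
  have hUr : Tendsto (fun i => Upsilon (r i) (varpi (r i))) F (𝓝 U) :=
    (continuousOn_Upsilon_varpi (ρ 0) hρ).tendsto.comp hr'
  have hUpos : ∀ i, 0 < Upsilon (r i) (varpi (r i)) := fun i =>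
    Upsilon_pos (hr_mem i) (by linarith [(varpi_spec (hr_mem i)).1])
  set L : ι → ℝ := fun i => (Real.log (Upsilon (r i) (varpi (r i))) - Real.log (B i)) / a i with hL
  have hLt : Tendsto L F (𝓝 0) := by
    have := ((hUr.log hU.ne').sub (hBt.log hU.ne')).div hα hα₁.ne'
    rwa [sub_self, zero_div] at this
  -- `dslope` is continuous at the base point and takes the derivative as its value there, so no
  -- case distinction is needed when `L i = 0`; the same holds for `κ`.
  set E : ι → ℝ := fun i => dslope Real.exp 0 (L i) with hE
  have hEt : Tendsto E F (𝓝 1) := by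
    have h1 : Tendsto (dslope Real.exp 0) (𝓝 0) (𝓝 (dslope Real.exp 0 0)) :=
      continuousAt_dslope_same.2 Real.differentiable_exp.differentiableAt
    rw [dslope_same, Real.deriv_exp, Real.exp_zero] at h1
    exact h1.comp hLt
  set κ : ι → ℝ := fun i => dslope Real.log U (B i) with hκ
  have hκt : Tendsto κ F (𝓝 U⁻¹) := by
    have h1 : Tendsto (dslope Real.log U) (𝓝 U) (𝓝 (dslope Real.log U U)) :=
      continuousAt_dslope_same.2 (Real.differentiableAt_log hU.ne')
    rw [dslope_same, Real.deriv_log] at h1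
    exact h1.comp hBt
  have hev : ∀ᶠ i in F, ∃ x ∈ uIcc (alphaOne (ρ 0) α₀) (a i),
      B i - expMoment (logSnd (z i) (s i)) 0 (alphaOne (ρ 0) α₀) =
        -expMoment (logSnd (z i) (s i)) 1 x * (a i - alphaOne (ρ 0) α₀) := by
    filter_upwards [h.eventually_mle_mem c one_pos] with i hi
    exact exists_hasDerivAt_eq_sub hα₁ hi.2.1 fun x _ => hasDerivAt_expMoment _ 0 x
  choose! x hx using fun i (hi : ∃ x ∈ uIcc (alphaOne (ρ 0) α₀) (a i),
      B i - expMoment (logSnd (z i) (s i)) 0 (alphaOne (ρ 0) α₀) =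
        -expMoment (logSnd (z i) (s i)) 1 x * (a i - alphaOne (ρ 0) α₀)) => hi
  have hxt : Tendsto x F (𝓝 (alphaOne (ρ 0) α₀)) :=
    tendsto_of_mem_uIcc hα (hev.mono fun i hi => (hx i hi).1)
  set A : ι → ℝ := fun i => expMoment (logSnd (z i) (s i)) 1 (x i) with hA
  have hAt := h.tendsto_expMoment_one_apply hxt
  -- The plug-in error is of the order of `r - ρ₀`, hence negligible even after multiplication by
  -- `v`.
  have hvU : Tendsto (fun i => v i * (Real.log (Upsilon (r i) (varpi (r i))) - Real.log U)) F
      (𝓝 0) := by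
    have hO := (isBigO_refl v F).mul ((log_Upsilon_varpi_sub_isBigO hρ).comp_tendsto hr')
    exact hO.trans_tendsto hvr
  refine ⟨fun i => (-(E i / a i * κ i)) • (![0, 1, 0, 0] - A i • cf i),
    fun i => E i / a i * (v i * (Real.log (Upsilon (r i) (varpi (r i))) - Real.log U)), ?_, ?_, ?_⟩
  · rw [matMbc_row_one h.alpha_pos hα₁ hU h.psiDot_neg.ne]
    exact (((hEt.div hα hα₁.ne').mul hκt).neg).smul (tendsto_const_nhds.sub (hAt.smul hcf))
  · simpa using (hEt.div hα hα₁.ne').mul hvU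
  · filter_upwards [hev, hcfe, h.eventually_mle_mem c one_pos] with i hi hci hmi
    have hBi : 0 < B i := expMoment_zero_pos (h.size_pos i) _ _
    have g1 := gVec_one (fun j => (h.sample_pos i j).2) (h.scale_pos i) ρ α₀ (v i)
    rw [fwIntegral_rpow h.welsch h.alpha_pos h.alphaOne_pos, h.alphaOne_div, ← hUdef] at g1
    have e1 : sigmaTilde (mle (c i) (z i)) (r i) / s i = Real.exp (L i) :=
      sigmaTilde_div hmi.2.1 hmi.2.2.2.1 hBi hmi.2.2.2.2 (hUpos i)
    have e2 : Real.exp (L i) - 1 = L i * E i := by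
      have := sub_smul_dslope Real.exp 0 (L i)
      simpa using this.symm
    have e3 : Real.log (B i) - Real.log U = (B i - U) * κ i :=
      (sub_smul_dslope Real.log U (B i)).symm
    have e4 := (hx i hi).2
    have e5 : (![0, 1, 0, 0] : Fin 4 → ℝ) ⬝ᵥ gVec ρ α₀ (v i) (s i) (z i) =
        gVec ρ α₀ (v i) (s i) (z i) 1 := by
      simp [dotProduct, Fin.sum_univ_four]
    have e6 : L i = ((Real.log (Upsilon (r i) (varpi (r i))) - Real.log U) -
        (Real.log (B i) - Real.log U)) / a i := by rw [hL]; ring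
    rw [e1, e2, smul_dotProduct, sub_dotProduct, smul_dotProduct, e5, ← hci, g1, smul_eq_mul,
      smul_eq_mul, e6, e3]
    have e7 : B i - U = (expMoment (logSnd (z i) (s i)) 0 (alphaOne (ρ 0) α₀) - U) -
      A i * (a i - alphaOne (ρ 0) α₀) := by linarith
    rw [e7]
    ring

/-- The expansion of the bias-corrected estimator along the filter `F`. -/
theorem expansion (h : IsConvergentSample F ρ α₀ am ap k z s) (c : ι → ℝ)
    {v r : ι → ℝ} (hr_mem : ∀ i, r i ∈ Icc (0 : ℝ) 1) (hv : Tendsto v F atTop)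
    (hvr : Tendsto (fun i => v i * (r i - ρ 0)) F (𝓝 0)) :
    (fun i => (![v i * (alphaTilde (mle (c i) (z i)) (r i) - α₀),
        v i * (sigmaTilde (mle (c i) (z i)) (r i) / s i - 1)] : Fin 2 → ℝ) -
      matMbc (ρ 0) α₀ *ᵥ gVec ρ α₀ (v i) (s i) (z i)) =o[F]
        fun i => 1 + ‖gVec ρ α₀ (v i) (s i) (z i)‖ := by
  have hρ := h.welsch.zero_mem
  -- Dividing `v (r - ρ₀) → 0` by `v → ∞` gives consistency of the plug-in.
  have hr : Tendsto r F (𝓝 (ρ 0)) := by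
    have h1 := hv.inv_tendsto_atTop.mul hvr
    rw [zero_mul] at h1
    refine tendsto_sub_nhds_zero_iff.1 (h1.congr' ?_)
    filter_upwards [hv.eventually_gt_atTop 0] with i hi
    rw [Pi.inv_apply, inv_mul_cancel_left₀ hi.ne']
  have hr' : Tendsto r F (𝓝[Icc 0 1] (ρ 0)) :=
    tendsto_nhdsWithin_iff.2 ⟨hr, Eventually.of_forall hr_mem⟩
  have hw : Tendsto (fun i => varpi (r i)) F (𝓝 (varpi (ρ 0))) :=
    (continuousOn_varpi (ρ 0) hρ).tendsto.comp hr'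
  have hvw : Tendsto (fun i => v i * (varpi (r i) - varpi (ρ 0))) F (𝓝 0) :=
    ((isBigO_refl v F).mul ((varpi_sub_isBigO hρ).comp_tendsto hr')).trans_tendsto hvr
  obtain ⟨cf, hcf, hcfe⟩ := h.exists_shape_expansion c v
  obtain ⟨cf', e, hcf', he, hcfe'⟩ := h.exists_scale_expansion c hr_mem hr hvr
  refine isLittleO_pi.2 fun j => ?_
  fin_cases j
  · have t1 : Tendsto (fun i => (1 / varpi (r i)) • cf i) F (𝓝 (matMbc (ρ 0) α₀ 0)) := by
      rw [matMbc_row_zero]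
      exact (tendsto_const_nhds.div hw h.varpi_pos.ne').smul hcf
    -- From `α̃ - α₀ = (α̂ - α₁) / ϖ_r - α₀ (ϖ_r - ϖ) / ϖ_r`; this is the second term, scaled by
    -- `v`.
    have t2 : Tendsto (fun i => -α₀ / varpi (r i) * (v i * (varpi (r i) - varpi (ρ 0)))) F
        (𝓝 0) := by
      simpa using ((tendsto_const_nhds (x := -α₀)).div hw h.varpi_pos.ne').mul hvw
    refine isLittleO_of_dotProduct t1 t2 (hcfe.mono fun i hi => ?_)
    have hwi := (varpi_spec (hr_mem i)).1.ne'
    rw [smul_dotProduct, ← hi]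
    simp [alphaTilde, alphaOne]
    field_simp
    ring
  · exact isLittleO_of_dotProduct hcf' he (hcfe'.mono fun i hi => by simpa using hi)

end IsConvergentSample

/-! ### Convergence in probability along a filter on `ℕ × Ω` -/

section ProbFilter

variable {Ω Ω' : Type*} [MeasurableSpace Ω] [MeasurableSpace Ω']

/-- The filter of the events whose probability tends to one. -/
def probFilter (μ : Measure Ω) : Filter (ℕ × Ω) where
  sets := {A | Tendsto (fun n => μ {ω | (n, ω) ∉ A}) atTop (𝓝 0)}
  univ_sets := by simp
  sets_of_superset := fun {A B} hA hAB =>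
    tendsto_of_tendsto_of_tendsto_of_le_of_le tendsto_const_nhds hA (fun _ => zero_le)
      fun _ => measure_mono fun _ hω h => hω (hAB h)
  inter_sets := fun {A B} hA hB => by
    have h := Tendsto.add (show Tendsto _ _ _ from hA) (show Tendsto _ _ _ from hB)
    rw [add_zero] at h
    refine tendsto_of_tendsto_of_tendsto_of_le_of_le tendsto_const_nhds h (fun _ => zero_le)
      fun n => (measure_mono fun ω hω => ?_).trans (measure_union_le _ _)
    by_cases hωA : (n, ω) ∈ A
    · exact Or.inr fun hωB => hω ⟨hωA, hωB⟩
    · exact Or.inl hωA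

variable {μ : Measure Ω} {μ' : Measure Ω'}

lemma eventually_probFilter {p : ℕ × Ω → Prop} :
    (∀ᶠ x in probFilter μ, p x) ↔ Tendsto (fun n => μ {ω | ¬ p (n, ω)}) atTop (𝓝 0) := Iff.rfl

lemma tendsto_fst_probFilter : Tendsto Prod.fst (probFilter μ) atTop := by
  intro A hA
  refine tendsto_const_nhds.congr' ?_
  filter_upwards [mem_atTop_sets.2 (mem_atTop_sets.1 hA)] with n hn
  have : {ω : Ω | (n, ω) ∉ Prod.fst ⁻¹' A} = ∅ := by
    ext ω
    simpa using hn
  rw [this, measure_empty]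

lemma tendsto_probFilter_of_tendstoInMeasure {E : Type*} [PseudoMetricSpace E] {f : ℕ → Ω → E}
    {a : E} (h : TendstoInMeasure μ f atTop fun _ => a) :
    Tendsto (fun x : ℕ × Ω => f x.1 x.2) (probFilter μ) (𝓝 a) := by
  rw [Metric.tendsto_nhds]
  intro ε hε
  rw [eventually_probFilter]
  simpa only [not_lt] using tendstoInMeasure_iff_dist.1 h ε hε

variable [IsProbabilityMeasure μ] [IsProbabilityMeasure μ']

lemma limsup_measure_le_of_tendstoInDistribution {E : Type*} [PseudoEMetricSpace E]
    [MeasurableSpace E] [BorelSpace E] {X : ℕ → Ω → E} {W : Ω' → E}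
    (h : TendstoInDistribution X atTop W (fun _ => μ) μ') {C : Set E} (hC : IsClosed C) :
    limsup (fun n => μ (X n ⁻¹' C)) atTop ≤ μ' (W ⁻¹' C) := by
  have h1 := ProbabilityMeasure.limsup_measure_closed_le_of_tendsto h.tendsto hC
  simp only [ProbabilityMeasure.coe_mk] at h1
  rw [Measure.map_apply_of_aemeasurable h.aemeasurable_limit hC.measurableSet] at h1
  simpa only [Measure.map_apply_of_aemeasurable (h.forall_aemeasurable _) hC.measurableSet] using h1

/-- The set of points at distance at least `ε` from `a` is closed and null for the limit, so the
portmanteau inequality suffices. -/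
lemma tendstoInMeasure_of_tendstoInDistribution_const {X : ℕ → Ω → ℝ} {a : ℝ}
    (h : TendstoInDistribution X atTop (fun _ : Ω' => a) (fun _ => μ) μ') :
    TendstoInMeasure μ X atTop fun _ => a := by
  rw [tendstoInMeasure_iff_dist]
  intro ε hε
  have hC : IsClosed {x : ℝ | ε ≤ dist x a} := isClosed_le (by fun_prop) (by fun_prop)
  have h1 := limsup_measure_le_of_tendstoInDistribution h hC
  have h2 : (fun _ : Ω' => a) ⁻¹' {x : ℝ | ε ≤ dist x a} = ∅ := by
    ext; simp [hε]
  rw [h2, measure_empty, nonpos_iff_eq_zero] at h1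
  exact tendsto_of_le_liminf_of_limsup_le zero_le h1.le

/-- Tightness: complements of large open balls are closed and have small mass under the limit, and
the portmanteau inequality passes this to the sequence. -/
lemma exists_eventually_measure_norm_ge_lt {E : Type*} [SeminormedAddCommGroup E]
    [MeasurableSpace E] [BorelSpace E] {X : ℕ → Ω → E} {W : Ω' → E}
    (h : TendstoInDistribution X atTop W (fun _ => μ) μ') {δ : ENNReal} (hδ : 0 < δ) :
    ∃ K : ℕ, ∀ᶠ n in atTop, μ {ω | (K : ℝ) ≤ ‖X n ω‖} < δ := by
  have hC : ∀ K : ℕ, IsClosed {x : E | (K : ℝ) ≤ ‖x‖} := fun K =>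
    isClosed_le (by fun_prop) (by fun_prop)
  have h1 : Tendsto (fun K : ℕ => μ'.map W {x : E | (K : ℝ) ≤ ‖x‖}) atTop
      (𝓝 (μ'.map W (⋂ K : ℕ, {x : E | (K : ℝ) ≤ ‖x‖}))) := by
    have := Measure.isProbabilityMeasure_map h.aemeasurable_limit
    refine tendsto_measure_iInter_atTop (fun K => (hC K).measurableSet.nullMeasurableSet)
      (fun m n hmn x hx => ?_) ⟨0, measure_ne_top _ _⟩
    exact (show (m : ℝ) ≤ n by exact_mod_cast hmn).trans hx
  have h2 : (⋂ K : ℕ, {x : E | (K : ℝ) ≤ ‖x‖}) = ∅ := by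
    refine eq_empty_of_forall_notMem fun x hx => ?_
    obtain ⟨K, hK⟩ := exists_nat_gt ‖x‖
    exact not_le.2 hK (mem_iInter.1 hx K)
  rw [h2, measure_empty] at h1
  obtain ⟨K, hK⟩ := (h1.eventually_lt_const hδ).exists
  rw [Measure.map_apply_of_aemeasurable h.aemeasurable_limit (hC K).measurableSet] at hK
  exact ⟨K, eventually_lt_of_limsup_lt
    ((limsup_measure_le_of_tendstoInDistribution h (hC K)).trans_lt hK)⟩

/-- A remainder that is `o(1 + ‖X‖)` with `X` convergent in distribution tends to zero in
probability. -/
lemma tendstoInMeasure_of_isLittleO {E E' : Type*} [SeminormedAddCommGroup E] [MeasurableSpace E]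
    [BorelSpace E] [SeminormedAddCommGroup E'] {X : ℕ → Ω → E} {W : Ω' → E} {R : ℕ → Ω → E'}
    (h : TendstoInDistribution X atTop W (fun _ => μ) μ')
    (hR : (fun x : ℕ × Ω => R x.1 x.2) =o[probFilter μ] fun x => 1 + ‖X x.1 x.2‖) :
    TendstoInMeasure μ R atTop fun _ => 0 := by
  rw [tendstoInMeasure_iff_norm]
  intro ε hε
  rw [ENNReal.tendsto_nhds_zero]
  intro δ hδ
  obtain ⟨K, hK⟩ := exists_eventually_measure_norm_ge_lt h (ENNReal.half_pos hδ.ne')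
  -- With this constant the remainder is at most `ε / 2` wherever `‖X‖ < K`.
  have hR' := eventually_probFilter.1 (isLittleO_iff.1 hR
    (show 0 < ε / (2 * (1 + (K : ℝ))) by positivity))
  filter_upwards [hK, hR'.eventually_lt_const (ENNReal.half_pos hδ.ne')] with n h1 h2
  refine ((measure_mono fun ω hω => ?_).trans (measure_union_le _ _)).trans
    ((add_le_add h1.le h2.le).trans (ENNReal.add_halves δ).le)
  by_contra hne
  simp only [mem_union, mem_ofPred_eq, not_or, not_le] at hne
  obtain ⟨h3, h4⟩ := hne
  have hω' : ε ≤ ‖R n ω‖ := by simpa using hω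
  rw [Real.norm_of_nonneg (by positivity)] at h4
  have h5 : ε / (2 * (1 + (K : ℝ))) * (1 + ‖X n ω‖) ≤ ε / (2 * (1 + (K : ℝ))) * (1 + K) := by
    gcongr
  have h6 : ε / (2 * (1 + (K : ℝ))) * (1 + K) = ε / 2 := by field_simp
  linarith

end ProbFilter

/-! ### Measurability of the estimators -/

section Measurability

variable {Ω : Type*} [MeasurableSpace Ω] {k : ℕ} {Z : Fin k → Ω → ℝ × ℝ}

lemma measurable_expMoment_comp (hZ : ∀ i, Measurable (Z i)) (j : ℕ) {a : Ω → ℝ}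
    (ha : Measurable a) : Measurable fun ω => expMoment (logSnd (fun i => Z i ω) 1) j (a ω) := by
  simp only [expMoment, logSnd]
  fun_prop

lemma measurable_score_comp (hZ : ∀ i, Measurable (Z i)) (a : ℝ) :
    Measurable fun ω => score (logSnd (fun i => Z i ω) 1) (logMean (fun i => Z i ω) 1) a := by
  have h1 := measurable_expMoment_comp hZ 1 (measurable_const (a := a))
  have h0 := measurable_expMoment_comp hZ 0 (measurable_const (a := a))
  simp only [score, logMean, empMean]
  fun_prop

/-- The score is positive near 0 and strictly decreasing, so having a zero is the same as being
negative at some rational. This makes existence of a maximizer a countable union of measurable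
events. -/
lemma exists_isMLE_iff_rat (hk : 0 < k) {z : Fin k → ℝ × ℝ}
    (hz : ∀ i, 0 < (z i).1 ∧ 0 < (z i).2) :
    (∃ θ, IsMLE z θ) ↔ ∃ q : ℚ, 0 < (q : ℝ) ∧ score (logSnd z 1) (logMean z 1) q < 0 := by
  rw [exists_isMLE_iff hk hz one_pos]
  constructor
  · rintro ⟨a, ha, h⟩
    obtain ⟨q, hq, -⟩ := exists_rat_btwn (lt_add_one a)
    exact ⟨q, ha.trans hq, h ▸ score_strictAntiOn hk _ _ ha (ha.trans hq) hq⟩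
  · rintro ⟨q, hq, h⟩
    obtain ⟨a, ha, h0⟩ := exists_score_pos hk (logSnd z 1) (logMean z 1) hq
    obtain ⟨b, hb, hb0⟩ := exists_score_eq_zero hk _ _ ha.1 ha.2.le h0.le h.le
    exact ⟨b, ha.1.trans_le hb.1, hb0⟩

lemma measurableSet_exists_isMLE (hk : 0 < k) (hZ : ∀ i, Measurable (Z i))
    (hpos : ∀ i ω, 0 < (Z i ω).1 ∧ 0 < (Z i ω).2) :
    MeasurableSet {ω | (¬ ∀ i j, Z i ω = Z j ω) ∧ ∃ θ, IsMLE (fun i => Z i ω) θ} := by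
  have h1 : MeasurableSet {ω | ∀ i j, Z i ω = Z j ω} := by
    simp only [ofPred_forall]
    exact MeasurableSet.iInter fun i => MeasurableSet.iInter fun j =>
      measurableSet_eq_fun (hZ i) (hZ j)
  have h2 : MeasurableSet {ω | ∃ θ, IsMLE (fun i => Z i ω) θ} := by
    simp only [exists_isMLE_iff_rat hk (fun i => hpos i _), ofPred_exists]
    exact MeasurableSet.iUnion fun q => (MeasurableSet.const _).inter
      (measurableSet_lt (measurable_score_comp hZ q) measurable_const)
  exact h1.compl.inter h2

lemma mle_of_not {c : ℝ} {z : Fin k → ℝ × ℝ} (hk : 0 < k)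
    (h : ¬ ((¬ ∀ i j, z i = z j) ∧ ∃ θ, IsMLE z θ)) : mle c z = (c, (z ⟨0, hk⟩).2) := by
  rw [mle, dif_neg h, dif_pos hk]

/-- The estimator is obtained by choice, so measurability needs a formula: for `t > 0`, monotonicity
makes `α̂ > t` equivalent to a positive score at `t`. -/
lemma measurable_mle_fst (hk : 0 < k) (hZ : ∀ i, Measurable (Z i))
    (hpos : ∀ i ω, 0 < (Z i ω).1 ∧ 0 < (Z i ω).2) (c : ℝ) :
    Measurable fun ω => (mle c fun i => Z i ω).1 := by
  have hE := measurableSet_exists_isMLE hk hZ hpos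
  refine measurable_of_Ioi fun t => ?_
  set E := {ω | (¬ ∀ i j, Z i ω = Z j ω) ∧ ∃ θ, IsMLE (fun i => Z i ω) θ} with hEdef
  have hset : (fun ω => (mle c fun i => Z i ω).1) ⁻¹' Ioi t =
      (E ∩ {ω | t ≤ 0 ∨
        0 < score (logSnd (fun i => Z i ω) 1) (logMean (fun i => Z i ω) 1) t}) ∪
      (Eᶜ ∩ {_ω | t < c}) := by
    ext ω
    by_cases h : ω ∈ E
    · obtain ⟨a, ha, h0⟩ := (exists_isMLE_iff hk (fun i => hpos i ω) one_pos).1 h.2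
      have e := (mle_spec hk (fun i => hpos i ω) one_pos c h.1 ha h0).1
      simp only [mem_preimage, e, mem_Ioi, mem_union, mem_inter_iff, h, true_and,
        mem_compl_iff, not_true_eq_false, false_and, or_false]
      rcases le_or_gt t 0 with ht | ht
      · exact ⟨fun _ => Or.inl ht, fun _ => ht.trans_lt ha⟩
      · have := (score_strictAntiOn hk (logSnd (fun i => Z i ω) 1)
          (logMean (fun i => Z i ω) 1)).lt_iff_gt (a := a) (b := t) ha ht
        rw [h0] at this
        rw [← this]
        exact ⟨Or.inr, fun h => h.resolve_left (not_le.2 ht)⟩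
    · simp only [mem_preimage, mle_of_not hk h, mem_Ioi, mem_union, mem_inter_iff, h,
        false_and, mem_compl_iff, not_false_eq_true, true_and, false_or, mem_ofPred_eq]
  rw [hset]
  refine (hE.inter ?_).union (hE.compl.inter (MeasurableSet.const _))
  exact (MeasurableSet.const _).union
    (measurableSet_lt measurable_const (measurable_score_comp hZ t))

/-- The scale equation makes `σ̂` an explicit measurable function of `α̂` and the data. -/
lemma measurable_mle_snd (hk : 0 < k) (hZ : ∀ i, Measurable (Z i))
    (hpos : ∀ i ω, 0 < (Z i ω).1 ∧ 0 < (Z i ω).2) (c : ℝ) :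
    Measurable fun ω => (mle c fun i => Z i ω).2 := by
  classical
  have hE := measurableSet_exists_isMLE hk hZ hpos
  have ha := measurable_mle_fst hk hZ hpos c
  have hB := measurable_expMoment_comp hZ 0 ha
  have hfun : (fun ω => (mle c fun i => Z i ω).2) = fun ω =>
      if ω ∈ {ω | (¬ ∀ i j, Z i ω = Z j ω) ∧ ∃ θ, IsMLE (fun i => Z i ω) θ} then
        (2 / expMoment (logSnd (fun i => Z i ω) 1) 0 (mle c fun i => Z i ω).1) ^
          ((mle c fun i => Z i ω).1)⁻¹
      else (Z ⟨0, hk⟩ ω).2 := by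
    ext ω
    split_ifs with h
    · obtain ⟨a, ha, h0⟩ := (exists_isMLE_iff hk (fun i => hpos i ω) one_pos).1 h.2
      obtain ⟨e1, e2, e3⟩ := mle_spec hk (fun i => hpos i ω) one_pos c h.1 ha h0
      rw [div_one] at e3
      rw [e1, ← e3, mul_div_cancel_right₀ _ (expMoment_zero_pos hk _ a).ne',
        Real.rpow_rpow_inv e2.le ha.ne']
    · rw [mle_of_not hk h]
  rw [hfun]
  exact Measurable.ite hE (by fun_prop) (by fun_prop)

/-- For `r` outside `[0, 1]` nothing is known about `ϖ_r`, so measurability must go through the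
restriction. -/
lemma measurable_comp_of_continuousOn_Icc {f : ℝ → ℝ} (hf : ContinuousOn f (Icc 0 1)) {r : Ω → ℝ}
    (hr : Measurable r) (hr_mem : ∀ ω, r ω ∈ Icc (0 : ℝ) 1) : Measurable fun ω => f (r ω) :=
  (continuousOn_iff_continuous_domRestrict.1 hf).measurable.comp (hr.subtype_mk (h := hr_mem))

lemma measurable_estimationError (hk : 0 < k) (hZ : ∀ i, Measurable (Z i))
    (hpos : ∀ i ω, 0 < (Z i ω).1 ∧ 0 < (Z i ω).2) {r : Ω → ℝ} (hr : Measurable r)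
    (hr_mem : ∀ ω, r ω ∈ Icc (0 : ℝ) 1) (c v α₀ σ : ℝ) :
    Measurable fun ω => (![v * (alphaTilde (mle c fun i => Z i ω) (r ω) - α₀),
      v * (sigmaTilde (mle c fun i => Z i ω) (r ω) / σ - 1)] : Fin 2 → ℝ) := by
  have hm1 := measurable_mle_fst hk hZ hpos c
  have hm2 := measurable_mle_snd hk hZ hpos c
  have hw := measurable_comp_of_continuousOn_Icc continuousOn_varpi hr hr_mem
  have hU := measurable_comp_of_continuousOn_Icc continuousOn_Upsilon_varpi hr hr_mem
  have h1 : Measurable fun ω => v * (alphaTilde (mle c fun i => Z i ω) (r ω) - α₀) := by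
    simp only [alphaTilde]
    fun_prop
  have h2 : Measurable fun ω => v * (sigmaTilde (mle c fun i => Z i ω) (r ω) / σ - 1) := by
    simp only [sigmaTilde]
    fun_prop
  refine measurable_pi_iff.2 fun j => ?_
  fin_cases j
  · exact h1
  · exact h2

end Measurability

end FrechetWelsch

/-! ### The main theorem: return from the filter to probability. -/

theorem mainTheorem6
    {Ω Ω' : Type*} [MeasurableSpace Ω] [MeasurableSpace Ω']
    (μ : Measure Ω) [IsProbabilityMeasure μ] (μ' : Measure Ω') [IsProbabilityMeasure μ']
    -- the triangular array of pairs `Z n i = (X n i, Y n i)` with values in `(0,∞)²`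
    (k : ℕ → ℕ) (hk : ∀ n, 2 ≤ k n) (hk_top : Tendsto k atTop atTop)
    (Z : (n : ℕ) → Fin (k n) → Ω → ℝ × ℝ) (hZ_meas : ∀ n i, Measurable (Z n i))
    (hZ_pos : ∀ n i ω, 0 < (Z n i ω).1 ∧ 0 < (Z n i ω).2)
    -- asymptotically, the pairs are not all equal
    (hZ_ties : Tendsto (fun n => μ {ω | ∀ i j, Z n i ω = Z n j ω}) atTop (𝓝 0))
    -- the limit model
    (ρ : ℝ → ℝ) (hρ : IsWelschFunction ρ) (α₀ : ℝ) (hα₀ : 0 < α₀)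
    (σ : ℕ → ℝ) (hσ : ∀ n, 0 < σ n)
    -- weak laws of large numbers on a class of functions
    (am ap : ℝ) (ham : 0 < am) (ham₁ : am < alphaOne (ρ 0) α₀) (hap₁ : alphaOne (ρ 0) α₀ < ap)
    (hLLN : ∀ f ∈ classF2 am ap,
      TendstoInDistribution (fun n ω => empMean (fun i => Z n i ω) (σ n) f) atTop
        (fun _ : Ω => fwIntegral ρ α₀ f) (fun _ => μ) μ)
    -- joint weak convergence of four normalized averages
    (v : ℕ → ℝ) (hv : ∀ n, 0 < v n) (hv_top : Tendsto v atTop atTop)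
    (W : Ω' → Fin 4 → ℝ)
    (hW : TendstoInDistribution (fun n ω => gVec ρ α₀ (v n) (σ n) (fun i => Z n i ω)) atTop
        W (fun _ => μ) μ')
    -- the estimator of `ρ 0`
    (ρhat : ℕ → Ω → ℝ) (hρhat_meas : ∀ n, Measurable (ρhat n))
    (hρhat_mem : ∀ n ω, ρhat n ω ∈ Icc (0 : ℝ) 1)
    (hρhat : TendstoInMeasure μ (fun n ω => v n * (ρhat n ω - ρ 0)) atTop (fun _ => 0))
    -- arbitrary values assigned to the shape estimator when all pairs are equal
    (c : ℕ → ℝ) :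
    let θhat : ℕ → Ω → ℝ × ℝ := fun n ω => mle (c n) (fun i => Z n i ω)
    let err : ℕ → Ω → Fin 2 → ℝ := fun n ω =>
      ![v n * (alphaTilde (θhat n ω) (ρhat n ω) - α₀),
        v n * (sigmaTilde (θhat n ω) (ρhat n ω) / σ n - 1)]
    TendstoInMeasure μ
      (fun n ω => err n ω - matMbc (ρ 0) α₀ *ᵥ gVec ρ α₀ (v n) (σ n) (fun i => Z n i ω))
      atTop (fun _ => 0) ∧
    TendstoInDistribution err atTop (fun ω' => matMbc (ρ 0) α₀ *ᵥ W ω') (fun _ => μ) μ' ∧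
    (ρ 0 = 1 → matMbc (ρ 0) α₀ = matM 1 α₀ ∧ matM 1 α₀ = matMOne α₀) := by
  intro θhat err
  have hk0 : ∀ n, 0 < k n := fun n => by have := hk n; omega
  have hLLN' : ∀ f ∈ classF2 am ap, Tendsto (fun x : ℕ × Ω =>
      empMean (fun i => Z x.1 i x.2) (σ x.1) f) (probFilter μ) (𝓝 (fwIntegral ρ α₀ f)) := by
    intro f hf
    have h := tendstoInMeasure_of_tendstoInDistribution_const (hLLN f hf)
    exact tendsto_probFilter_of_tendstoInMeasure
      (f := fun n ω => empMean (fun i => Z n i ω) (σ n) f) h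
  -- An index is a pair `(n, ω)`, so the deterministic expansion applies to the random sample with
  -- no change.
  have hsample : IsConvergentSample (probFilter μ) ρ α₀ am ap (fun x : ℕ × Ω => k x.1)
      (fun x i => Z x.1 i x.2) (fun x => σ x.1) :=
    { size_pos := fun x => hk0 x.1
      sample_pos := fun x i => hZ_pos x.1 i x.2
      scale_pos := fun x => hσ x.1
      welsch := hρ
      alpha_pos := hα₀
      am_pos := ham
      am_lt := ham₁
      lt_ap := hap₁
      lln := fun f hf => hLLN' f hf
      not_all_eq := eventually_probFilter.2 (by simpa only [not_not] using hZ_ties) }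
  have hexp := hsample.expansion (fun x => c x.1) (v := fun x => v x.1)
    (r := fun x => ρhat x.1 x.2) (fun x => hρhat_mem x.1 x.2)
    (hv_top.comp tendsto_fst_probFilter) (tendsto_probFilter_of_tendstoInMeasure
      (f := fun n ω => v n * (ρhat n ω - ρ 0)) hρhat)
  have hmeas : TendstoInMeasure μ
      (fun n ω => err n ω - matMbc (ρ 0) α₀ *ᵥ gVec ρ α₀ (v n) (σ n) (fun i => Z n i ω))
      atTop (fun _ => 0) := 
    tendstoInMeasure_of_isLittleO (X := fun n ω => gVec ρ α₀ (v n) (σ n) fun i => Z n i ω)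
      (R := fun n ω => err n ω - matMbc (ρ 0) α₀ *ᵥ gVec ρ α₀ (v n) (σ n) (fun i => Z n i ω))
      hW hexp
  refine ⟨hmeas, ?_, fun h1 => ⟨by rw [h1, matMbc_one], matM_one hα₀⟩⟩
  -- Slutsky's lemma: the error differs by `o_P(1)` from a continuous image of `G_n`.
  refine tendstoInDistribution_of_tendstoInMeasure_sub err _
    (hW.continuous_comp (g := fun x => matMbc (ρ 0) α₀ *ᵥ x) (by fun_prop)) hmeas fun n => ?_
  exact (measurable_estimationError (hk0 n) (hZ_meas n) (hZ_pos n) (hρhat_meas n) (hρhat_mem n)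
    (c n) (v n) α₀ (σ n)).aemeasurable
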